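/- Let $\mathcal N$ be a smooth two-dimensional Riemannian manifold without boundary, with distance $|x-y|$, gradient $\nabla$ and Laplace–Beltrami operator $\Delta$. Let $\mathcal B(p;s)=\{x:|x-p|<s\}$, $\overline{\mathcal B}(p;s)=\{x:|x-p|\le s\}$, and $d(x,Q)=\inf_{y\in Q}|x-y|$. Let $K\subset\mathcal N$ be compact (if $\mathcal N$ is compact one may take $K=\mathcal N$), let $I\ge 1$ be an integer and let $C_0>0$. There exist $\epsilon_0>0$ and $C>0$, depending only on $\mathcal N,K,I,C_0$, such that the following holds. Let $p\in K$, $r>0$ and $r^{1/4}<\epsilon<\epsilon_0$. Let $Q=\{q_1,\dots,q_I\}\subset\mathcal N$ satisfy $r^2\le|q_j-p|\le\epsilon r/2$ for all $j$, put $$\Xi=\mathcal B(p;\epsilon^2)\setminus\Big(\overline{\mathcal B}(p;r^2)\cup\bigcup_{j=1}^I\overline{\mathcal B}(q_j;r^2)\Big),$$ and let $w\in C^2(\Xi)$ satisfy the minimal condition with constant $C_0$, that is, for all $x\in\Xi$: (a) $w(x)>0$ and $w(x)\le C_0(|x-p|^2+r^2)$; (b) $d(x,Q)\,|\nabla\log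 w(x)|<C_0$; (c) $|\Delta w(x)|\le C_0w(x)+\dfrac{C_0\,w(x)^3}{d(x,Q)^4}$. Then $$\max_{\partial\mathcal B(p;\epsilon^2/2)}w\le C\min_{\partial\mathcal B(p;\epsilon r)}w,$$ where in particular this maximum and this minimum exist. -/

import Mathlib

open Set Manifold Bundle
open scoped ContDiff ENNReal

noncomputable section

namespace SurfaceHarnack

/-! Riemannian surfaces without boundary: manifolds modelled on `ℝ²` whose tangent spaces carry an
inner product. Geodesic balls and distances are those of the Riemannian distance `edist`. -/

section Calculus

variable {N : Type*} [TopologicalSpace N] [ChartedSpace (EuclideanSpace ℝ (Fin 2)) N]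
  [RiemannianBundle (fun x : N ↦ TangentSpace (𝓡 2) x)]

/-- The differential of a real function at `x`, as a linear form on the tangent space. -/
def differential (f : N → ℝ) (x : N) : TangentSpace (𝓡 2) x →L[ℝ] ℝ :=
  mfderiv (𝓡 2) 𝓘(ℝ, ℝ) f x

instance finiteDimensional_tangentSpace (x : N) :
    FiniteDimensional ℝ (TangentSpace (𝓡 2) x) :=
  inferInstanceAs (FiniteDimensional ℝ (EuclideanSpace ℝ (Fin 2)))

instance completeSpace_tangentSpace (x : N) : CompleteSpace (TangentSpace (𝓡 2) x) :=
  FiniteDimensional.complete ℝ _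

/-- The Riemannian gradient: the vector representing the differential. -/
def grad (f : N → ℝ) (x : N) : TangentSpace (𝓡 2) x :=
  (InnerProductSpace.toDual ℝ (TangentSpace (𝓡 2) x)).symm (differential f x)

/-- The coordinate vector field `∂_i` of the preferred chart at `x₀`, at the point with
coordinates `z`. -/
def coordField (x₀ : N) (i : Fin 2) (z : EuclideanSpace ℝ (Fin 2)) :
    TangentSpace (𝓡 2) ((extChartAt (𝓡 2) x₀).symm z) :=
  mfderiv 𝓘(ℝ, EuclideanSpace ℝ (Fin 2)) (𝓡 2) (extChartAt (𝓡 2) x₀).symm z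
    (EuclideanSpace.single i (1 : ℝ) : EuclideanSpace ℝ (Fin 2))

/-- The matrix `g_{ij}` of the metric in the preferred chart at `x₀`. -/
def gram (x₀ : N) (z : EuclideanSpace ℝ (Fin 2)) : Matrix (Fin 2) (Fin 2) ℝ :=
  Matrix.of fun i j ↦ inner ℝ (coordField x₀ i z) (coordField x₀ j z)

/-- The `i`-th component of a vector field in the preferred chart at `x₀`. -/
def coordComponent (X : ∀ x : N, TangentSpace (𝓡 2) x) (x₀ : N) (i : Fin 2)
    (z : EuclideanSpace ℝ (Fin 2)) : ℝ :=
  (show EuclideanSpace ℝ (Fin 2) from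
    mfderiv (𝓡 2) 𝓘(ℝ, EuclideanSpace ℝ (Fin 2)) (extChartAt (𝓡 2) x₀)
      ((extChartAt (𝓡 2) x₀).symm z) (X ((extChartAt (𝓡 2) x₀).symm z))) i

/-- The Riemannian divergence `(det g)^{-1/2} ∑ᵢ ∂ᵢ ((det g)^{1/2} Xⁱ)`. -/
def divergence (X : ∀ x : N, TangentSpace (𝓡 2) x) (x : N) : ℝ :=
  (√(gram x (extChartAt (𝓡 2) x x)).det)⁻¹ *
    ∑ i : Fin 2, fderiv ℝ (fun z ↦ √(gram x z).det * coordComponent X x i z)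
      (extChartAt (𝓡 2) x x) (EuclideanSpace.single i (1 : ℝ))

/-- The Laplace-Beltrami operator `Δ f = div (∇ f)`. -/
def laplaceBeltrami (f : N → ℝ) (x : N) : ℝ :=
  divergence (fun y ↦ grad f y) x

end Calculus

section Metric

variable {N : Type*} [EMetricSpace N]

/-- The geodesic ball `B(p; s)`. -/
def geodesicBall (p : N) (s : ℝ) : Set N := {x | edist x p < ENNReal.ofReal s}

/-- The closed geodesic ball. -/
def closedGeodesicBall (p : N) (s : ℝ) : Set N := {x | edist x p ≤ ENNReal.ofReal s}

/-- The Riemannian distance as a real number; it is only used for points of one geodesic ball,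
where it is finite. -/
def rdist (x y : N) : ℝ := (edist x y).toReal

/-- The distance from `x` to a set, as a real number; it is only used for a nonempty set and a
point lying in one geodesic ball, where it is finite. -/
def rdistSet (x : N) (A : Set N) : ℝ := (Metric.infEDist x A).toReal

/-- The open set `Ξ`: the annulus `r² < |x| < ε²` around `p` with the closed balls of radius `r²`
around the points `q_j` removed. Closed balls are removed so that
`Ξ` is open and `C²` functions, their gradients and Laplacians make sense at all its points. -/
def holedAnnulus {J : ℕ} (p : N) (r ε : ℝ) (q : Fin J → N) : Set N :=
  geodesicBall p (ε ^ 2) \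
    (closedGeodesicBall p (r ^ 2) ∪ ⋃ j, closedGeodesicBall (q j) (r ^ 2))

end Metric

/-- The minimal condition with constant `C`, for a positive `C²` function `w` on `Ξ` (a domain
around `p`, at scale `r`, with finite set of centres `Q`). -/
structure MinimalCondition {N : Type*} [EMetricSpace N]
    [ChartedSpace (EuclideanSpace ℝ (Fin 2)) N]
    [RiemannianBundle (fun x : N ↦ TangentSpace (𝓡 2) x)]
    (p : N) (r : ℝ) (Q Ξ : Set N) (C : ℝ) (w : N → ℝ) : Prop where
  contMDiffOn : ContMDiffOn (𝓡 2) 𝓘(ℝ, ℝ) 2 w Ξ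
  pos : ∀ x ∈ Ξ, 0 < w x
  quadratic_growth : ∀ x ∈ Ξ, w x ≤ C * (rdist x p ^ 2 + r ^ 2)
  log_gradient : ∀ x ∈ Ξ, rdistSet x Q * ‖grad (fun y ↦ Real.log (w y)) x‖ < C
  laplacian : ∀ x ∈ Ξ, |laplaceBeltrami w x| ≤ C * w x + C * w x ^ 3 / rdistSet x Q ^ 4

end SurfaceHarnack

end

/-!
# A Harnack inequality around clustered singularities on a surface

The proof compares `w` with an explicit logarithmic barrier.

The gradient bound says that `log w` varies by at most a constant along a path whose length is
comparable to its distance from the centres. Hence `w` is comparable, over the sphere of radius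
`ε ^ 2 / 2` around `p`, with its minimum `A` there
(`IsNormalizedChart.le_exp_mul_of_minimalCondition`). It remains to bound `w` from below by a
multiple of `A` on the sphere of radius `ε r`.

The minimal condition implies `Δ w ≤ V w` with the potential `V = C₀ + C₀ w ^ 2 / d(x, Q) ^ 4`, and
the growth condition bounds `V` by a constant times `1 + r ^ 4 / d(x, Q) ^ 4`. So it is enough to
find `u` with `Δ u ≥ V u` where `u > 0`, with `u ≤ 2` up to the outer sphere, with `u ≤ 0` near the
centres `p` and `q j`, and with `u` bounded below on the inner sphere: then `w ≥ A u / 2` by the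
maximum principle (`le_of_laplaceBeltrami_comparison`), as `w - A u / 2` cannot have a negative
minimum, neither inside nor on the boundary. The barrier (`IsNormalizedChart.exists_barrier`) is
`u = 1 + c ∑ (log d_i + 2 C d_i + κ r ^ 2 / d_i - log ε ^ 2 - D) + M d_0 ^ 2`, where the sum is over
the `J + 1` centres, `d_i` is the distance to the `i`-th one and `d_0` that to `p`, and
`c = 1 / ((J + 2) log (ε / r))`.

* At distance `ε r` from `p` the normalized logarithms sum to about `-(J + 1) log (ε / r)`, so that
  `u` is about `1 / (J + 2)`. At distance about `r ^ 2` from a centre the logarithm of that centre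
  is about `-2 log (ε / r)` and the others are at most about `-log (ε / r)`, so that together they
  cancel the `1`, and `-D` makes `u` negative. More precisely `u ≤ c C₂ (d_j / r ^ 2 - 2)` for every
  `j` (`barrier_le_linear`).
* As `log d` is harmonic in the plane, `Δ u` is at least a constant plus `c κ r ^ 2 / (2 d_j ^ 3)`.
  The first term dominates the bounded part of `V u`, and the second, by the linear bound on `u`,
  the part `r ^ 4 u / d_j ^ 4` (`potential_mul_le`).

The Riemannian distance to a centre is awkward to differentiate. It is replaced by the square root
of `quadDist`, the quadratic form of the metric at the centre in a fixed chart, which is smooth and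
comparable with the squared distance; its Laplacian and gradient are Euclidean up to a relative
error of the order of the distance (`IsNormalizedChart.exists_quadDist_estimates`). The term
`2 C d_i` in the barrier absorbs that error. All this takes place in small balls on which one chart
distorts distances by a factor close to `1` (`exists_isNormalizedChart`), and a compact set is
covered by finitely many of these. The computations in a fixed chart rest on the invariance of the
divergence under changes of coordinates (`divergence_eq_chartDivergence`), which is the Piola
identity.
-/

noncomputable section

namespace SurfaceHarnack

/-! ### Partial derivatives in the coordinate plane -/

/-- The coordinate plane, with its Euclidean norm. -/
abbrev Plane : Type := EuclideanSpace ℝ (Fin 2)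

/-- The `i`-th coordinate vector of the plane. -/
abbrev basisVec (i : Fin 2) : Plane := EuclideanSpace.single i (1 : ℝ)

/-- The `i`-th partial derivative of a function on the plane. -/
def pd (i : Fin 2) (F : Plane → ℝ) (z : Plane) : ℝ := fderiv ℝ F z (basisVec i)

lemma eq_sum_basisVec (v : Plane) : v = v 0 • basisVec 0 + v 1 • basisVec 1 := by
  ext i
  fin_cases i <;> simp [basisVec]

lemma fderiv_apply_eq (F : Plane → ℝ) (z v : Plane) :
    fderiv ℝ F z v = v 0 * pd 0 F z + v 1 * pd 1 F z := by
  conv_lhs => rw [eq_sum_basisVec v]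
  simp [pd]

lemma Filter.EventuallyEq.pd_eq {F G : Plane → ℝ} {z : Plane} (h : F =ᶠ[nhds z] G) (i : Fin 2) :
    pd i F z = pd i G z := by
  simp [pd, h.fderiv_eq]

lemma pd_add {F G : Plane → ℝ} {z : Plane} (hF : DifferentiableAt ℝ F z)
    (hG : DifferentiableAt ℝ G z) (i : Fin 2) :
    pd i (fun y ↦ F y + G y) z = pd i F z + pd i G z := by
  simp [pd, fderiv_fun_add hF hG]

lemma pd_sub {F G : Plane → ℝ} {z : Plane} (hF : DifferentiableAt ℝ F z)
    (hG : DifferentiableAt ℝ G z) (i : Fin 2) :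
    pd i (fun y ↦ F y - G y) z = pd i F z - pd i G z := by
  simp [pd, fderiv_fun_sub hF hG]

lemma pd_mul {F G : Plane → ℝ} {z : Plane} (hF : DifferentiableAt ℝ F z)
    (hG : DifferentiableAt ℝ G z) (i : Fin 2) :
    pd i (fun y ↦ F y * G y) z = pd i F z * G z + F z * pd i G z := by
  simp [pd, fderiv_fun_mul hF hG]
  ring

lemma pd_const_mul {F : Plane → ℝ} {z : Plane} (hF : DifferentiableAt ℝ F z) (c : ℝ) (i : Fin 2) :
    pd i (fun y ↦ c * F y) z = c * pd i F z := by
  simp [pd, fderiv_const_mul hF c]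

lemma fderiv_coord {T : Plane → Plane} {z : Plane} (hT : DifferentiableAt ℝ T z) (i k : Fin 2) :
    fderiv ℝ T z (basisVec i) k = pd i (fun y ↦ T y k) z := by
  have := ((EuclideanSpace.proj (𝕜 := ℝ) k : Plane →L[ℝ] ℝ).hasFDerivAt.comp z
    hT.hasFDerivAt).fderiv
  simp only [pd]
  change _ = fderiv ℝ (⇑(EuclideanSpace.proj (𝕜 := ℝ) k : Plane →L[ℝ] ℝ) ∘ T) z _
  rw [this]
  rfl

lemma pd_comp {T : Plane → Plane} {F : Plane → ℝ} {z : Plane} (hT : DifferentiableAt ℝ T z)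
    (hF : DifferentiableAt ℝ F (T z)) (i : Fin 2) :
    pd i (fun y ↦ F (T y)) z =
      pd 0 F (T z) * pd i (fun y ↦ T y 0) z + pd 1 F (T z) * pd i (fun y ↦ T y 1) z := by
  have := fderiv_comp z hF hT
  simp only [Function.comp_def] at this
  rw [pd, this, ContinuousLinearMap.comp_apply, fderiv_apply_eq, fderiv_coord hT, fderiv_coord hT]
  ring

lemma pd_real_comp {F : Plane → ℝ} {h : ℝ → ℝ} {h' : ℝ} {z : Plane} (hF : DifferentiableAt ℝ F z)
    (hh : HasDerivAt h h' (F z)) (i : Fin 2) :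
    pd i (fun y ↦ h (F y)) z = h' * pd i F z := by
  have := (hh.comp_hasFDerivAt z hF.hasFDerivAt).fderiv
  simp only [Function.comp_def] at this
  simp [pd, this]

lemma contDiffAt_pd {F : Plane → ℝ} {z : Plane} {m n : ℕ∞ω} (hF : ContDiffAt ℝ n F z)
    (hmn : m + 1 ≤ n) (i : Fin 2) : ContDiffAt ℝ m (pd i F) z :=
  (hF.fderiv_right hmn).clm_apply contDiffAt_const

lemma differentiableAt_pd {F : Plane → ℝ} {z : Plane} (hF : ContDiffAt ℝ 2 F z) (i : Fin 2) :
    DifferentiableAt ℝ (pd i F) z :=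
  (contDiffAt_pd (m := 1) hF (by norm_num) i).differentiableAt (by norm_num)

lemma pd_pd_eq {F : Plane → ℝ} {z : Plane} (hF : ContDiffAt ℝ 2 F z) (i j : Fin 2) :
    pd i (pd j F) z = fderiv ℝ (fderiv ℝ F) z (basisVec i) (basisVec j) := by
  have h : DifferentiableAt ℝ (fderiv ℝ F) z :=
    (hF.fderiv_right (m := 1) (by norm_num)).differentiableAt (by norm_num)
  have := (h.hasFDerivAt.clm_apply (hasFDerivAt_const (basisVec j) z)).fderiv
  unfold pd
  rw [this]
  simp

lemma pd_comm {F : Plane → ℝ} {z : Plane} (hF : ContDiffAt ℝ 2 F z) (i j : Fin 2) :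
    pd i (pd j F) z = pd j (pd i F) z := by
  rw [pd_pd_eq hF, pd_pd_eq hF]
  exact (hF.isSymmSndFDerivAt (by simp)) _ _

lemma contDiffAt_coord {T : Plane → Plane} {z : Plane} {n : ℕ∞ω} (hT : ContDiffAt ℝ n T z)
    (k : Fin 2) : ContDiffAt ℝ n (fun y ↦ T y k) z :=
  (EuclideanSpace.proj (𝕜 := ℝ) k : Plane →L[ℝ] ℝ).contDiff.contDiffAt.comp z hT

/-- The Jacobian determinant of a map of the plane. -/
def jac (T : Plane → Plane) (z : Plane) : ℝ :=
  pd 0 (fun y ↦ T y 0) z * pd 1 (fun y ↦ T y 1) z -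
    pd 1 (fun y ↦ T y 0) z * pd 0 (fun y ↦ T y 1) z

/-- The Piola identity in the plane: pulling a vector field back by the adjugate of the Jacobian
matrix multiplies its divergence by the Jacobian determinant. The second derivatives of `T` cancel
by symmetry. -/
lemma piola {T : Plane → Plane} {Y : Fin 2 → Plane → ℝ} {z : Plane} (hT : ContDiffAt ℝ 2 T z)
    (hY : ∀ k, DifferentiableAt ℝ (Y k) (T z)) :
    pd 0 (fun w ↦ pd 1 (fun y ↦ T y 1) w * Y 0 (T w) - pd 1 (fun y ↦ T y 0) w * Y 1 (T w)) z +
      pd 1 (fun w ↦ pd 0 (fun y ↦ T y 0) w * Y 1 (T w) - pd 0 (fun y ↦ T y 1) w * Y 0 (T w)) z =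
    jac T z * (pd 0 (Y 0) (T z) + pd 1 (Y 1) (T z)) := by
  have hTd : DifferentiableAt ℝ T z := hT.differentiableAt (by norm_num)
  have d1 : ∀ i k, DifferentiableAt ℝ (pd i (fun y ↦ T y k)) z := fun i k ↦
    differentiableAt_pd (contDiffAt_coord hT k) i
  have d2 : ∀ k, DifferentiableAt ℝ (fun w ↦ Y k (T w)) z := fun k ↦ (hY k).comp z hTd
  have d3 : ∀ i k l, DifferentiableAt ℝ (fun w ↦ pd i (fun y ↦ T y k) w * Y l (T w)) z :=
    fun i k l ↦ (d1 i k).mul (d2 l)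
  rw [pd_sub (d3 _ _ _) (d3 _ _ _), pd_sub (d3 _ _ _) (d3 _ _ _),
    pd_mul (d1 _ _) (d2 _), pd_mul (d1 _ _) (d2 _), pd_mul (d1 _ _) (d2 _),
    pd_mul (d1 _ _) (d2 _), pd_comp hTd (hY _), pd_comp hTd (hY _), pd_comp hTd (hY _),
    pd_comp hTd (hY _), pd_comm (contDiffAt_coord hT 1) 1 0, pd_comm (contDiffAt_coord hT 0) 1 0,
    jac]
  ring

lemma IsLocalMin.deriv_deriv_nonneg {g : ℝ → ℝ} {t : ℝ} (h : IsLocalMin g t)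
    (hg : ContDiffAt ℝ 2 g t) : 0 ≤ deriv (deriv g) t := by
  by_contra! hneg
  -- otherwise a small multiple of `(s - t) ^ 2` can be added to `g`, keeping a strict local
  -- minimum while the second derivative stays negative
  set δ : ℝ := -(deriv (deriv g) t) / 4 with hδ
  have hδ0 : 0 < δ := by rw [hδ]; linarith
  have hq : ∀ s : ℝ, HasDerivAt (fun s ↦ δ * (s - t) ^ 2) (δ * (2 * (s - t))) s := by
    intro s
    have := (((hasDerivAt_id s).sub_const t).pow 2).const_mul δ
    simpa using this
  have hd : ∀ᶠ s in nhds t, DifferentiableAt ℝ g s := by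
    filter_upwards [hg.eventually (by simp)] with s hs using hs.differentiableAt (by norm_num)
  have e1 : deriv (fun s ↦ g s + δ * (s - t) ^ 2) =ᶠ[nhds t]
      fun s ↦ deriv g s + δ * (2 * (s - t)) := by
    filter_upwards [hd] with s hs
    exact (hs.hasDerivAt.add (hq s)).deriv
  have hdd : DifferentiableAt ℝ (deriv g) t := by
    have : ContDiffAt ℝ 1 (deriv g) t := by
      have := (hg.fderiv_right (m := 1) (by norm_num)).clm_apply
        (contDiffAt_const (c := (1 : ℝ)))
      exact this
    exact this.differentiableAt (by norm_num)
  have e2 : deriv (deriv (fun s ↦ g s + δ * (s - t) ^ 2)) t = deriv (deriv g) t + 2 * δ := by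
    rw [e1.deriv_eq]
    have := hdd.hasDerivAt.add ((((hasDerivAt_id t).sub_const t).const_mul 2).const_mul δ)
    rw [show deriv (deriv g) t + 2 * δ = deriv (deriv g) t + δ * (2 * 1) by ring]
    exact this.deriv
  have hmax : IsLocalMax (fun s ↦ g s + δ * (s - t) ^ 2) t := by
    apply isLocalMax_of_deriv_deriv_neg
    · rw [e2, hδ]; linarith
    · rw [e1.eq_of_nhds]; simp [h.deriv_eq_zero]
    · exact (hg.continuousAt).add (hq t).continuousAt
  have hev : ∀ᶠ s in nhds t, s = t := by
    filter_upwards [h, hmax] with s h1 h2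
    have h3 : δ * (s - t) ^ 2 ≤ 0 := by
      simp only [sub_self] at h2
      linarith
    have h4 : (s - t) ^ 2 ≤ 0 := by
      by_contra! h5
      have := mul_pos hδ0 h5
      linarith
    have := pow_eq_zero_iff (two_ne_zero) |>.1 (le_antisymm h4 (sq_nonneg _))
    linarith
  obtain ⟨η, hη, hball⟩ := Metric.eventually_nhds_iff.1 hev
  have := hball (y := t + η / 2) (by
    rw [Real.dist_eq, add_sub_cancel_left, abs_of_pos (by linarith)]; linarith)
  linarith

lemma IsLocalMin.hessian_nonneg {F : Plane → ℝ} {z : Plane} (h : IsLocalMin F z)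
    (hF : ContDiffAt ℝ 2 F z) (a b : ℝ) :
    0 ≤ a ^ 2 * pd 0 (pd 0 F) z + 2 * a * b * pd 0 (pd 1 F) z + b ^ 2 * pd 1 (pd 1 F) z := by
  set v : Plane := a • basisVec 0 + b • basisVec 1
  have hl : ∀ t : ℝ, HasDerivAt (fun t : ℝ ↦ z + t • v) v t := fun t ↦ by
    simpa using ((hasDerivAt_id t).smul_const v).const_add z
  have hlc : ContDiff ℝ 2 (fun t : ℝ ↦ z + t • v) := by fun_prop
  have hz : z + (0 : ℝ) • v = z := by simp
  have hg : ContDiffAt ℝ 2 (fun t : ℝ ↦ F (z + t • v)) 0 :=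
    ContDiffAt.comp (0 : ℝ) (by rwa [hz]) hlc.contDiffAt
  have hmin : IsLocalMin (fun t : ℝ ↦ F (z + t • v)) 0 := by
    have hc : Filter.Tendsto (fun t : ℝ ↦ z + t • v) (nhds 0) (nhds z) := by
      have := hlc.continuous.tendsto 0
      rwa [hz] at this
    have := hc.eventually h
    filter_upwards [this] with t ht
    simpa [hz] using ht
  have key := IsLocalMin.deriv_deriv_nonneg hmin hg
  have hev : ∀ᶠ t in nhds (0 : ℝ), DifferentiableAt ℝ F (z + t • v) := by
    have hc : Filter.Tendsto (fun t : ℝ ↦ z + t • v) (nhds 0) (nhds z) := by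
      have := hlc.continuous.tendsto 0
      rwa [hz] at this
    filter_upwards [hc.eventually (hF.eventually (by simp))] with t ht
      using ht.differentiableAt (by norm_num)
  have e1 : deriv (fun t : ℝ ↦ F (z + t • v)) =ᶠ[nhds 0]
      fun t ↦ a * pd 0 F (z + t • v) + b * pd 1 F (z + t • v) := by
    filter_upwards [hev] with t ht
    have := (ht.hasFDerivAt.comp_hasDerivAt t (hl t)).deriv
    simp only [Function.comp_def] at this
    rw [this, fderiv_apply_eq]
    simp [v]
  have hd : ∀ i, HasDerivAt (fun t : ℝ ↦ pd i F (z + t • v))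
      (a * pd 0 (pd i F) z + b * pd 1 (pd i F) z) 0 := by
    intro i
    have hdi : DifferentiableAt ℝ (pd i F) (z + (0 : ℝ) • v) := by
      rw [hz]; exact differentiableAt_pd hF i
    have := hdi.hasFDerivAt.comp_hasDerivAt (0 : ℝ) (hl 0)
    simp only [Function.comp_def] at this
    rw [fderiv_apply_eq, hz] at this
    simpa [v] using this
  have e2 := (((hd 0).const_mul a).add ((hd 1).const_mul b)).deriv
  rw [e1.deriv_eq] at key
  change 0 ≤ deriv ((fun t : ℝ ↦ a * pd 0 F (z + t • v)) + fun t : ℝ ↦ b * pd 1 F (z + t • v)) 0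
    at key
  rw [e2, pd_comm hF 1 0] at key
  linarith

/-! ### The metric, the gradient and the Laplacian in a chart -/

section Charts

set_option linter.unusedSectionVars false

variable {N : Type*} [TopologicalSpace N] [ChartedSpace (EuclideanSpace ℝ (Fin 2)) N]
  [IsManifold (𝓡 2) ∞ N]

/-- The differential of the inverse of the chart at `x₀`. -/
def push (x₀ : N) (z : Plane) : Plane →L[ℝ] TangentSpace (𝓡 2) ((extChartAt (𝓡 2) x₀).symm z) :=
  mfderiv 𝓘(ℝ, Plane) (𝓡 2) (extChartAt (𝓡 2) x₀).symm z

/-- The differential of the chart at `x₀`. -/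
def pull (x₀ y : N) : TangentSpace (𝓡 2) y →L[ℝ] Plane :=
  mfderiv (𝓡 2) 𝓘(ℝ, Plane) (extChartAt (𝓡 2) x₀) y

lemma mem_chart_source_of_mem {x₀ y : N} (hy : y ∈ (extChartAt (𝓡 2) x₀).source) :
    y ∈ (chartAt (EuclideanSpace ℝ (Fin 2)) x₀).source := by
  rwa [← extChartAt_source (I := 𝓡 2)]

lemma pull_push {x₀ : N} {z : Plane} (hz : z ∈ (extChartAt (𝓡 2) x₀).target) (v : Plane) :
    pull x₀ ((extChartAt (𝓡 2) x₀).symm z) (push x₀ z v) = v := by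
  have h := mfderiv_extChartAt_comp_mfderivWithin_extChartAt_symm (I := 𝓡 2) hz
  rw [ModelWithCorners.range_eq_univ, mfderivWithin_univ] at h
  exact congrArg (fun A : Plane →L[ℝ] Plane ↦ A v) h

lemma push_pull {x₀ : N} {z : Plane} (hz : z ∈ (extChartAt (𝓡 2) x₀).target)
    (X : TangentSpace (𝓡 2) ((extChartAt (𝓡 2) x₀).symm z)) :
    push x₀ z (pull x₀ ((extChartAt (𝓡 2) x₀).symm z) X) = X := by
  have h := mfderivWithin_extChartAt_symm_comp_mfderiv_extChartAt (I := 𝓡 2) hz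
  rw [ModelWithCorners.range_eq_univ, mfderivWithin_univ] at h
  exact congrArg (fun A : TangentSpace (𝓡 2) ((extChartAt (𝓡 2) x₀).symm z) →L[ℝ]
    TangentSpace (𝓡 2) ((extChartAt (𝓡 2) x₀).symm z) ↦ A X) h

lemma mdifferentiableAt_chart_symm {x₀ : N} {z : Plane}
    (hz : z ∈ (extChartAt (𝓡 2) x₀).target) :
    MDifferentiableAt 𝓘(ℝ, Plane) (𝓡 2) (extChartAt (𝓡 2) x₀).symm z :=
  ((contMDiffOn_extChartAt_symm (n := ∞) x₀).contMDiffAt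
    ((isOpen_extChartAt_target x₀).mem_nhds hz)).mdifferentiableAt (by simp)

/-- A function on the surface, read in the chart at `x₀`. -/
def inChart (x₀ : N) (f : N → ℝ) (z : Plane) : ℝ := f ((extChartAt (𝓡 2) x₀).symm z)

lemma fderiv_chart {x₀ : N} {z : Plane} (hz : z ∈ (extChartAt (𝓡 2) x₀).target) {f : N → ℝ}
    (hf : MDifferentiableAt (𝓡 2) 𝓘(ℝ, ℝ) f ((extChartAt (𝓡 2) x₀).symm z)) (v : Plane) :
    fderiv ℝ (inChart x₀ f) z v =
      mfderiv (𝓡 2) 𝓘(ℝ, ℝ) f ((extChartAt (𝓡 2) x₀).symm z) (push x₀ z v) := by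
  have := mfderiv_comp z hf (mdifferentiableAt_chart_symm hz)
  rw [mfderiv_eq_fderiv] at this
  exact congrArg (fun A : Plane →L[ℝ] ℝ ↦ A v) this

/-- The transition map from the chart at `x` to the chart at `x₀`. -/
def transition (x x₀ : N) (z : Plane) : Plane :=
  extChartAt (𝓡 2) x₀ ((extChartAt (𝓡 2) x).symm z)

lemma contDiffAt_transition {x x₀ : N} {z : Plane} (hz : z ∈ (extChartAt (𝓡 2) x).target)
    (hy : (extChartAt (𝓡 2) x).symm z ∈ (extChartAt (𝓡 2) x₀).source) :
    ContDiffAt ℝ ∞ (transition x x₀) z := by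
  rw [← contMDiffAt_iff_contDiffAt]
  exact (contMDiffAt_extChartAt' (mem_chart_source_of_mem hy)).comp z
    ((contMDiffOn_extChartAt_symm (n := ∞) x).contMDiffAt
      ((isOpen_extChartAt_target x).mem_nhds hz))

lemma pull_push_transition {x x₀ : N} {z : Plane} (hz : z ∈ (extChartAt (𝓡 2) x).target)
    (hy : (extChartAt (𝓡 2) x).symm z ∈ (extChartAt (𝓡 2) x₀).source) (v : Plane) :
    pull x₀ ((extChartAt (𝓡 2) x).symm z) (push x z v) = fderiv ℝ (transition x x₀) z v := by
  have := mfderiv_comp z (mdifferentiableAt_extChartAt (I := 𝓡 2) (mem_chart_source_of_mem hy))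
    (mdifferentiableAt_chart_symm hz)
  rw [mfderiv_eq_fderiv] at this
  exact (congrArg (fun A : Plane →L[ℝ] Plane ↦ A v) this).symm

lemma pull_transition {x x₀ : N} {z : Plane} (hz : z ∈ (extChartAt (𝓡 2) x).target)
    (hy : (extChartAt (𝓡 2) x).symm z ∈ (extChartAt (𝓡 2) x₀).source)
    (X : TangentSpace (𝓡 2) ((extChartAt (𝓡 2) x).symm z)) :
    pull x₀ ((extChartAt (𝓡 2) x).symm z) X =
      fderiv ℝ (transition x x₀) z (pull x ((extChartAt (𝓡 2) x).symm z) X) := by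
  rw [← pull_push_transition hz hy, push_pull hz]

lemma contMDiffAt_chart_section {x₀ : N} {z : Plane}
    (hz : z ∈ (extChartAt (𝓡 2) x₀).target) (v : Plane) :
    ContMDiffAt 𝓘(ℝ, Plane) ((𝓡 2).prod 𝓘(ℝ, Plane)) ∞
      (fun z ↦ (⟨(extChartAt (𝓡 2) x₀).symm z, push x₀ z v⟩ :
        TotalSpace Plane (TangentSpace (𝓡 2) : N → Type _))) z := by
  have hy := (extChartAt (𝓡 2) x₀).map_target hz
  rw [Trivialization.contMDiffAt_iff
    (e := trivializationAt Plane (TangentSpace (𝓡 2) : N → Type _) x₀)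
    (by
      rw [Trivialization.mem_source]
      simpa using hy)]
  refine ⟨(contMDiffOn_extChartAt_symm (n := ∞) x₀).contMDiffAt
      ((isOpen_extChartAt_target x₀).mem_nhds hz), ?_⟩
  refine (contMDiffAt_const (c := v)).congr_of_eventuallyEq ?_
  filter_upwards [(isOpen_extChartAt_target x₀).mem_nhds hz] with w hw
  have hyw := (extChartAt (𝓡 2) x₀).map_target hw
  have h := TangentBundle.continuousLinearMapAt_trivializationAt (𝕜 := ℝ) (I := 𝓡 2)
    (mem_chart_source_of_mem hyw)
  have h2 := congrArg (fun A : TangentSpace (𝓡 2) ((extChartAt (𝓡 2) x₀).symm w) →L[ℝ] Plane ↦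
    A (push x₀ w v)) h
  refine Eq.trans ?_ (h2.trans (pull_push hw v))
  rw [Trivialization.continuousLinearMapAt_apply, Trivialization.coe_linearMapAt_of_mem]
  simpa using hyw

variable [RiemannianBundle (fun x : N ↦ TangentSpace (𝓡 2) x)]

lemma gram_symm (x₀ : N) (z : Plane) (i j : Fin 2) : gram x₀ z i j = gram x₀ z j i := by
  simp only [gram, Matrix.of_apply]
  exact real_inner_comm _ _

/-- The metric in the chart at `x₀`, as a bilinear form on the plane. -/
def gramForm (x₀ : N) (z u v : Plane) : ℝ :=
  gram x₀ z 0 0 * (u 0 * v 0) + gram x₀ z 0 1 * (u 0 * v 1 + u 1 * v 0) +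
    gram x₀ z 1 1 * (u 1 * v 1)

lemma inner_push (x₀ : N) (z u v : Plane) :
    inner ℝ (push x₀ z u) (push x₀ z v) = gramForm x₀ z u v := by
  have h : ∀ u : Plane, push x₀ z u = u 0 • coordField x₀ 0 z + u 1 • coordField x₀ 1 z := by
    intro u
    conv_lhs => rw [eq_sum_basisVec u]
    rw [map_add, map_smul, map_smul]
    rfl
  rw [h u, h v, gramForm, gram_symm]
  simp only [inner_add_left, inner_add_right, real_inner_smul_left, real_inner_smul_right]
  rw [real_inner_comm (coordField x₀ 0 z) (coordField x₀ 1 z)]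
  simp only [gram, Matrix.of_apply]
  ring_nf

lemma inner_eq_gramForm {x₀ y : N} (hy : y ∈ (extChartAt (𝓡 2) x₀).source)
    (X Y : TangentSpace (𝓡 2) y) :
    inner ℝ X Y = gramForm x₀ (extChartAt (𝓡 2) x₀ y) (pull x₀ y X) (pull x₀ y Y) := by
  obtain ⟨z, hz, rfl⟩ : ∃ z ∈ (extChartAt (𝓡 2) x₀).target, (extChartAt (𝓡 2) x₀).symm z = y :=
    ⟨_, (extChartAt (𝓡 2) x₀).map_source hy, (extChartAt (𝓡 2) x₀).left_inv hy⟩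
  rw [(extChartAt (𝓡 2) x₀).right_inv hz, ← inner_push, push_pull hz, push_pull hz]

lemma gramForm_self_pos {x₀ : N} {z : Plane} (hz : z ∈ (extChartAt (𝓡 2) x₀).target) {v : Plane}
    (hv : v ≠ 0) : 0 < gramForm x₀ z v v := by
  rw [← inner_push]
  apply real_inner_self_pos.2
  intro h
  apply hv
  rw [← pull_push hz v, h, map_zero]

lemma gram_zero_zero_pos {x₀ : N} {z : Plane} (hz : z ∈ (extChartAt (𝓡 2) x₀).target) :
    0 < gram x₀ z 0 0 := by
  have := gramForm_self_pos hz (v := basisVec 0) (by simp [basisVec])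
  simpa [gramForm, basisVec] using this

lemma gram_det (x₀ : N) (z : Plane) :
    (gram x₀ z).det = gram x₀ z 0 0 * gram x₀ z 1 1 - gram x₀ z 0 1 ^ 2 := by
  rw [Matrix.det_fin_two, gram_symm x₀ z 1 0, sq]

lemma gram_det_pos {x₀ : N} {z : Plane} (hz : z ∈ (extChartAt (𝓡 2) x₀).target) :
    0 < (gram x₀ z).det := by
  have h0 := gram_zero_zero_pos hz
  have := gramForm_self_pos hz
    (v := (-gram x₀ z 0 1) • basisVec 0 + (gram x₀ z 0 0) • basisVec 1) (by
      intro h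
      have := congrArg (fun v : Plane ↦ v 1) h
      simp [basisVec] at this
      exact h0.ne' this)
  simp only [gramForm, basisVec, PiLp.add_apply, PiLp.smul_apply, PiLp.single_apply,
    smul_eq_mul] at this
  norm_num at this
  rw [gram_det]
  nlinarith

lemma contDiffAt_gram [IsContMDiffRiemannianBundle (𝓡 2) ∞ (EuclideanSpace ℝ (Fin 2))
      (fun x : N ↦ TangentSpace (𝓡 2) x)] {x₀ : N} {z : Plane}
    (hz : z ∈ (extChartAt (𝓡 2) x₀).target) (i j : Fin 2) :
    ContDiffAt ℝ ∞ (fun w ↦ gram x₀ w i j) z := by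
  rw [← contMDiffAt_iff_contDiffAt]
  exact (contMDiffAt_chart_section hz (basisVec i)).inner_bundle
    (contMDiffAt_chart_section hz (basisVec j))

/-- The inverse matrix `g^{ij}` of the metric in the chart at `x₀`. -/
def cometric (x₀ : N) (i j : Fin 2) (z : Plane) : ℝ :=
  (gram x₀ z).adjugate i j / (gram x₀ z).det

lemma cometric_zero_zero (x₀ : N) (z : Plane) :
    cometric x₀ 0 0 z = gram x₀ z 1 1 / (gram x₀ z).det := by
  simp [cometric, Matrix.adjugate_fin_two]

lemma cometric_zero_one (x₀ : N) (z : Plane) :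
    cometric x₀ 0 1 z = -gram x₀ z 0 1 / (gram x₀ z).det := by
  simp [cometric, Matrix.adjugate_fin_two]

lemma cometric_one_zero (x₀ : N) (z : Plane) :
    cometric x₀ 1 0 z = -gram x₀ z 0 1 / (gram x₀ z).det := by
  simp [cometric, Matrix.adjugate_fin_two, gram_symm x₀ z 1 0]

lemma cometric_one_one (x₀ : N) (z : Plane) :
    cometric x₀ 1 1 z = gram x₀ z 0 0 / (gram x₀ z).det := by
  simp [cometric, Matrix.adjugate_fin_two]

/-- The components of the gradient in a chart are `∑ⱼ g^{ij} ∂ⱼ f`. -/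
lemma coordComponent_grad {x₀ : N} {z : Plane} (hz : z ∈ (extChartAt (𝓡 2) x₀).target) {f : N → ℝ}
    (hf : MDifferentiableAt (𝓡 2) 𝓘(ℝ, ℝ) f ((extChartAt (𝓡 2) x₀).symm z)) (i : Fin 2) :
    coordComponent (fun y ↦ grad f y) x₀ i z =
      cometric x₀ i 0 z * pd 0 (inChart x₀ f) z +
      cometric x₀ i 1 z * pd 1 (inChart x₀ f) z := by
  set y := (extChartAt (𝓡 2) x₀).symm z
  have hy : y ∈ (extChartAt (𝓡 2) x₀).source := (extChartAt (𝓡 2) x₀).map_target hz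
  set X := pull x₀ y (grad f y) with hX
  have hk : ∀ v : Plane, gramForm x₀ z X v =
      fderiv ℝ (inChart x₀ f) z v := by
    intro v
    rw [fderiv_chart hz hf]
    have h1 := inner_eq_gramForm hy (grad f y) (push x₀ z v)
    rw [pull_push hz, (extChartAt (𝓡 2) x₀).right_inv hz] at h1
    rw [← h1, grad, InnerProductSpace.toDual_symm_apply]
    rfl
  have h0 := hk (basisVec 0)
  have h1 := hk (basisVec 1)
  have hd := gram_det_pos hz
  change X i = _
  simp only [pd, ← h0, ← h1]
  fin_cases i
  · simp [cometric_zero_zero, cometric_zero_one, gramForm, basisVec]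
    field_simp
    rw [gram_det]
    ring
  · simp [cometric_one_zero, cometric_one_one, gramForm, basisVec]
    field_simp
    rw [gram_det]
    ring

lemma norm_grad_sq {x₀ : N} {z : Plane} (hz : z ∈ (extChartAt (𝓡 2) x₀).target) {f : N → ℝ}
    (hf : MDifferentiableAt (𝓡 2) 𝓘(ℝ, ℝ) f ((extChartAt (𝓡 2) x₀).symm z)) :
    ‖grad f ((extChartAt (𝓡 2) x₀).symm z)‖ ^ 2 =
      cometric x₀ 0 0 z * pd 0 (inChart x₀ f) z ^ 2 +
      2 * cometric x₀ 0 1 z * (pd 0 (inChart x₀ f) z *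
        pd 1 (inChart x₀ f) z) +
      cometric x₀ 1 1 z * pd 1 (inChart x₀ f) z ^ 2 := by
  set y := (extChartAt (𝓡 2) x₀).symm z
  have h0 : pull x₀ y (grad f y) 0 = _ := coordComponent_grad hz hf 0
  have h1 : pull x₀ y (grad f y) 1 = _ := coordComponent_grad hz hf 1
  have h2 : ‖grad f y‖ ^ 2 = fderiv ℝ (inChart x₀ f) z
      (pull x₀ y (grad f y)) := by
    rw [fderiv_chart hz hf, push_pull hz, ← real_inner_self_eq_norm_sq]
    nth_rewrite 1 [grad]
    rw [InnerProductSpace.toDual_symm_apply]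
    rfl
  rw [h2, fderiv_apply_eq, h0, h1, cometric_one_zero, cometric_zero_one]
  ring

/-- Change of charts for the determinant of the metric. -/
lemma gram_det_transition {x x₀ : N} {z : Plane} (hz : z ∈ (extChartAt (𝓡 2) x).target)
    (hy : (extChartAt (𝓡 2) x).symm z ∈ (extChartAt (𝓡 2) x₀).source) :
    (gram x z).det = jac (transition x x₀) z ^ 2 * (gram x₀ (transition x x₀ z)).det := by
  have h : ∀ i j, gram x z i j = gramForm x₀ (transition x x₀ z)
      (fderiv ℝ (transition x x₀) z (basisVec i)) (fderiv ℝ (transition x x₀) z (basisVec j)) := by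
    intro i j
    rw [← pull_push_transition hz hy, ← pull_push_transition hz hy]
    exact inner_eq_gramForm hy (push x z (basisVec i)) (push x z (basisVec j))
  have hT := (contDiffAt_transition hz hy).differentiableAt (by simp)
  have hk : ∀ i k, fderiv ℝ (transition x x₀) z (basisVec i) k =
      pd i (fun y ↦ transition x x₀ y k) z := fun i k ↦ fderiv_coord hT i k
  rw [gram_det, h, h, h, gram_det]
  simp only [gramForm, hk, jac]
  ring

lemma coordComponent_transition {x x₀ : N} {z : Plane} (hz : z ∈ (extChartAt (𝓡 2) x).target)
    (hy : (extChartAt (𝓡 2) x).symm z ∈ (extChartAt (𝓡 2) x₀).source)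
    (X : ∀ y : N, TangentSpace (𝓡 2) y) (k : Fin 2) :
    coordComponent X x₀ k (transition x x₀ z) =
      coordComponent X x 0 z * pd 0 (fun y ↦ transition x x₀ y k) z +
      coordComponent X x 1 z * pd 1 (fun y ↦ transition x x₀ y k) z := by
  have hT := (contDiffAt_transition hz hy).differentiableAt (by simp)
  have h1 : coordComponent X x₀ k (transition x x₀ z) =
      pull x₀ ((extChartAt (𝓡 2) x).symm z) (X ((extChartAt (𝓡 2) x).symm z)) k :=
    congrArg (fun y : N ↦ pull x₀ y (X y) k) ((extChartAt (𝓡 2) x₀).left_inv hy)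
  rw [h1, pull_transition hz hy]
  set v := pull x ((extChartAt (𝓡 2) x).symm z) (X ((extChartAt (𝓡 2) x).symm z)) with hv
  have h2 : ∀ i, coordComponent X x i z = v i := fun i ↦ rfl
  rw [h2, h2, ← fderiv_coord hT, ← fderiv_coord hT]
  conv_lhs => rw [eq_sum_basisVec v]
  simp

/-- The divergence `(det g)^{-1/2} ∑ᵢ ∂ᵢ ((det g)^{1/2} Xⁱ)` computed in the chart at `x₀`. -/
def chartDivergence (X : ∀ y : N, TangentSpace (𝓡 2) y) (x₀ : N) (z : Plane) : ℝ :=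
  (√(gram x₀ z).det)⁻¹ *
    (pd 0 (fun w ↦ √(gram x₀ w).det * coordComponent X x₀ 0 w) z +
      pd 1 (fun w ↦ √(gram x₀ w).det * coordComponent X x₀ 1 w) z)

/-- The divergence does not depend on the chart in which it is computed. -/
lemma divergence_eq_chartDivergence {x x₀ : N} (hx : x ∈ (extChartAt (𝓡 2) x₀).source)
    (X : ∀ y : N, TangentSpace (𝓡 2) y)
    (hX : ∀ k, DifferentiableAt ℝ (fun w ↦ √(gram x₀ w).det * coordComponent X x₀ k w)
      (extChartAt (𝓡 2) x₀ x)) :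
    divergence X x = chartDivergence X x₀ (extChartAt (𝓡 2) x₀ x) := by
  set z := extChartAt (𝓡 2) x x with hzdef
  have hz : z ∈ (extChartAt (𝓡 2) x).target := mem_extChartAt_target x
  have hsymm : (extChartAt (𝓡 2) x).symm z = x := extChartAt_to_inv x
  have hTz : transition x x₀ z = extChartAt (𝓡 2) x₀ x := by rw [transition, hsymm]
  have hyz : (extChartAt (𝓡 2) x).symm z ∈ (extChartAt (𝓡 2) x₀).source := by rwa [hsymm]
  set T := transition x x₀ with hTdef
  have hT := contDiffAt_transition hz hyz
  have hT2 : ContDiffAt ℝ 2 T z := hT.of_le ENat.LEInfty.out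
  have hnear : ∀ᶠ w in nhds z, w ∈ (extChartAt (𝓡 2) x).target ∧
      (extChartAt (𝓡 2) x).symm w ∈ (extChartAt (𝓡 2) x₀).source := by
    refine Filter.Eventually.and ((isOpen_extChartAt_target x).mem_nhds hz) ?_
    exact (mdifferentiableAt_chart_symm hz).continuousAt.preimage_mem_nhds
      ((isOpen_extChartAt_source x₀).mem_nhds hyz)
  have hjc : ContinuousAt (jac T) z := by
    have hp : ∀ i k, ContinuousAt (pd i (fun y ↦ T y k)) z := fun i k ↦
      (differentiableAt_pd (contDiffAt_coord hT2 k) i).continuousAt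
    exact ((hp 0 0).mul (hp 1 1)).sub ((hp 1 0).mul (hp 0 1))
  have hj0 : jac T z ≠ 0 := by
    intro h
    have h1 := gram_det_transition hz hyz
    rw [← hTdef, h] at h1
    have := gram_det_pos hz
    simp [h1] at this
  -- near `z` the Jacobian determinant keeps its sign `σ`, so that `|jac T| = σ * jac T`
  obtain ⟨σ, hσ, hσj⟩ : ∃ σ : ℝ, σ * σ = 1 ∧ ∀ᶠ w in nhds z, |jac T w| = σ * jac T w := by
    rcases lt_or_gt_of_ne hj0 with h | h
    · refine ⟨-1, by norm_num, ?_⟩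
      filter_upwards [hjc.eventually (gt_mem_nhds h)] with w hw
      rw [abs_of_neg hw]; ring
    · refine ⟨1, by norm_num, ?_⟩
      filter_upwards [hjc.eventually (lt_mem_nhds h)] with w hw
      rw [abs_of_pos hw]; ring
  set Y : Fin 2 → Plane → ℝ := fun k w ↦ √(gram x₀ w).det * coordComponent X x₀ k w with hY
  have hsq : ∀ᶠ w in nhds z, √(gram x w).det = σ * jac T w * √(gram x₀ (T w)).det := by
    filter_upwards [hnear, hσj] with w hw hw2
    rw [gram_det_transition hw.1 hw.2, Real.sqrt_mul (sq_nonneg _), Real.sqrt_sq_eq_abs, hw2]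
  have e0 : (fun w ↦ √(gram x w).det * coordComponent X x 0 w) =ᶠ[nhds z] fun w ↦ σ *
      (pd 1 (fun y ↦ T y 1) w * Y 0 (T w) - pd 1 (fun y ↦ T y 0) w * Y 1 (T w)) := by
    filter_upwards [hnear, hsq] with w hw hw2
    simp only [hY, hw2]
    rw [coordComponent_transition hw.1 hw.2, coordComponent_transition hw.1 hw.2, ← hTdef, jac]
    ring
  have e1 : (fun w ↦ √(gram x w).det * coordComponent X x 1 w) =ᶠ[nhds z] fun w ↦ σ *
      (pd 0 (fun y ↦ T y 0) w * Y 1 (T w) - pd 0 (fun y ↦ T y 1) w * Y 0 (T w)) := by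
    filter_upwards [hnear, hsq] with w hw hw2
    simp only [hY, hw2]
    rw [coordComponent_transition hw.1 hw.2, coordComponent_transition hw.1 hw.2, ← hTdef, jac]
    ring
  have hYd : ∀ k, DifferentiableAt ℝ (Y k) (T z) := by
    intro k; rw [hTz]; exact hX k
  have d3 : ∀ i k l, DifferentiableAt ℝ (fun w ↦ pd i (fun y ↦ T y k) w * Y l (T w)) z :=
    fun i k l ↦ (differentiableAt_pd (contDiffAt_coord hT2 k) i).mul
      ((hYd l).comp z (hT2.differentiableAt (by norm_num)))
  have d4 : ∀ i k l i' k' l', DifferentiableAt ℝ (fun w ↦ pd i (fun y ↦ T y k) w * Y l (T w) -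
      pd i' (fun y ↦ T y k') w * Y l' (T w)) z :=
    fun i k l i' k' l' ↦ (d3 i k l).sub (d3 i' k' l')
  have hP := piola hT2 hYd
  have hdiv : divergence X x = (√(gram x z).det)⁻¹ *
      (pd 0 (fun w ↦ √(gram x w).det * coordComponent X x 0 w) z +
        pd 1 (fun w ↦ √(gram x w).det * coordComponent X x 1 w) z) := by
    rw [divergence, Fin.sum_univ_two]
    rfl
  rw [hdiv, Filter.EventuallyEq.pd_eq e0, Filter.EventuallyEq.pd_eq e1,
    pd_const_mul (d4 _ _ _ _ _ _), pd_const_mul (d4 _ _ _ _ _ _),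
    ← mul_add, hP, hsq.self_of_nhds, chartDivergence, ← hTz]
  have hg : 0 < √(gram x₀ (T z)).det := by
    apply Real.sqrt_pos.2
    apply gram_det_pos
    rw [hTz]
    exact (extChartAt (𝓡 2) x₀).map_source hx
  have hσ0 : σ ≠ 0 := by
    rintro rfl
    simp at hσ
  field_simp
  rfl

end Charts

section Laplacian

set_option linter.unusedSectionVars false

variable {N : Type*} [TopologicalSpace N] [ChartedSpace (EuclideanSpace ℝ (Fin 2)) N]
  [IsManifold (𝓡 2) ∞ N] [RiemannianBundle (fun x : N ↦ TangentSpace (𝓡 2) x)]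
  [IsContMDiffRiemannianBundle (𝓡 2) ∞ (EuclideanSpace ℝ (Fin 2))
    (fun x : N ↦ TangentSpace (𝓡 2) x)]

lemma contDiffAt_gram_det {x₀ : N} {z : Plane} (hz : z ∈ (extChartAt (𝓡 2) x₀).target) :
    ContDiffAt ℝ ∞ (fun w ↦ (gram x₀ w).det) z := by
  simp only [gram_det]
  exact ((contDiffAt_gram hz 0 0).mul (contDiffAt_gram hz 1 1)).sub ((contDiffAt_gram hz 0 1).pow 2)

lemma contDiffAt_sqrt_gram_det {x₀ : N} {z : Plane} (hz : z ∈ (extChartAt (𝓡 2) x₀).target) :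
    ContDiffAt ℝ ∞ (fun w ↦ √(gram x₀ w).det) z :=
  (contDiffAt_gram_det hz).sqrt (gram_det_pos hz).ne'

lemma contDiffAt_cometric {x₀ : N} {z : Plane} (hz : z ∈ (extChartAt (𝓡 2) x₀).target)
    (i j : Fin 2) : ContDiffAt ℝ ∞ (cometric x₀ i j) z := by
  have hd := contDiffAt_gram_det hz
  have hne := (gram_det_pos hz).ne'
  fin_cases i <;> fin_cases j
  · exact ((contDiffAt_gram hz 1 1).div hd hne).congr_of_eventuallyEq
      (.of_forall fun w ↦ cometric_zero_zero x₀ w)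
  · exact (((contDiffAt_gram hz 0 1).neg).div hd hne).congr_of_eventuallyEq
      (.of_forall fun w ↦ cometric_zero_one x₀ w)
  · exact (((contDiffAt_gram hz 0 1).neg).div hd hne).congr_of_eventuallyEq
      (.of_forall fun w ↦ cometric_one_zero x₀ w)
  · exact ((contDiffAt_gram hz 0 0).div hd hne).congr_of_eventuallyEq
      (.of_forall fun w ↦ cometric_one_one x₀ w)

/-- The first order coefficient `(det g)^{-1/2} ∑ᵢ ∂ᵢ ((det g)^{1/2} g^{ij})` of the
Laplace-Beltrami operator in the chart at `x₀`. -/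
def drift (x₀ : N) (j : Fin 2) (z : Plane) : ℝ :=
  (√(gram x₀ z).det)⁻¹ * (pd 0 (fun w ↦ √(gram x₀ w).det * cometric x₀ 0 j w) z +
    pd 1 (fun w ↦ √(gram x₀ w).det * cometric x₀ 1 j w) z)

lemma continuousAt_drift {x₀ : N} {z : Plane} (hz : z ∈ (extChartAt (𝓡 2) x₀).target)
    (j : Fin 2) : ContinuousAt (drift x₀ j) z := by
  have h : ∀ i, ContinuousAt (pd i (fun w ↦ √(gram x₀ w).det * cometric x₀ i j w)) z := fun i ↦
    (contDiffAt_pd (m := 0) (n := 1) (((contDiffAt_sqrt_gram_det hz).mul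
      (contDiffAt_cometric hz i j)).of_le ENat.LEInfty.out) (by simp) i).continuousAt
  exact ((contDiffAt_sqrt_gram_det hz).continuousAt.inv₀
    (Real.sqrt_pos.2 (gram_det_pos hz)).ne').mul ((h 0).add (h 1))

/-- The Laplace-Beltrami operator in a chart, applied to a function on the plane. -/
def chartLaplacian (x₀ : N) (F : Plane → ℝ) (z : Plane) : ℝ :=
  cometric x₀ 0 0 z * pd 0 (pd 0 F) z + 2 * cometric x₀ 0 1 z * pd 0 (pd 1 F) z +
    cometric x₀ 1 1 z * pd 1 (pd 1 F) z + drift x₀ 0 z * pd 0 F z + drift x₀ 1 z * pd 1 F z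

lemma contDiffAt_inChart {x₀ x : N} (hx : x ∈ (extChartAt (𝓡 2) x₀).source) {f : N → ℝ}
    (hf : ContMDiffAt (𝓡 2) 𝓘(ℝ, ℝ) 2 f x) :
    ContDiffAt ℝ 2 (inChart x₀ f) (extChartAt (𝓡 2) x₀ x) := by
  have hz := (extChartAt (𝓡 2) x₀).map_source hx
  rw [← contMDiffAt_iff_contDiffAt]
  refine ContMDiffAt.comp (I' := 𝓡 2) _ ?_ ((contMDiffOn_extChartAt_symm (n := 2) x₀).contMDiffAt
    ((isOpen_extChartAt_target x₀).mem_nhds hz))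
  rwa [(extChartAt (𝓡 2) x₀).left_inv hx]

/-- The Laplace-Beltrami operator in an arbitrary chart containing the point. -/
lemma laplaceBeltrami_eq_chartLaplacian {x₀ x : N} (hx : x ∈ (extChartAt (𝓡 2) x₀).source)
    {f : N → ℝ} (hf : ContMDiffAt (𝓡 2) 𝓘(ℝ, ℝ) 2 f x) :
    laplaceBeltrami f x = chartLaplacian x₀ (inChart x₀ f) (extChartAt (𝓡 2) x₀ x) := by
  set z := extChartAt (𝓡 2) x₀ x with hzdef
  have hz : z ∈ (extChartAt (𝓡 2) x₀).target := (extChartAt (𝓡 2) x₀).map_source hx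
  have hsymm : (extChartAt (𝓡 2) x₀).symm z = x := (extChartAt (𝓡 2) x₀).left_inv hx
  set F := inChart x₀ f with hF
  have hFc : ContDiffAt ℝ 2 F z := contDiffAt_inChart hx hf
  have hnear : ∀ᶠ w in nhds z, w ∈ (extChartAt (𝓡 2) x₀).target ∧
      MDifferentiableAt (𝓡 2) 𝓘(ℝ, ℝ) f ((extChartAt (𝓡 2) x₀).symm w) := by
    refine Filter.Eventually.and ((isOpen_extChartAt_target x₀).mem_nhds hz) ?_
    have h1 : ∀ᶠ y in nhds ((extChartAt (𝓡 2) x₀).symm z),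
        MDifferentiableAt (𝓡 2) 𝓘(ℝ, ℝ) f y := by
      rw [hsymm]
      filter_upwards [(contMDiffAt_iff_contMDiffAt_nhds (by simp)).1 hf] with y hy using
        hy.mdifferentiableAt (by norm_num)
    exact (mdifferentiableAt_chart_symm hz).continuousAt.eventually h1
  have he : ∀ k, (fun w ↦ √(gram x₀ w).det * coordComponent (fun y ↦ grad f y) x₀ k w) =ᶠ[nhds z]
      fun w ↦ (√(gram x₀ w).det * cometric x₀ k 0 w) * pd 0 F w +
        (√(gram x₀ w).det * cometric x₀ k 1 w) * pd 1 F w := by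
    intro k
    filter_upwards [hnear] with w hw
    rw [coordComponent_grad hw.1 hw.2]
    ring
  have dm : ∀ k j, DifferentiableAt ℝ (fun w ↦ √(gram x₀ w).det * cometric x₀ k j w) z :=
    fun k j ↦ ((contDiffAt_sqrt_gram_det hz).mul (contDiffAt_cometric hz k j)).differentiableAt
      (by simp)
  have dF : ∀ j, DifferentiableAt ℝ (pd j F) z := fun j ↦ differentiableAt_pd hFc j
  have dmF : ∀ k j, DifferentiableAt ℝ
      (fun w ↦ (√(gram x₀ w).det * cometric x₀ k j w) * pd j F w) z :=
    fun k j ↦ (dm k j).mul (dF j)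
  have hX : ∀ k, DifferentiableAt ℝ
      (fun w ↦ √(gram x₀ w).det * coordComponent (fun y ↦ grad f y) x₀ k w) z := fun k ↦
    ((dmF k 0).add (dmF k 1)).congr_of_eventuallyEq (he k)
  rw [laplaceBeltrami, divergence_eq_chartDivergence hx _ hX, chartDivergence, ← hzdef,
    Filter.EventuallyEq.pd_eq (he 0), Filter.EventuallyEq.pd_eq (he 1),
    pd_add (dmF _ _) (dmF _ _), pd_add (dmF _ _) (dmF _ _), pd_mul (dm _ _) (dF _),
    pd_mul (dm _ _) (dF _), pd_mul (dm _ _) (dF _), pd_mul (dm _ _) (dF _), chartLaplacian,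
    drift, drift, pd_comm hFc 1 0, cometric_one_zero, ← cometric_zero_one]
  have hg : 0 < √(gram x₀ z).det := Real.sqrt_pos.2 (gram_det_pos hz)
  field_simp
  ring

lemma laplaceBeltrami_add {x : N} {f h : N → ℝ} (hf : ContMDiffAt (𝓡 2) 𝓘(ℝ, ℝ) 2 f x)
    (hh : ContMDiffAt (𝓡 2) 𝓘(ℝ, ℝ) 2 h x) :
    laplaceBeltrami (fun y ↦ f y + h y) x = laplaceBeltrami f x + laplaceBeltrami h x := by
  have hx := mem_extChartAt_source (I := 𝓡 2) x
  have hF := contDiffAt_inChart hx hf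
  have hH := contDiffAt_inChart hx hh
  rw [laplaceBeltrami_eq_chartLaplacian hx hf, laplaceBeltrami_eq_chartLaplacian hx hh,
    laplaceBeltrami_eq_chartLaplacian hx (f := fun y ↦ f y + h y) (hf.add hh)]
  have e : ∀ i, pd i (inChart x (fun y ↦ f y + h y)) =ᶠ[nhds (extChartAt (𝓡 2) x x)]
      fun w ↦ pd i (inChart x f) w + pd i (inChart x h) w := by
    intro i
    filter_upwards [hF.eventually (by simp), hH.eventually (by simp)] with w h1 h2
    exact pd_add (h1.differentiableAt (by norm_num)) (h2.differentiableAt (by norm_num)) i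
  have e2 : ∀ i j, pd i (pd j (inChart x (fun y ↦ f y + h y))) (extChartAt (𝓡 2) x x) =
      pd i (pd j (inChart x f)) (extChartAt (𝓡 2) x x) +
        pd i (pd j (inChart x h)) (extChartAt (𝓡 2) x x) := by
    intro i j
    rw [Filter.EventuallyEq.pd_eq (e j), pd_add (differentiableAt_pd hF j)
      (differentiableAt_pd hH j)]
  simp only [chartLaplacian, e2, (e _).eq_of_nhds]
  ring

/-- The chain rule `Δ (h ∘ s) = h' Δ s + h'' |∇ s|²`. -/
lemma laplaceBeltrami_comp {x : N} {s : N → ℝ} {h h' : ℝ → ℝ} {h'' : ℝ}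
    (hs : ContMDiffAt (𝓡 2) 𝓘(ℝ, ℝ) 2 s x) (hh2 : ContDiffAt ℝ 2 h (s x))
    (hh : ∀ᶠ t in nhds (s x), HasDerivAt h (h' t) t) (hh' : HasDerivAt h' h'' (s x)) :
    laplaceBeltrami (fun y ↦ h (s y)) x =
      h' (s x) * laplaceBeltrami s x + h'' * ‖grad s x‖ ^ 2 := by
  have hx := mem_extChartAt_source (I := 𝓡 2) x
  have hS := contDiffAt_inChart hx hs
  set z := extChartAt (𝓡 2) x x with hzdef
  have hz : z ∈ (extChartAt (𝓡 2) x).target := mem_extChartAt_target x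
  have hsymm : (extChartAt (𝓡 2) x).symm z = x := extChartAt_to_inv x
  have hSz : inChart x s z = s x := by rw [inChart, hsymm]
  have hc : ContMDiffAt (𝓡 2) 𝓘(ℝ, ℝ) 2 (fun y ↦ h (s y)) x :=
    ContMDiffAt.comp x (contMDiffAt_iff_contDiffAt.2 hh2) hs
  have hg := norm_grad_sq (x₀ := x) hz (f := s) (by
    rw [hsymm]; exact hs.mdifferentiableAt (by norm_num))
  have hg' : ‖grad s ((extChartAt (𝓡 2) x).symm z)‖ ^ 2 = ‖grad s x‖ ^ 2 :=
    congrArg (fun y : N ↦ ‖grad s y‖ ^ 2) hsymm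
  rw [laplaceBeltrami_eq_chartLaplacian hx hs, laplaceBeltrami_eq_chartLaplacian hx hc, ← hg', hg,
    ← hzdef]
  have hev : ∀ᶠ w in nhds z, HasDerivAt h (h' (inChart x s w)) (inChart x s w) := by
    have h1 : Filter.Tendsto (inChart x s) (nhds z) (nhds (s x)) := by
      rw [← hSz]; exact hS.continuousAt
    exact h1.eventually hh
  have hd' : DifferentiableAt ℝ (fun w ↦ h' (inChart x s w)) z := by
    have : HasDerivAt h' h'' (inChart x s z) := by rwa [hSz]
    exact (this.comp_hasFDerivAt z
      (hS.differentiableAt (by norm_num)).hasFDerivAt).differentiableAt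
  have e : ∀ i, pd i (inChart x (fun y ↦ h (s y))) =ᶠ[nhds z]
      fun w ↦ h' (inChart x s w) * pd i (inChart x s) w := by
    intro i
    filter_upwards [hev, hS.eventually (by simp)] with w h1 h2
    exact pd_real_comp (h2.differentiableAt (by norm_num)) h1 i
  have e2 : ∀ i j, pd i (pd j (inChart x (fun y ↦ h (s y)))) z =
      h'' * pd i (inChart x s) z * pd j (inChart x s) z +
        h' (s x) * pd i (pd j (inChart x s)) z := by
    intro i j
    rw [Filter.EventuallyEq.pd_eq (e j), pd_mul hd' (differentiableAt_pd hS j),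
      pd_real_comp (hS.differentiableAt (by norm_num)) (by rw [hSz]; exact hh'), hSz]
  simp only [chartLaplacian, e2, (e _).eq_of_nhds, hSz]
  ring

lemma laplaceBeltrami_const_mul {x : N} {f : N → ℝ} (hf : ContMDiffAt (𝓡 2) 𝓘(ℝ, ℝ) 2 f x)
    (c : ℝ) : laplaceBeltrami (fun y ↦ c * f y) x = c * laplaceBeltrami f x := by
  have := laplaceBeltrami_comp (h := fun t ↦ c * t) (h' := fun _ ↦ c) (h'' := 0) hf
    (by fun_prop) (.of_forall fun t ↦ by simpa using (hasDerivAt_id t).const_mul c)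
    (hasDerivAt_const _ _)
  simpa using this

lemma laplaceBeltrami_add_const {x : N} {f : N → ℝ} (hf : ContMDiffAt (𝓡 2) 𝓘(ℝ, ℝ) 2 f x)
    (c : ℝ) : laplaceBeltrami (fun y ↦ f y + c) x = laplaceBeltrami f x := by
  have := laplaceBeltrami_comp (h := fun t ↦ t + c) (h' := fun _ ↦ 1) (h'' := 0) hf
    (by fun_prop) (.of_forall fun t ↦ by simpa using (hasDerivAt_id t).add_const c)
    (hasDerivAt_const _ _)
  simpa using this

lemma IsLocalMin.laplaceBeltrami_nonneg {x : N} {f : N → ℝ} (h : IsLocalMin f x)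
    (hf : ContMDiffAt (𝓡 2) 𝓘(ℝ, ℝ) 2 f x) : 0 ≤ laplaceBeltrami f x := by
  have hx := mem_extChartAt_source (I := 𝓡 2) x
  have hF := contDiffAt_inChart hx hf
  rw [laplaceBeltrami_eq_chartLaplacian hx hf]
  set z := extChartAt (𝓡 2) x x with hzdef
  have hz : z ∈ (extChartAt (𝓡 2) x).target := mem_extChartAt_target x
  have hsymm : (extChartAt (𝓡 2) x).symm z = x := extChartAt_to_inv x
  have hm : IsLocalMin (inChart x f) z := by
    have hc : Filter.Tendsto (extChartAt (𝓡 2) x).symm (nhds z) (nhds x) := by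
      have := (mdifferentiableAt_chart_symm hz).continuousAt.tendsto
      rwa [hsymm] at this
    filter_upwards [hc.eventually h] with w hw
    simpa only [inChart, hsymm] using hw
  have h0 : ∀ i, pd i (inChart x f) z = 0 := fun i ↦ by simp [pd, hm.fderiv_eq_zero]
  have hH := IsLocalMin.hessian_nonneg hm hF
  have hg0 := gram_zero_zero_pos hz
  have hd := gram_det_pos hz
  -- completing the square in the inverse matrix `g^{ij}` writes the second order part as a
  -- combination of two values of the Hessian form with positive coefficients
  have e : chartLaplacian x (inChart x f) z = ((gram x z).det * gram x z 0 0)⁻¹ *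
      ((gram x z 0 1 ^ 2 * pd 0 (pd 0 (inChart x f)) z +
        2 * gram x z 0 1 * (-gram x z 0 0) * pd 0 (pd 1 (inChart x f)) z +
        (-gram x z 0 0) ^ 2 * pd 1 (pd 1 (inChart x f)) z) +
        (gram x z).det * pd 0 (pd 0 (inChart x f)) z) := by
    rw [chartLaplacian, h0, h0, cometric_zero_zero, cometric_zero_one, cometric_one_one]
    field_simp
    rw [gram_det]
    ring
  rw [e]
  have h1 := hH (gram x z 0 1) (-gram x z 0 0)
  have h2 := hH 1 0
  simp only [one_pow, one_mul, mul_zero, zero_mul, add_zero] at h2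
  norm_num at h2
  positivity

end Laplacian

/-! ### Comparison of the Riemannian distance with a chart -/

section Distance

variable {N : Type*} [EMetricSpace N]

lemma mem_geodesicBall_iff {p x : N} {s : ℝ} :
    x ∈ geodesicBall p s ↔ edist x p < ENNReal.ofReal s := Iff.rfl

lemma mem_geodesicBall_iff_rdist {p x : N} {s : ℝ} (h : edist x p ≠ ⊤) :
    x ∈ geodesicBall p s ↔ rdist x p < s := by
  rw [mem_geodesicBall_iff, rdist, ENNReal.lt_ofReal_iff_toReal_lt h]

lemma rdist_nonneg (x y : N) : 0 ≤ rdist x y := ENNReal.toReal_nonneg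

lemma rdist_comm (x y : N) : rdist x y = rdist y x := by rw [rdist, rdist, edist_comm]

lemma rdist_triangle {x y z : N} (h1 : edist x y ≠ ⊤) (h2 : edist y z ≠ ⊤) :
    rdist x z ≤ rdist x y + rdist y z := by
  rw [rdist, rdist, rdist, ← ENNReal.toReal_add h1 h2]
  exact ENNReal.toReal_mono (ENNReal.add_ne_top.2 ⟨h1, h2⟩) (edist_triangle _ _ _)

lemma edist_ne_top_of_mem_geodesicBall {p x y : N} {s t : ℝ} (hx : x ∈ geodesicBall p s)
    (hy : y ∈ geodesicBall p t) : edist x y ≠ ⊤ := by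
  have h : edist x y ≤ edist x p + edist y p := edist_triangle_right _ _ _
  refine ne_top_of_le_ne_top (ENNReal.add_ne_top.2 ⟨?_, ?_⟩) h
  · exact (lt_of_lt_of_le hx le_top).ne
  · exact (lt_of_lt_of_le hy le_top).ne

lemma self_mem_geodesicBall {p : N} {s : ℝ} (hs : 0 < s) : p ∈ geodesicBall p s := by
  simpa [geodesicBall] using hs

lemma isOpen_geodesicBall (p : N) (s : ℝ) : IsOpen (geodesicBall p s) :=
  Metric.isOpen_eball

lemma isClosed_closedGeodesicBall (p : N) (s : ℝ) : IsClosed (closedGeodesicBall p s) :=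
  Metric.isClosed_closedEBall

lemma exists_geodesicBall_subset {p : N} {u : Set N} (hu : u ∈ nhds p) :
    ∃ s : ℝ, 0 < s ∧ geodesicBall p s ⊆ u := by
  obtain ⟨ε, hε, h⟩ := EMetric.mem_nhds_iff.1 hu
  obtain ⟨t, ht0, ht⟩ := ENNReal.lt_iff_exists_nnreal_btwn.1 hε
  refine ⟨t, by exact_mod_cast ht0, fun x hx ↦ h ?_⟩
  have hx' : edist x p < ENNReal.ofReal t := hx
  rw [ENNReal.ofReal_coe_nnreal] at hx'
  exact hx'.trans ht

end Distance

section ChartDistance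

set_option linter.unusedSectionVars false

variable {N : Type*} [EMetricSpace N] [ChartedSpace (EuclideanSpace ℝ (Fin 2)) N]
  [IsManifold (𝓡 2) ∞ N] [RiemannianBundle (fun x : N ↦ TangentSpace (𝓡 2) x)]
  [IsContMDiffRiemannianBundle (𝓡 2) ∞ (EuclideanSpace ℝ (Fin 2))
    (fun x : N ↦ TangentSpace (𝓡 2) x)]

lemma isContinuousRiemannianBundle_tangentSpace :
    IsContinuousRiemannianBundle Plane (fun x : N ↦ TangentSpace (𝓡 2) x) := by
  obtain ⟨g, hg, h⟩ := IsContMDiffRiemannianBundle.exists_contMDiff (IB := 𝓡 2) (n := ∞)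
    (F := EuclideanSpace ℝ (Fin 2)) (E := fun x : N ↦ TangentSpace (𝓡 2) x)
  exact ⟨g, hg.continuous, h⟩

/-- After composition with a suitable linear isomorphism onto `ℂ`, the differential of a chart is
almost isometric near the centre of the chart. -/
lemma exists_normalization (x₀ : N) : ∃ B : Plane ≃L[ℝ] ℂ, ∀ r : ℝ, 1 < r →
    ∀ᶠ y in nhds x₀, ∀ X : TangentSpace (𝓡 2) y,
      ‖B (pull x₀ y X)‖ ≤ r * ‖X‖ ∧ ‖X‖ ≤ r * ‖B (pull x₀ y X)‖ := by
  have := isContinuousRiemannianBundle_tangentSpace (N := N)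
  have hdim : Module.finrank ℝ (TangentSpace (𝓡 2) x₀) = 2 := by
    change Module.finrank ℝ (EuclideanSpace ℝ (Fin 2)) = 2
    simp
  set e := trivializationAt Plane (TangentSpace (𝓡 2) : N → Type _) x₀ with he
  have hx₀ : x₀ ∈ e.baseSet := FiberBundle.mem_baseSet_trivializationAt' x₀
  let e₀ : Plane ≃L[ℝ] TangentSpace (𝓡 2) x₀ := (e.continuousLinearEquivAt ℝ x₀ hx₀).symm
  let i₁ : TangentSpace (𝓡 2) x₀ ≃ₗᵢ[ℝ] ℂ :=
    ((stdOrthonormalBasis ℝ (TangentSpace (𝓡 2) x₀)).reindex (finCongr hdim)).repr.trans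
      Complex.orthonormalBasisOneI.repr.symm
  refine ⟨e₀.trans i₁.toContinuousLinearEquiv, fun r hr ↦ ?_⟩
  have hB : ∀ v, ‖(e₀.trans i₁.toContinuousLinearEquiv) v‖ = ‖e.symmL ℝ x₀ v‖ := by
    intro v
    change ‖i₁ (e₀ v)‖ = _
    rw [i₁.norm_map]
    exact congrArg (fun A : Plane → TangentSpace (𝓡 2) x₀ ↦ ‖A v‖)
      (e.symm_continuousLinearEquivAt_eq (R := ℝ) hx₀)
  filter_upwards [eventually_norm_symmL_trivializationAt_self_comp_lt Plane
    (fun x : N ↦ TangentSpace (𝓡 2) x) x₀ hr,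
    eventually_norm_symmL_trivializationAt_comp_self_lt Plane
    (fun x : N ↦ TangentSpace (𝓡 2) x) x₀ hr, chart_source_mem_nhds (EuclideanSpace ℝ (Fin 2)) x₀]
    with y h1 h2 hy X
  have hyb : y ∈ e.baseSet := by simpa [he] using hy
  have hp : pull x₀ y X = e.continuousLinearMapAt ℝ y X := by
    rw [TangentBundle.continuousLinearMapAt_trivializationAt (𝕜 := ℝ) (I := 𝓡 2) hy]
    rfl
  rw [hB, hp]
  constructor
  · exact (ContinuousLinearMap.le_opNorm
      ((e.symmL ℝ x₀) ∘L (e.continuousLinearMapAt ℝ y)) X).trans (by gcongr)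
  · have h3 := ContinuousLinearMap.le_opNorm ((e.symmL ℝ y) ∘L (e.continuousLinearMapAt ℝ x₀))
      (e.symmL ℝ x₀ (e.continuousLinearMapAt ℝ y X))
    simp only [ContinuousLinearMap.comp_apply] at h3
    rw [Trivialization.continuousLinearMapAt_symmL _ hx₀,
      Trivialization.symmL_continuousLinearMapAt _ hyb] at h3
    exact h3.trans (by gcongr)

open MeasureTheory in
/-- A short path has a short image in a chart. -/
lemma enorm_chart_sub_le {x₀ : N} {B : Plane ≃L[ℝ] ℂ} {r : ℝ} {γ : ℝ → N}
    (hγ : ContMDiffOn 𝓘(ℝ, ℝ) (𝓡 2) 1 γ (Icc 0 1))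
    (hs : ∀ t ∈ Icc (0 : ℝ) 1, γ t ∈ (extChartAt (𝓡 2) x₀).source)
    (hr : ∀ t ∈ Icc (0 : ℝ) 1, ∀ X : TangentSpace (𝓡 2) (γ t), ‖B (pull x₀ (γ t) X)‖ ≤ r * ‖X‖) :
    ‖B (extChartAt (𝓡 2) x₀ (γ 1)) - B (extChartAt (𝓡 2) x₀ (γ 0))‖ₑ ≤
      ENNReal.ofReal r * pathELength (𝓡 2) γ 0 1 := by
  set c : ℝ → Plane := extChartAt (𝓡 2) x₀ ∘ γ with hc
  have hcs : ContDiffOn ℝ 1 c (Icc 0 1) := by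
    rw [← contMDiffOn_iff_contDiffOn]
    exact contMDiffOn_extChartAt.comp (I' := 𝓡 2)
      (t := (chartAt (EuclideanSpace ℝ (Fin 2)) x₀).source) hγ
      (fun t ht ↦ mem_chart_source_of_mem (hs t ht))
  have hBc : ContDiffOn ℝ 1 (fun t ↦ B (c t)) (Icc 0 1) :=
    (B : Plane →L[ℝ] ℂ).contDiff.comp_contDiffOn hcs
  have h1 := enorm_sub_le_lintegral_derivWithin_Icc_of_contDiffOn_Icc hBc zero_le_one
  refine h1.trans ?_
  rw [pathELength_eq_lintegral_mfderivWithin_Icc, ← lintegral_const_mul' _ _ ENNReal.ofReal_ne_top]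
  apply setLIntegral_mono' measurableSet_Icc (fun t ht ↦ ?_)
  have hu : UniqueDiffWithinAt ℝ (Icc (0 : ℝ) 1) t := uniqueDiffOn_Icc zero_lt_one t ht
  have hm : mfderivWithin 𝓘(ℝ, ℝ) 𝓘(ℝ, Plane) c (Icc 0 1) t =
      (mfderiv (𝓡 2) 𝓘(ℝ, Plane) (extChartAt (𝓡 2) x₀) (γ t)) ∘L
        (mfderivWithin 𝓘(ℝ, ℝ) (𝓡 2) γ (Icc 0 1) t) := by
    apply mfderiv_comp_mfderivWithin
    · exact mdifferentiableAt_extChartAt (mem_chart_source_of_mem (hs t ht))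
    · exact hγ.mdifferentiableOn one_ne_zero t ht
    · rw [uniqueMDiffWithinAt_iff_uniqueDiffWithinAt]
      exact hu
  rw [mfderivWithin_eq_fderivWithin] at hm
  have hcd : DifferentiableWithinAt ℝ c (Icc 0 1) t := hcs.differentiableOn one_ne_zero t ht
  have h2 : derivWithin (fun t ↦ B (c t)) (Icc 0 1) t =
      B (pull x₀ (γ t) (mfderivWithin 𝓘(ℝ, ℝ) (𝓡 2) γ (Icc 0 1) t (1 : ℝ))) := by
    have h3 := (B : Plane →L[ℝ] ℂ).hasFDerivAt.comp_hasDerivWithinAt t hcd.hasDerivWithinAt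
    have h4 := h3.derivWithin hu
    change derivWithin (⇑(B : Plane →L[ℝ] ℂ) ∘ c) (Icc 0 1) t = _
    rw [h4, ← fderivWithin_derivWithin]
    exact congrArg (fun A : ℝ →L[ℝ] Plane ↦ B (A 1)) hm
  rw [h2, ← ofReal_norm, ← ofReal_norm]
  refine (ENNReal.ofReal_le_ofReal (hr t ht _)).trans ?_
  by_cases hr0 : 0 ≤ r
  · rw [ENNReal.ofReal_mul hr0]
    rfl
  · rw [ENNReal.ofReal_of_nonpos (mul_nonpos_of_nonpos_of_nonneg (not_le.1 hr0).le (norm_nonneg _))]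
    exact zero_le

open MeasureTheory in
/-- The Riemannian distance is controlled by the distance in a chart, as long as the segment joining
the two points stays in the chart. -/
lemma edist_chart_symm_le [IsRiemannianManifold (𝓡 2) N] {x₀ : N} {B : Plane ≃L[ℝ] ℂ} {r : ℝ}
    {a b : Plane} (hs : segment ℝ a b ⊆ (extChartAt (𝓡 2) x₀).target)
    (hr : ∀ z ∈ segment ℝ a b, ∀ v : Plane, ‖push x₀ z v‖ ≤ r * ‖B v‖) :
    edist ((extChartAt (𝓡 2) x₀).symm a) ((extChartAt (𝓡 2) x₀).symm b) ≤
      ENNReal.ofReal (r * ‖B (b - a)‖) := by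
  rw [IsRiemannianManifold.out (I := 𝓡 2)]
  let η := ContinuousAffineMap.lineMap (R := ℝ) a b
  have hη : ∀ t ∈ Icc (0 : ℝ) 1, η t ∈ segment ℝ a b := by
    intro t ht
    rw [segment_eq_image_lineMap]
    exact ⟨t, ht, rfl⟩
  have η_smooth : ContMDiffOn 𝓘(ℝ, ℝ) 𝓘(ℝ, Plane) 1 η (Icc 0 1) := by
    apply ContMDiff.contMDiffOn
    rw [contMDiff_iff_contDiff]
    exact ContinuousAffineMap.contDiff _
  have h1 : riemannianEDist (𝓡 2) ((extChartAt (𝓡 2) x₀).symm a) ((extChartAt (𝓡 2) x₀).symm b) ≤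
      pathELength (𝓡 2) ((extChartAt (𝓡 2) x₀).symm ∘ η) 0 1 := by
    apply riemannianEDist_le_pathELength _ _ _ zero_le_one
    · exact (contMDiffOn_extChartAt_symm x₀).comp η_smooth (fun t ht ↦ hs (hη t ht))
    · simp [η, ContinuousAffineMap.coe_lineMap_eq]
    · simp [η, ContinuousAffineMap.coe_lineMap_eq]
  refine h1.trans ?_
  rw [pathELength_eq_lintegral_mfderivWithin_Icc]
  have h2 : ∫⁻ _ in Icc (0 : ℝ) 1, ENNReal.ofReal (r * ‖B (b - a)‖) =
      ENNReal.ofReal (r * ‖B (b - a)‖) := by simp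
  rw [← h2]
  apply setLIntegral_mono' measurableSet_Icc (fun t ht ↦ ?_)
  have hu : UniqueDiffWithinAt ℝ (Icc (0 : ℝ) 1) t := uniqueDiffOn_Icc zero_lt_one t ht
  have hm : mfderivWithin 𝓘(ℝ, ℝ) (𝓡 2) ((extChartAt (𝓡 2) x₀).symm ∘ η) (Icc 0 1) t =
      (mfderiv 𝓘(ℝ, Plane) (𝓡 2) (extChartAt (𝓡 2) x₀).symm (η t)) ∘L
        (mfderivWithin 𝓘(ℝ, ℝ) 𝓘(ℝ, Plane) η (Icc 0 1) t) := by
    apply mfderiv_comp_mfderivWithin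
    · exact mdifferentiableAt_chart_symm (hs (hη t ht))
    · exact η_smooth.mdifferentiableOn one_ne_zero t ht
    · rw [uniqueMDiffWithinAt_iff_uniqueDiffWithinAt]
      exact hu
  have hd : fderivWithin ℝ η (Icc 0 1) t 1 = b - a := by
    rw [fderivWithin_eq_fderiv hu (ContinuousAffineMap.differentiableAt _)]
    simp [η]
  have h3 : mfderivWithin 𝓘(ℝ, ℝ) (𝓡 2) ((extChartAt (𝓡 2) x₀).symm ∘ η) (Icc 0 1) t (1 : ℝ) =
      push x₀ (η t) (b - a) := by
    rw [mfderivWithin_eq_fderivWithin] at hm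
    rw [← hd]
    exact congrArg (fun A : ℝ →L[ℝ] TangentSpace (𝓡 2) ((extChartAt (𝓡 2) x₀).symm (η t)) ↦
      A (1 : ℝ)) hm
  have h4 := hr (η t) (hη t ht) (b - a)
  calc _ = ‖push x₀ (η t) (b - a)‖ₑ := congrArg (fun v => ‖v‖ₑ) h3
    _ ≤ _ := by
      rw [← ofReal_norm]
      exact ENNReal.ofReal_le_ofReal h4

end ChartDistance

section NormalizedChart

set_option linter.unusedSectionVars false

variable {N : Type*} [EMetricSpace N] [ChartedSpace (EuclideanSpace ℝ (Fin 2)) N]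
  [IsManifold (𝓡 2) ∞ N] [RiemannianBundle (fun x : N ↦ TangentSpace (𝓡 2) x)]

/-- The chart at `x₀`, followed by the linear map `B`, distorts distances and tangent vectors by a
factor at most `11 / 10` on the geodesic ball of radius `δ`, and its inverse is defined on discs of
radius `ρ` around points at distance less than `ρ` from `x₀`. -/
structure IsNormalizedChart (x₀ : N) (B : Plane ≃L[ℝ] ℂ) (δ ρ : ℝ) : Prop where
  ρ_pos : 0 < ρ
  ρ_le : 2 * ρ ≤ δ
  mem_source : ∀ y ∈ geodesicBall x₀ δ, y ∈ (extChartAt (𝓡 2) x₀).source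
  norm_pull_le : ∀ y ∈ geodesicBall x₀ δ, ∀ X : TangentSpace (𝓡 2) y,
    ‖B (pull x₀ y X)‖ ≤ 11 / 10 * ‖X‖
  norm_le : ∀ y ∈ geodesicBall x₀ δ, ∀ X : TangentSpace (𝓡 2) y,
    ‖X‖ ≤ 11 / 10 * ‖B (pull x₀ y X)‖
  rdist_le : ∀ y ∈ geodesicBall x₀ δ, ∀ y' ∈ geodesicBall x₀ δ,
    rdist y y' ≤ 11 / 10 * ‖B (extChartAt (𝓡 2) x₀ y - extChartAt (𝓡 2) x₀ y')‖
  le_rdist : ∀ y ∈ geodesicBall x₀ δ, ∀ y' ∈ geodesicBall x₀ δ,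
    ‖B (extChartAt (𝓡 2) x₀ y - extChartAt (𝓡 2) x₀ y')‖ ≤ 11 / 10 * rdist y y'
  symm_mem : ∀ p ∈ geodesicBall x₀ ρ, ∀ z : Plane, ‖B (z - extChartAt (𝓡 2) x₀ p)‖ < ρ →
    z ∈ (extChartAt (𝓡 2) x₀).target ∧ (extChartAt (𝓡 2) x₀).symm z ∈ geodesicBall x₀ δ

lemma exists_norm_lt_subset (B : Plane ≃L[ℝ] ℂ) {z₀ : Plane} {u : Set Plane} (hu : u ∈ nhds z₀) :
    ∃ σ : ℝ, 0 < σ ∧ ∀ z, ‖B (z - z₀)‖ < σ → z ∈ u := by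
  have hc : Filter.Tendsto (fun c : ℂ ↦ z₀ + B.symm c) (nhds 0) (nhds z₀) := by
    have : Continuous (fun c : ℂ ↦ z₀ + B.symm c) := by fun_prop
    simpa using this.tendsto 0
  obtain ⟨σ, hσ, h⟩ := Metric.mem_nhds_iff.1 (hc hu)
  refine ⟨σ, hσ, fun z hz ↦ ?_⟩
  have := h (a := B (z - z₀)) (by simpa using hz)
  simpa using this

/-- The bounds on tangent vectors are continuity of the metric at `x₀`. Those on distances follow by
measuring coordinate segments with the metric, and short paths in the coordinates. -/
lemma exists_isNormalizedChart [IsContMDiffRiemannianBundle (𝓡 2) ∞ (EuclideanSpace ℝ (Fin 2))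
    (fun x : N ↦ TangentSpace (𝓡 2) x)] [IsRiemannianManifold (𝓡 2) N] (x₀ : N) :
    ∃ (B : Plane ≃L[ℝ] ℂ) (δ ρ : ℝ), IsNormalizedChart x₀ B δ ρ := by
  obtain ⟨B, hB⟩ := exists_normalization x₀
  have hV := (hB (11 / 10) (by norm_num)).and (extChartAt_source_mem_nhds (I := 𝓡 2) x₀)
  obtain ⟨s₁, hs₁, hs₁V⟩ := exists_geodesicBall_subset hV
  set φ := extChartAt (𝓡 2) x₀ with hφ
  set z₀ := φ x₀ with hz₀
  have hz₀t : z₀ ∈ φ.target := mem_extChartAt_target x₀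
  have hsymm₀ : φ.symm z₀ = x₀ := extChartAt_to_inv x₀
  have hpre : ∀ s : ℝ, 0 < s → ∃ σ : ℝ, 0 < σ ∧ ∀ z, ‖B (z - z₀)‖ < σ →
      z ∈ φ.target ∧ φ.symm z ∈ geodesicBall x₀ s := by
    intro s hs
    refine exists_norm_lt_subset B (u := φ.target ∩ φ.symm ⁻¹' geodesicBall x₀ s) ?_
    refine Filter.inter_mem ((isOpen_extChartAt_target x₀).mem_nhds hz₀t) ?_
    refine (mdifferentiableAt_chart_symm hz₀t).continuousAt.preimage_mem_nhds ?_
    apply (isOpen_geodesicBall x₀ s).mem_nhds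
    change φ.symm z₀ ∈ _
    rw [hsymm₀]
    exact self_mem_geodesicBall hs
  have himg : ∀ σ : ℝ, 0 < σ → ∃ s : ℝ, 0 < s ∧ ∀ y ∈ geodesicBall x₀ s, ‖B (φ y - z₀)‖ < σ := by
    intro σ hσ
    apply exists_geodesicBall_subset
    have hc : ContinuousAt (fun y ↦ ‖B (φ y - z₀)‖) x₀ :=
      (B.continuous.continuousAt.comp ((continuousAt_extChartAt x₀).sub continuousAt_const)).norm
    have h0 : ‖B (φ x₀ - z₀)‖ < σ := by simpa [hz₀] using hσ
    exact hc.eventually (gt_mem_nhds h0)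
  obtain ⟨σ, hσ, hW⟩ := hpre s₁ hs₁
  obtain ⟨s₂, hs₂, hs₂W⟩ := himg σ hσ
  set δ := min s₂ (s₁ / 3) with hδ
  have hδ0 : 0 < δ := by positivity
  have hδ1 : 3 * δ ≤ s₁ := by have := min_le_right s₂ (s₁ / 3); rw [← hδ] at this; linarith
  have hsub1 : geodesicBall x₀ δ ⊆ geodesicBall x₀ s₁ := fun y hy ↦
    lt_of_lt_of_le hy (ENNReal.ofReal_le_ofReal (by linarith))
  have hsub2 : geodesicBall x₀ δ ⊆ geodesicBall x₀ s₂ := fun y hy ↦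
    lt_of_lt_of_le hy (ENNReal.ofReal_le_ofReal (min_le_left _ _))
  obtain ⟨σ', hσ', hW'⟩ := hpre δ hδ0
  obtain ⟨s₃, hs₃, hs₃W⟩ := himg (σ' / 2) (by positivity)
  have hsrc : ∀ y ∈ geodesicBall x₀ s₁, y ∈ φ.source := fun y hy ↦ (hs₁V hy).2
  refine ⟨B, δ, min (σ' / 2) (min s₃ (δ / 2)), ⟨by positivity, ?_, fun y hy ↦ hsrc y (hsub1 hy),
    fun y hy X ↦ ((hs₁V (hsub1 hy)).1 X).1, fun y hy X ↦ ((hs₁V (hsub1 hy)).1 X).2, ?_, ?_, ?_⟩⟩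
  · have : min (σ' / 2) (min s₃ (δ / 2)) ≤ δ / 2 := (min_le_right _ _).trans (min_le_right _ _)
    linarith
  · intro y hy y' hy'
    have hconv : Convex ℝ {z : Plane | ‖B (z - z₀)‖ < σ} := by
      have : {z : Plane | ‖B (z - z₀)‖ < σ} =
          (fun z ↦ z + (-z₀)) ⁻¹' ((B : Plane →ₗ[ℝ] ℂ) ⁻¹' Metric.ball 0 σ) := by
        ext z; simp [sub_eq_add_neg]
      rw [this]
      exact ((convex_ball (0 : ℂ) σ).linear_preimage (B : Plane →ₗ[ℝ] ℂ)).translate_preimage_left _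
    have hseg : segment ℝ (φ y) (φ y') ⊆ {z : Plane | ‖B (z - z₀)‖ < σ} :=
      hconv.segment_subset (hs₂W y (hsub2 hy)) (hs₂W y' (hsub2 hy'))
    have h1 := edist_chart_symm_le (x₀ := x₀) (B := B) (r := 11 / 10)
      (fun z hz ↦ (hW z (hseg hz)).1) (fun z hz v ↦ by
        have h2 := ((hs₁V (hW z (hseg hz)).2).1 (push x₀ z v)).2
        rwa [pull_push (hW z (hseg hz)).1] at h2)
    rw [← hφ, φ.left_inv (hsrc y (hsub1 hy)), φ.left_inv (hsrc y' (hsub1 hy')), ← norm_neg,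
      ← map_neg, neg_sub] at h1
    exact ENNReal.toReal_le_of_le_ofReal (by positivity) h1
  · intro y hy y' hy'
    have hfin : edist y y' ≠ ⊤ := edist_ne_top_of_mem_geodesicBall hy hy'
    have hlt : edist y y' < ENNReal.ofReal (2 * δ) := by
      calc edist y y' ≤ edist y x₀ + edist y' x₀ := edist_triangle_right _ _ _
        _ < ENNReal.ofReal δ + ENNReal.ofReal δ := ENNReal.add_lt_add hy hy'
        _ = ENNReal.ofReal (2 * δ) := by rw [← ENNReal.ofReal_add hδ0.le hδ0.le, two_mul]
    have hlt' : rdist y y' < 2 * δ := by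
      rwa [rdist, ← ENNReal.lt_ofReal_iff_toReal_lt hfin]
    by_contra! hcon
    set m := ‖B (φ y - φ y')‖ with hm
    -- a path of length less than `10 / 11 * m` and `2 * δ` stays in the ball of radius `3 * δ`
    obtain ⟨L, hL1, hL2⟩ := exists_between (show rdist y y' < min (10 / 11 * m) (2 * δ) from
      lt_min (by linarith) hlt')
    have hL0 : 0 < L := lt_of_le_of_lt (rdist_nonneg _ _) hL1
    have hed : riemannianEDist (𝓡 2) y y' < ENNReal.ofReal L := by
      rw [← IsRiemannianManifold.out (I := 𝓡 2)]
      rwa [ENNReal.lt_ofReal_iff_toReal_lt hfin]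
    obtain ⟨γ, hγ0, hγ1, hγ, hlen⟩ := exists_lt_of_riemannianEDist_lt hed
    have hmem : ∀ t ∈ Icc (0 : ℝ) 1, γ t ∈ geodesicBall x₀ s₁ := by
      intro t ht
      have h1 : edist (γ t) y < ENNReal.ofReal (2 * δ) := by
        rw [edist_comm, IsRiemannianManifold.out (I := 𝓡 2)]
        calc riemannianEDist (𝓡 2) y (γ t) ≤ pathELength (𝓡 2) γ 0 t :=
              riemannianEDist_le_pathELength (hγ.mono (Icc_subset_Icc_right ht.2)) hγ0 rfl ht.1
          _ ≤ pathELength (𝓡 2) γ 0 1 := pathELength_mono le_rfl ht.2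
          _ < ENNReal.ofReal L := hlen
          _ ≤ ENNReal.ofReal (2 * δ) :=
              ENNReal.ofReal_le_ofReal (hL2.le.trans (min_le_right _ _))
      calc edist (γ t) x₀ ≤ edist (γ t) y + edist y x₀ := edist_triangle _ _ _
        _ < ENNReal.ofReal (2 * δ) + ENNReal.ofReal δ := ENNReal.add_lt_add h1 hy
        _ = ENNReal.ofReal (3 * δ) := by
            rw [← ENNReal.ofReal_add (by positivity) hδ0.le]; congr 1; ring
        _ ≤ ENNReal.ofReal s₁ := ENNReal.ofReal_le_ofReal hδ1
    have h2 := enorm_chart_sub_le (x₀ := x₀) (B := B) (r := 11 / 10) hγ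
      (fun t ht ↦ hsrc _ (hmem t ht)) (fun t ht X ↦ ((hs₁V (hmem t ht)).1 X).1)
    rw [hγ0, hγ1, ← map_sub, ← ofReal_norm, ← norm_neg, ← map_neg, neg_sub, ← hφ, ← hm] at h2
    have h3 : ENNReal.ofReal m < ENNReal.ofReal (11 / 10 * L) := by
      rw [ENNReal.ofReal_mul (by norm_num)]
      refine h2.trans_lt ?_
      exact ENNReal.mul_lt_mul_right (by simp) ENNReal.ofReal_ne_top hlen
    have h4 := (ENNReal.ofReal_lt_ofReal_iff (by positivity)).1 h3
    have h5 : L < 10 / 11 * m := hL2.trans_le (min_le_left _ _)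
    linarith
  · intro p hp z hz
    have hp' : ‖B (φ p - z₀)‖ < σ' / 2 := hs₃W p (lt_of_lt_of_le hp
      (ENNReal.ofReal_le_ofReal ((min_le_right _ _).trans (min_le_left _ _))))
    apply hW' z
    have h1 : ‖B (z - φ p)‖ < σ' / 2 := hz.trans_le (min_le_left _ _)
    have h2 : B (z - z₀) = B (z - φ p) + B (φ p - z₀) := by rw [← map_add]; congr 1; abel
    rw [h2]
    exact (norm_add_le _ _).trans_lt (by linarith)

namespace IsNormalizedChart

variable {x₀ : N} {B : Plane ≃L[ℝ] ℂ} {δ ρ : ℝ}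

lemma mem_ball_of_edist_le (h : IsNormalizedChart x₀ B δ ρ) {p y : N} {s : ℝ}
    (hp : p ∈ geodesicBall x₀ ρ) (hs : s < ρ) (hy : edist y p ≤ ENNReal.ofReal s) :
    y ∈ geodesicBall x₀ δ := by
  have hρ := h.ρ_pos
  calc edist y x₀ ≤ edist y p + edist p x₀ := edist_triangle _ _ _
    _ < ENNReal.ofReal ρ + ENNReal.ofReal ρ :=
        ENNReal.add_lt_add (hy.trans_lt ((ENNReal.ofReal_lt_ofReal_iff hρ).2 hs)) hp
    _ = ENNReal.ofReal (2 * ρ) := by rw [← ENNReal.ofReal_add hρ.le hρ.le, two_mul]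
    _ ≤ ENNReal.ofReal δ := ENNReal.ofReal_le_ofReal h.ρ_le

lemma mem_ball_of_mem (h : IsNormalizedChart x₀ B δ ρ) {p : N} (hp : p ∈ geodesicBall x₀ ρ) :
    p ∈ geodesicBall x₀ δ :=
  h.mem_ball_of_edist_le hp h.ρ_pos (by simp)

lemma isCompact_closedGeodesicBall (h : IsNormalizedChart x₀ B δ ρ) {p : N} {s : ℝ}
    (hp : p ∈ geodesicBall x₀ ρ) (hs0 : 0 ≤ s) (hs : 11 / 10 * s < ρ) :
    IsCompact (closedGeodesicBall p s) := by
  set φ := extChartAt (𝓡 2) x₀ with hφ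
  have hK : IsCompact ((fun c : ℂ ↦ φ p + B.symm c) '' Metric.closedBall 0 (11 / 10 * s)) :=
    (isCompact_closedBall _ _).image (by fun_prop)
  have hKt : (fun c : ℂ ↦ φ p + B.symm c) '' Metric.closedBall 0 (11 / 10 * s) ⊆ φ.target := by
    rintro _ ⟨c, hc, rfl⟩
    refine (h.symm_mem p hp _ ?_).1
    rw [mem_closedBall_zero_iff] at hc
    rw [← hφ, add_sub_cancel_left, ContinuousLinearEquiv.apply_symm_apply]
    exact hc.trans_lt hs
  refine (hK.image_of_continuousOn ((contMDiffOn_extChartAt_symm (n := ∞) x₀).continuousOn.mono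
    hKt)).of_isClosed_subset (isClosed_closedGeodesicBall p s) ?_
  intro y hy
  have hyδ : y ∈ geodesicBall x₀ δ := h.mem_ball_of_edist_le hp (by linarith) hy
  refine ⟨φ y, ⟨B (φ y - φ p), ?_, by simp⟩, φ.left_inv (h.mem_source y hyδ)⟩
  rw [mem_closedBall_zero_iff]
  refine (h.le_rdist y hyδ p (h.mem_ball_of_mem hp)).trans ?_
  gcongr
  exact ENNReal.toReal_le_of_le_ofReal hs0 hy

lemma exists_of_norm_lt (h : IsNormalizedChart x₀ B δ ρ) {p : N} (hp : p ∈ geodesicBall x₀ ρ)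
    {c : ℂ} (hc : ‖c‖ < ρ) :
    extChartAt (𝓡 2) x₀ p + B.symm c ∈ (extChartAt (𝓡 2) x₀).target ∧
    (extChartAt (𝓡 2) x₀).symm (extChartAt (𝓡 2) x₀ p + B.symm c) ∈ geodesicBall x₀ δ ∧
    rdist ((extChartAt (𝓡 2) x₀).symm (extChartAt (𝓡 2) x₀ p + B.symm c)) p ≤ 11 / 10 * ‖c‖ ∧
    ‖c‖ ≤ 11 / 10 * rdist ((extChartAt (𝓡 2) x₀).symm (extChartAt (𝓡 2) x₀ p + B.symm c)) p := by
  obtain ⟨h1, h2⟩ := h.symm_mem p hp (extChartAt (𝓡 2) x₀ p + B.symm c) (by simpa using hc)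
  have h3 := h.rdist_le _ h2 p (h.mem_ball_of_mem hp)
  have h4 := h.le_rdist _ h2 p (h.mem_ball_of_mem hp)
  rw [(extChartAt (𝓡 2) x₀).right_inv h1] at h3 h4
  simp only [add_sub_cancel_left, ContinuousLinearEquiv.apply_symm_apply] at h3 h4
  exact ⟨h1, h2, h3, h4⟩

lemma frontier_geodesicBall_nonempty (h : IsNormalizedChart x₀ B δ ρ) {p : N} {s : ℝ}
    (hp : p ∈ geodesicBall x₀ ρ) (hs0 : 0 < s) (hs : 2 * s < ρ) :
    (frontier (geodesicBall p s)).Nonempty := by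
  by_contra hemp
  -- a ball with empty frontier is open and closed
  rw [not_nonempty_iff_eq_empty, ← isClopen_iff_frontier_eq_empty] at hemp
  -- a coordinate segment starting at `p` cannot leave the ball
  set c : ℝ → N := fun t ↦ (extChartAt (𝓡 2) x₀).symm
    (extChartAt (𝓡 2) x₀ p + B.symm ((t : ℂ))) with hc
  have hlt : ∀ t ∈ Icc (0 : ℝ) (2 * s), ‖(t : ℂ)‖ < ρ := by
    intro t ht
    rw [Complex.norm_real, Real.norm_of_nonneg ht.1]
    exact ht.2.trans_lt hs
  have hcont : ContinuousOn c (Icc 0 (2 * s)) := by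
    refine (contMDiffOn_extChartAt_symm (n := ∞) x₀).continuousOn.comp (by fun_prop) ?_
    intro t ht
    exact (h.exists_of_norm_lt hp (hlt t ht)).1
  have hpre := (isPreconnected_Icc (a := (0 : ℝ)) (b := 2 * s)).image c hcont
  have hc0 : c 0 = p := by
    simp only [hc, Complex.ofReal_zero, map_zero, add_zero]
    exact (extChartAt (𝓡 2) x₀).left_inv (h.mem_source p (h.mem_ball_of_mem hp))
  have hsub := hpre.subset_isClopen hemp ⟨p, ⟨0, ⟨le_rfl, by positivity⟩, hc0⟩,
    self_mem_geodesicBall hs0⟩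
  have hend : c (2 * s) ∈ geodesicBall p s := hsub ⟨2 * s, ⟨by positivity, le_rfl⟩, rfl⟩
  obtain ⟨-, h2, -, h4⟩ := h.exists_of_norm_lt hp (hlt (2 * s) ⟨by positivity, le_rfl⟩)
  have h5 : rdist (c (2 * s)) p < s := by
    rwa [← mem_geodesicBall_iff_rdist (edist_ne_top_of_mem_geodesicBall h2 (h.mem_ball_of_mem hp))]
  rw [Complex.norm_real, Real.norm_of_nonneg (by positivity)] at h4
  change 2 * s ≤ 11 / 10 * rdist (c (2 * s)) p at h4
  linarith

/-- A gradient bound on an annulus of radii comparable to `t` bounds the oscillation over the sphere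
of radius `t`. In the coordinate `ζ = log` of the normalized chart the annulus is a convex strip. -/
lemma abs_sub_le_of_norm_grad_le (h : IsNormalizedChart x₀ B δ ρ) {p : N} {t M : ℝ}
    (hp : p ∈ geodesicBall x₀ ρ) (ht0 : 0 < t) (ht : 2 * t < ρ) (hM : 0 ≤ M) {f : N → ℝ}
    (hf : ∀ y ∈ geodesicBall x₀ δ, t / 2 ≤ rdist y p → rdist y p ≤ 3 / 2 * t →
      MDifferentiableAt (𝓡 2) 𝓘(ℝ, ℝ) f y ∧ ‖grad f y‖ ≤ M / t)
    {x y : N} (hx : x ∈ geodesicBall x₀ δ) (hxt : rdist x p = t) (hy : y ∈ geodesicBall x₀ δ)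
    (hyt : rdist y p = t) : |f x - f y| ≤ 10 * M := by
  set φ := extChartAt (𝓡 2) x₀ with hφ
  set P : ℂ → Plane := fun c ↦ φ p + B.symm c with hP
  set S : Set ℂ := {ζ | Real.log (10 / 11 * t) ≤ ζ.re} ∩ {ζ | ζ.re ≤ Real.log (11 / 10 * t)} with hS
  have hSconv : Convex ℝ S :=
    (convex_halfSpace_re_ge _).inter (convex_halfSpace_re_le _)
  have hSn : ∀ ζ ∈ S, 10 / 11 * t ≤ ‖Complex.exp ζ‖ ∧ ‖Complex.exp ζ‖ ≤ 11 / 10 * t := by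
    intro ζ hζ
    rw [Complex.norm_exp]
    exact ⟨(Real.log_le_iff_le_exp (by positivity)).1 hζ.1,
      (Real.le_log_iff_exp_le (by positivity)).1 hζ.2⟩
  set G : ℂ → ℝ := fun ζ ↦ inChart x₀ f (P (Complex.exp ζ)) with hG
  -- the factor `‖exp ζ‖ ≤ 11 / 10 * t` from the chain rule cancels the `t` in the gradient bound
  have hder : ∀ ζ ∈ S, HasFDerivAt (𝕜 := ℝ) G
      ((fderiv ℝ (inChart x₀ f) (P (Complex.exp ζ))) ∘L (B.symm : ℂ →L[ℝ] Plane) ∘L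
        ((ContinuousLinearMap.toSpanSingleton ℂ (Complex.exp ζ)).restrictScalars ℝ)) ζ ∧
      ‖(fderiv ℝ (inChart x₀ f) (P (Complex.exp ζ))) ∘L (B.symm : ℂ →L[ℝ] Plane) ∘L
        ((ContinuousLinearMap.toSpanSingleton ℂ (Complex.exp ζ)).restrictScalars ℝ)‖ ≤
          5 / 4 * M := by
    intro ζ hζ
    obtain ⟨hn1, hn2⟩ := hSn ζ hζ
    obtain ⟨h1, h2, h3, h4⟩ := h.exists_of_norm_lt hp (c := Complex.exp ζ) (by linarith)
    obtain ⟨hd, hg⟩ := hf _ h2 (by linarith) (by linarith)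
    have hFd : DifferentiableAt ℝ (inChart x₀ f) (P (Complex.exp ζ)) := by
      rw [← mdifferentiableAt_iff_differentiableAt]
      exact hd.comp _ (mdifferentiableAt_chart_symm h1)
    constructor
    · refine HasFDerivAt.comp (g := inChart x₀ f) (f := fun ζ ↦ P (Complex.exp ζ)) ζ
        hFd.hasFDerivAt ?_
      have h5 : HasFDerivAt (𝕜 := ℝ) Complex.exp
          ((ContinuousLinearMap.toSpanSingleton ℂ (Complex.exp ζ)).restrictScalars ℝ) ζ :=
        (Complex.hasDerivAt_exp ζ).hasFDerivAt.restrictScalars ℝ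
      exact ((B.symm : ℂ →L[ℝ] Plane).hasFDerivAt.comp ζ h5).const_add _
    · refine ContinuousLinearMap.opNorm_le_bound _ (by positivity) fun w ↦ ?_
      simp only [ContinuousLinearMap.comp_apply]
      rw [fderiv_chart h1 hd]
      set v : Plane := (B.symm : ℂ →L[ℝ] Plane)
        (((ContinuousLinearMap.toSpanSingleton ℂ (Complex.exp ζ)).restrictScalars ℝ) w) with hv
      have hBv : ‖B v‖ = ‖w‖ * ‖Complex.exp ζ‖ := by
        rw [hv]
        simp
      have h5 := h.norm_le _ h2 (push x₀ (P (Complex.exp ζ)) v)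
      rw [pull_push h1, hBv] at h5
      have h6 : mfderiv (𝓡 2) 𝓘(ℝ, ℝ) f (φ.symm (P (Complex.exp ζ)))
          (push x₀ (P (Complex.exp ζ)) v) =
          inner ℝ (grad f (φ.symm (P (Complex.exp ζ)))) (push x₀ (P (Complex.exp ζ)) v) := by
        rw [grad, InnerProductSpace.toDual_symm_apply]
        rfl
      have h7 : ‖push x₀ (P (Complex.exp ζ)) v‖ ≤ 11 / 10 * (‖w‖ * (11 / 10 * t)) :=
        h5.trans (by gcongr)
      calc _ = ‖inner ℝ (grad f (φ.symm (P (Complex.exp ζ)))) (push x₀ (P (Complex.exp ζ)) v)‖ :=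
            congrArg _ h6
        _ ≤ ‖grad f (φ.symm (P (Complex.exp ζ)))‖ * ‖push x₀ (P (Complex.exp ζ)) v‖ :=
            norm_inner_le_norm _ _
        _ ≤ M / t * (11 / 10 * (‖w‖ * (11 / 10 * t))) :=
            mul_le_mul hg h7 (norm_nonneg _) (by positivity)
        _ = 121 / 100 * (M * ‖w‖) := by field_simp; ring
        _ ≤ 5 / 4 * M * ‖w‖ := by nlinarith [mul_nonneg hM (norm_nonneg w)]
  -- points of the sphere have logarithmic coordinates with imaginary part at most `π`
  have hlog : ∀ u ∈ geodesicBall x₀ δ, rdist u p = t →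
      ∃ ζ ∈ S, |ζ.im| ≤ Real.pi ∧ G ζ = f u := by
    intro u hu hut
    have h1 := h.rdist_le u hu p (h.mem_ball_of_mem hp)
    have h2 := h.le_rdist u hu p (h.mem_ball_of_mem hp)
    rw [hut, ← hφ] at h1 h2
    set c := B (φ u - φ p) with hc
    have hc0 : c ≠ 0 := by
      rw [← norm_pos_iff]; linarith
    refine ⟨Complex.log c, ⟨?_, ?_⟩, ?_, ?_⟩
    · simp only [mem_ofPred_eq, Complex.log_re]
      exact Real.log_le_log (by positivity) (by linarith)
    · simp only [mem_ofPred_eq, Complex.log_re]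
      exact Real.log_le_log (norm_pos_iff.2 hc0) h2
    · rw [Complex.log_im]
      exact Complex.abs_arg_le_pi c
    · have h3 : P (Complex.exp (Complex.log c)) = φ u := by
        rw [Complex.exp_log hc0, hP, hc]
        simp only [ContinuousLinearEquiv.symm_apply_apply, add_sub_cancel]
      simp only [hG, h3, inChart]
      rw [← hφ, φ.left_inv (h.mem_source u hu)]
  obtain ⟨ζ, hζ, hζi, hζf⟩ := hlog x hx hxt
  obtain ⟨ξ, hξ, hξi, hξf⟩ := hlog y hy hyt
  have key := hSconv.norm_image_sub_le_of_norm_hasFDerivWithin_le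
    (fun ζ hζ ↦ (hder ζ hζ).1.hasFDerivWithinAt) (fun ζ hζ ↦ (hder ζ hζ).2) hξ hζ
  rw [hζf, hξf, Real.norm_eq_abs] at key
  refine key.trans ?_
  have h1 : ‖ζ - ξ‖ ≤ |(ζ - ξ).re| + |(ζ - ξ).im| := Complex.norm_le_abs_re_add_abs_im _
  have hl : Real.log (11 / 10 * t) - Real.log (10 / 11 * t) ≤ 21 / 100 := by
    rw [← Real.log_div (by positivity) (by positivity)]
    have : 11 / 10 * t / (10 / 11 * t) = 121 / 100 := by field_simp; norm_num
    rw [this]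
    linarith [Real.log_le_sub_one_of_pos (show (0 : ℝ) < 121 / 100 by norm_num)]
  have h2 : |(ζ - ξ).re| ≤ 21 / 100 := by
    rw [Complex.sub_re, abs_le]
    have a1 := hζ.1; have a2 := hζ.2; have b1 := hξ.1; have b2 := hξ.2
    simp only [mem_ofPred_eq] at a1 a2 b1 b2
    constructor <;> linarith
  have h3 : |(ζ - ξ).im| ≤ 2 * Real.pi := by
    rw [Complex.sub_im]
    exact (abs_sub _ _).trans (by linarith)
  have hpi := Real.pi_lt_d2
  nlinarith

end IsNormalizedChart

end NormalizedChart

/-! ### The squared distance in coordinates frozen at a point -/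

lemma differentiableAt_coord (z : Plane) (k : Fin 2) : DifferentiableAt ℝ (fun w : Plane ↦ w k) z :=
  (contDiffAt_coord (n := 1) contDiffAt_id k).differentiableAt (by norm_num)

lemma pd_coord_sub (i k : Fin 2) (c : ℝ) (z : Plane) :
    pd i (fun w : Plane ↦ w k - c) z = if k = i then 1 else 0 := by
  have h := fderiv_coord (differentiableAt_id (𝕜 := ℝ) (x := z)) i k
  rw [fderiv_id] at h
  simp only [id_eq, ContinuousLinearMap.id_apply, basisVec, PiLp.single_apply] at h
  rw [h, pd, fderiv_sub_const, pd]

/-- The quadratic polynomial with coefficients `a, b, d` centred at `c`. -/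
def quadPoly (a b d : ℝ) (c w : Plane) : ℝ :=
  a * ((w 0 - c 0) * (w 0 - c 0)) + b * ((w 0 - c 0) * (w 1 - c 1) + (w 1 - c 1) * (w 0 - c 0)) +
    d * ((w 1 - c 1) * (w 1 - c 1))

lemma contDiff_quadPoly (a b d : ℝ) (c : Plane) : ContDiff ℝ ∞ (quadPoly a b d c) := by
  have h : ∀ k : Fin 2, ContDiff ℝ ∞ (fun w : Plane ↦ w k - c k) := fun k ↦
    (contDiff_iff_contDiffAt.2 fun z ↦ contDiffAt_coord contDiffAt_id k).sub contDiff_const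
  unfold quadPoly
  exact ((contDiff_const.mul ((h 0).mul (h 0))).add (contDiff_const.mul
    (((h 0).mul (h 1)).add ((h 1).mul (h 0))))).add (contDiff_const.mul ((h 1).mul (h 1)))

lemma pd_quadPoly (a b d : ℝ) (c : Plane) (i : Fin 2) (z : Plane) :
    pd i (quadPoly a b d c) z =
      (2 * a * (if i = 0 then 1 else 0) + 2 * b * (if i = 1 then 1 else 0)) * (z 0 - c 0) +
      (2 * b * (if i = 0 then 1 else 0) + 2 * d * (if i = 1 then 1 else 0)) * (z 1 - c 1) := by
  have h : ∀ k, DifferentiableAt ℝ (fun w : Plane ↦ w k - c k) z := fun k ↦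
    (differentiableAt_coord z k).sub_const _
  have hm : ∀ k l, DifferentiableAt ℝ (fun w : Plane ↦ (w k - c k) * (w l - c l)) z := fun k l ↦
    (h k).mul (h l)
  have hs : DifferentiableAt ℝ (fun w : Plane ↦
    (w 0 - c 0) * (w 1 - c 1) + (w 1 - c 1) * (w 0 - c 0)) z := (hm 0 1).add (hm 1 0)
  have h1 : DifferentiableAt ℝ (fun w : Plane ↦ a * ((w 0 - c 0) * (w 0 - c 0))) z :=
    (hm 0 0).const_mul a
  have h2 : DifferentiableAt ℝ (fun w : Plane ↦
    b * ((w 0 - c 0) * (w 1 - c 1) + (w 1 - c 1) * (w 0 - c 0))) z := hs.const_mul b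
  have h3 : DifferentiableAt ℝ (fun w : Plane ↦ d * ((w 1 - c 1) * (w 1 - c 1))) z :=
    (hm 1 1).const_mul d
  have h12 : DifferentiableAt ℝ (fun w : Plane ↦ a * ((w 0 - c 0) * (w 0 - c 0)) +
    b * ((w 0 - c 0) * (w 1 - c 1) + (w 1 - c 1) * (w 0 - c 0))) z := h1.add h2
  unfold quadPoly
  rw [pd_add h12 h3, pd_add h1 h2, pd_const_mul (hm _ _), pd_const_mul hs, pd_const_mul (hm _ _),
    pd_add (hm _ _) (hm _ _), pd_mul (h _) (h _), pd_mul (h _) (h _), pd_mul (h _) (h _),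
    pd_mul (h _) (h _), pd_coord_sub, pd_coord_sub]
  fin_cases i <;> simp <;> ring

lemma pd_affine (α β : ℝ) (c : Plane) (i : Fin 2) (z : Plane) :
    pd i (fun w : Plane ↦ α * (w 0 - c 0) + β * (w 1 - c 1)) z = if i = 0 then α else β := by
  have h : ∀ k, DifferentiableAt ℝ (fun w : Plane ↦ w k - c k) z := fun k ↦
    (differentiableAt_coord z k).sub_const _
  rw [pd_add ((h 0).const_mul α) ((h 1).const_mul β), pd_const_mul (h 0), pd_const_mul (h 1),
    pd_coord_sub, pd_coord_sub]
  fin_cases i <;> simp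

lemma pd_pd_quadPoly (a b d : ℝ) (c : Plane) (i j : Fin 2) (z : Plane) :
    pd i (pd j (quadPoly a b d c)) z = if i = 0 then
      2 * a * (if j = 0 then 1 else 0) + 2 * b * (if j = 1 then 1 else 0) else
      2 * b * (if j = 0 then 1 else 0) + 2 * d * (if j = 1 then 1 else 0) := by
  rw [show pd j (quadPoly a b d c) = _ from funext fun z ↦ pd_quadPoly a b d c j z, pd_affine]

section QuadDist

set_option linter.unusedSectionVars false

variable {N : Type*} [EMetricSpace N] [ChartedSpace (EuclideanSpace ℝ (Fin 2)) N]
  [IsManifold (𝓡 2) ∞ N] [RiemannianBundle (fun x : N ↦ TangentSpace (𝓡 2) x)]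

/-- The square of the length of the coordinate difference of `x` and `q` in the chart at `x₀`,
measured with the metric at `q`. It behaves like the squared distance to `q`. -/
def quadDist (x₀ q x : N) : ℝ :=
  gramForm x₀ (extChartAt (𝓡 2) x₀ q) (extChartAt (𝓡 2) x₀ x - extChartAt (𝓡 2) x₀ q)
    (extChartAt (𝓡 2) x₀ x - extChartAt (𝓡 2) x₀ q)

lemma quadDist_eq (x₀ q x : N) : quadDist x₀ q x =
    quadPoly (gram x₀ (extChartAt (𝓡 2) x₀ q) 0 0) (gram x₀ (extChartAt (𝓡 2) x₀ q) 0 1)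
      (gram x₀ (extChartAt (𝓡 2) x₀ q) 1 1) (extChartAt (𝓡 2) x₀ q) (extChartAt (𝓡 2) x₀ x) := rfl

lemma contMDiffAt_quadDist {x₀ x : N} (q : N) (hx : x ∈ (extChartAt (𝓡 2) x₀).source) :
    ContMDiffAt (𝓡 2) 𝓘(ℝ, ℝ) 2 (quadDist x₀ q) x :=
  ContMDiffAt.comp (I' := 𝓘(ℝ, Plane)) x
    (contMDiffAt_iff_contDiffAt.2 ((contDiff_quadPoly (gram x₀ (extChartAt (𝓡 2) x₀ q) 0 0)
      (gram x₀ (extChartAt (𝓡 2) x₀ q) 0 1) (gram x₀ (extChartAt (𝓡 2) x₀ q) 1 1)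
      (extChartAt (𝓡 2) x₀ q)).contDiffAt.of_le ENat.LEInfty.out))
    (contMDiffAt_extChartAt' (mem_chart_source_of_mem hx))

lemma IsNormalizedChart.quadDist_bounds {x₀ : N} {B : Plane ≃L[ℝ] ℂ} {δ ρ : ℝ}
    (h : IsNormalizedChart x₀ B δ ρ) {q x : N} (hq : q ∈ geodesicBall x₀ δ)
    (hx : x ∈ geodesicBall x₀ δ) :
    rdist x q ^ 2 ≤ 2 * quadDist x₀ q x ∧ quadDist x₀ q x ≤ 2 * rdist x q ^ 2 := by
  set φ := extChartAt (𝓡 2) x₀ with hφ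
  have hqs := h.mem_source q hq
  have hqt := φ.map_source hqs
  have hsymm : φ.symm (φ q) = q := φ.left_inv hqs
  set X := push x₀ (φ q) (φ x - φ q) with hX
  have hs : quadDist x₀ q x = ‖X‖ ^ 2 := by
    rw [← real_inner_self_eq_norm_sq, hX, inner_push]
    rfl
  have hq' : φ.symm (φ q) ∈ geodesicBall x₀ δ := by rwa [hsymm]
  have h1 := h.norm_pull_le _ hq' X
  have h2 := h.norm_le _ hq' X
  rw [hX, pull_push hqt, ← hX] at h1 h2
  have h3 := h.rdist_le x hx q hq
  have h4 := h.le_rdist x hx q hq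
  have h0 := rdist_nonneg x q
  have h5 := norm_nonneg X
  rw [hs]
  rw [← hφ] at h3 h4
  constructor <;> nlinarith

lemma quadDist_derivs {x₀ x : N} (q : N) [IsContMDiffRiemannianBundle (𝓡 2) ∞
    (EuclideanSpace ℝ (Fin 2)) (fun x : N ↦ TangentSpace (𝓡 2) x)]
    (hx : x ∈ (extChartAt (𝓡 2) x₀).source) :
    laplaceBeltrami (quadDist x₀ q) x = chartLaplacian x₀
      (quadPoly (gram x₀ (extChartAt (𝓡 2) x₀ q) 0 0) (gram x₀ (extChartAt (𝓡 2) x₀ q) 0 1)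
      (gram x₀ (extChartAt (𝓡 2) x₀ q) 1 1) (extChartAt (𝓡 2) x₀ q)) (extChartAt (𝓡 2) x₀ x) ∧
    ∀ i, pd i (inChart x₀ (quadDist x₀ q)) (extChartAt (𝓡 2) x₀ x) = pd i
      (quadPoly (gram x₀ (extChartAt (𝓡 2) x₀ q) 0 0) (gram x₀ (extChartAt (𝓡 2) x₀ q) 0 1)
      (gram x₀ (extChartAt (𝓡 2) x₀ q) 1 1) (extChartAt (𝓡 2) x₀ q)) (extChartAt (𝓡 2) x₀ x) := by
  set Q := quadPoly (gram x₀ (extChartAt (𝓡 2) x₀ q) 0 0) (gram x₀ (extChartAt (𝓡 2) x₀ q) 0 1)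
      (gram x₀ (extChartAt (𝓡 2) x₀ q) 1 1) (extChartAt (𝓡 2) x₀ q) with hQ
  have hz := (extChartAt (𝓡 2) x₀).map_source hx
  have hev : ∀ᶠ w in nhds (extChartAt (𝓡 2) x₀ x), inChart x₀ (quadDist x₀ q) =ᶠ[nhds w] Q := by
    refine eventually_eventually_nhds.2 ?_
    filter_upwards [(isOpen_extChartAt_target x₀).mem_nhds hz] with w hw
    rw [inChart, quadDist_eq, (extChartAt (𝓡 2) x₀).right_inv hw]
  have e1 : ∀ i, pd i (inChart x₀ (quadDist x₀ q)) =ᶠ[nhds (extChartAt (𝓡 2) x₀ x)] pd i Q := by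
    intro i
    filter_upwards [hev] with w hw using Filter.EventuallyEq.pd_eq hw i
  refine ⟨?_, fun i ↦ (e1 i).eq_of_nhds⟩
  rw [laplaceBeltrami_eq_chartLaplacian hx (contMDiffAt_quadDist q hx), chartLaplacian,
    chartLaplacian]
  simp only [Filter.EventuallyEq.pd_eq (e1 _), (e1 _).eq_of_nhds]

/-- The trace of the identity matrix, as `∑ g^{ij} g_{ij}`: this is the `4 = 2 * 2` in the Laplacian
of the quadratic form with coefficients `g_{ij}`. -/
lemma cometric_trace {x₀ : N} {z : Plane} (hz : z ∈ (extChartAt (𝓡 2) x₀).target) :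
    cometric x₀ 0 0 z * gram x₀ z 0 0 + 2 * cometric x₀ 0 1 z * gram x₀ z 0 1 +
      cometric x₀ 1 1 z * gram x₀ z 1 1 = 2 := by
  have hd := gram_det_pos hz
  rw [cometric_zero_zero, cometric_zero_one, cometric_one_one]
  field_simp
  rw [gram_det]
  ring

/-- The inverse metric of the covector `g X` is the metric of `X`, here for `X = (a, b)`. -/
lemma cometric_dual {x₀ : N} {z : Plane} (hz : z ∈ (extChartAt (𝓡 2) x₀).target) (a b : ℝ) :
    cometric x₀ 0 0 z * (gram x₀ z 0 0 * a + gram x₀ z 0 1 * b) ^ 2 +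
      2 * cometric x₀ 0 1 z * ((gram x₀ z 0 0 * a + gram x₀ z 0 1 * b) *
        (gram x₀ z 0 1 * a + gram x₀ z 1 1 * b)) +
      cometric x₀ 1 1 z * (gram x₀ z 0 1 * a + gram x₀ z 1 1 * b) ^ 2 =
    gram x₀ z 0 0 * (a * a) + gram x₀ z 0 1 * (a * b + b * a) + gram x₀ z 1 1 * (b * b) := by
  have hd := gram_det_pos hz
  rw [cometric_zero_zero, cometric_zero_one, cometric_one_one]
  field_simp
  rw [gram_det]
  ring

/-- Near the centre of a chart the metric and the first order coefficients are bounded, and the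
inverse metric is Lipschitz. -/
lemma exists_coefficient_bounds [IsContMDiffRiemannianBundle (𝓡 2) ∞
    (EuclideanSpace ℝ (Fin 2)) (fun x : N ↦ TangentSpace (𝓡 2) x)] (x₀ : N) :
    ∃ M : ℝ, 0 < M ∧ ∃ W ∈ nhds (extChartAt (𝓡 2) x₀ x₀), (∀ z ∈ W, ∀ i j, |gram x₀ z i j| ≤ M) ∧
      (∀ z ∈ W, ∀ i, |drift x₀ i z| ≤ M) ∧
      ∀ z ∈ W, ∀ w ∈ W, ∀ i j, |cometric x₀ i j z - cometric x₀ i j w| ≤ M * ‖z - w‖ := by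
  have hz := mem_extChartAt_target (I := 𝓡 2) x₀
  set z₀ := extChartAt (𝓡 2) x₀ x₀
  have hbd : ∀ f : Plane → ℝ, ContinuousAt f z₀ → ∀ᶠ z in nhds z₀, |f z| ≤ |f z₀| + 1 := by
    intro f hf
    filter_upwards [hf.abs.eventually (gt_mem_nhds (lt_add_one |f z₀|))] with z hz using hz.le
  have hlip : ∀ i j, ∃ K : ℝ, 0 ≤ K ∧ ∃ W ∈ nhds z₀, ∀ z ∈ W, ∀ w ∈ W,
      |cometric x₀ i j z - cometric x₀ i j w| ≤ K * ‖z - w‖ := by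
    intro i j
    obtain ⟨K, W, hW, hK⟩ := ((contDiffAt_cometric hz i j).of_le
      (m := 1) ENat.LEInfty.out).exists_lipschitzOnWith
    refine ⟨K, K.2, W, hW, fun z hz w hw ↦ ?_⟩
    have := hK.dist_le_mul z hz w hw
    rwa [Real.dist_eq, dist_eq_norm] at this
  choose K hK0 W hW hK using hlip
  set M : ℝ := (∑ i, ∑ j, (|gram x₀ z₀ i j| + 1)) + (∑ i, (|drift x₀ i z₀| + 1)) + ∑ i, ∑ j, K i j
    with hM
  have hMg : ∀ i j, |gram x₀ z₀ i j| + 1 ≤ M := by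
    intro i j
    have h1 : |gram x₀ z₀ i j| + 1 ≤ ∑ i, ∑ j, (|gram x₀ z₀ i j| + 1) :=
      (Finset.single_le_sum (f := fun j ↦ |gram x₀ z₀ i j| + 1) (fun _ _ ↦ by positivity)
        (Finset.mem_univ j)).trans (Finset.single_le_sum
        (f := fun i ↦ ∑ j, (|gram x₀ z₀ i j| + 1)) (fun _ _ ↦ by positivity) (Finset.mem_univ i))
    have h2 : 0 ≤ ∑ i, (|drift x₀ i z₀| + 1) := by positivity
    have h3 : 0 ≤ ∑ i, ∑ j, K i j :=
      Finset.sum_nonneg fun i _ ↦ Finset.sum_nonneg fun j _ ↦ hK0 i j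
    linarith
  have hMd : ∀ i, |drift x₀ i z₀| + 1 ≤ M := by
    intro i
    have h1 : |drift x₀ i z₀| + 1 ≤ ∑ i, (|drift x₀ i z₀| + 1) :=
      Finset.single_le_sum (f := fun i ↦ |drift x₀ i z₀| + 1) (fun _ _ ↦ by positivity)
        (Finset.mem_univ i)
    have h2 : 0 ≤ ∑ i, ∑ j, (|gram x₀ z₀ i j| + 1) := by positivity
    have h3 : 0 ≤ ∑ i, ∑ j, K i j :=
      Finset.sum_nonneg fun i _ ↦ Finset.sum_nonneg fun j _ ↦ hK0 i j
    linarith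
  have hMK : ∀ i j, K i j ≤ M := by
    intro i j
    have h1 : K i j ≤ ∑ i, ∑ j, K i j :=
      (Finset.single_le_sum (f := fun j ↦ K i j) (fun _ _ ↦ hK0 _ _)
        (Finset.mem_univ j)).trans (Finset.single_le_sum
        (f := fun i ↦ ∑ j, K i j) (fun _ _ ↦ Finset.sum_nonneg fun j _ ↦ hK0 _ j)
        (Finset.mem_univ i))
    have h2 : 0 ≤ ∑ i, (|drift x₀ i z₀| + 1) := by positivity
    have h3 : 0 ≤ ∑ i, ∑ j, (|gram x₀ z₀ i j| + 1) := by positivity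
    linarith
  have hg : ∀ᶠ z in nhds z₀, ∀ i j, |gram x₀ z i j| ≤ M := by
    rw [Filter.eventually_all]; intro i
    rw [Filter.eventually_all]; intro j
    filter_upwards [hbd _ (contDiffAt_gram hz i j).continuousAt] with z h using h.trans (hMg i j)
  have hd : ∀ᶠ z in nhds z₀, ∀ i, |drift x₀ i z| ≤ M := by
    rw [Filter.eventually_all]; intro i
    filter_upwards [hbd _ (continuousAt_drift hz i)] with z h using h.trans (hMd i)
  have hWW : ∀ᶠ z in nhds z₀, ∀ i j, z ∈ W i j := by
    rw [Filter.eventually_all]; intro i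
    rw [Filter.eventually_all]; intro j
    exact hW i j
  refine ⟨M, lt_of_lt_of_le (by positivity) (hMd 0), _, hg.and (hd.and hWW), fun z hz ↦ hz.1,
    fun z hz ↦ hz.2.1, fun z hz w hw i j ↦ ?_⟩
  exact (hK i j z (hz.2.2 i j) w (hw.2.2 i j)).trans (by gcongr; exact hMK i j)

/-- As for the squared distance in the flat plane, the Laplacian of `quadDist x₀ q` is close to `4`
and its squared gradient close to four times the function. With the metric frozen at `q` both would
be exact; the errors come from the Lipschitz bound on the metric and, for the Laplacian, from the
first order terms. -/
lemma IsNormalizedChart.exists_quadDist_estimates [IsContMDiffRiemannianBundle (𝓡 2) ∞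
    (EuclideanSpace ℝ (Fin 2)) (fun x : N ↦ TangentSpace (𝓡 2) x)] {x₀ : N} {B : Plane ≃L[ℝ] ℂ}
    {δ ρ : ℝ} (h : IsNormalizedChart x₀ B δ ρ) :
    ∃ Λ : ℝ, 0 < Λ ∧ ∃ η : ℝ, 0 < η ∧ η ≤ ρ ∧
      ∀ q ∈ geodesicBall x₀ η, ∀ x ∈ geodesicBall x₀ η,
        |laplaceBeltrami (quadDist x₀ q) x - 4| ≤ Λ * rdist x q ∧
        |‖grad (quadDist x₀ q) x‖ ^ 2 - 4 * quadDist x₀ q x| ≤ Λ * rdist x q ^ 3 := by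
  obtain ⟨M, hM, W, hW, hMg, hMd, hMc⟩ := exists_coefficient_bounds x₀
  obtain ⟨η, hη, hηW⟩ := exists_geodesicBall_subset
    ((continuousAt_extChartAt (I := 𝓡 2) x₀).preimage_mem_nhds hW)
  set b : ℝ := ‖(B.symm : ℂ →L[ℝ] Plane)‖ * (11 / 10) with hb
  have hb0 : 0 ≤ b := by positivity
  refine ⟨16 * M ^ 2 * b + 64 * M ^ 3 * b ^ 3 + 1, by positivity, min η ρ, lt_min hη h.ρ_pos,
    min_le_right _ _, fun q hq x hx ↦ ?_⟩
  have hqδ := h.mem_ball_of_mem (lt_of_lt_of_le hq (ENNReal.ofReal_le_ofReal (min_le_right _ _)))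
  have hxδ := h.mem_ball_of_mem (lt_of_lt_of_le hx (ENNReal.ofReal_le_ofReal (min_le_right _ _)))
  have hqW := hηW (lt_of_lt_of_le hq (ENNReal.ofReal_le_ofReal (min_le_left _ _)))
  have hxW := hηW (lt_of_lt_of_le hx (ENNReal.ofReal_le_ofReal (min_le_left _ _)))
  set φ := extChartAt (𝓡 2) x₀ with hφ
  change φ q ∈ W at hqW
  change φ x ∈ W at hxW
  have hxs := h.mem_source x hxδ
  have hqt := φ.map_source (h.mem_source q hqδ)
  have hxt := φ.map_source hxs
  set d := rdist x q with hd
  have hd0 : 0 ≤ d := rdist_nonneg _ _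
  have hv : ‖φ x - φ q‖ ≤ b * d := by
    have h1 := (B.symm : ℂ →L[ℝ] Plane).le_opNorm (B (φ x - φ q))
    simp only [ContinuousLinearEquiv.coe_coe, ContinuousLinearEquiv.symm_apply_apply] at h1
    calc _ ≤ _ := h1
      _ ≤ ‖(B.symm : ℂ →L[ℝ] Plane)‖ * (11 / 10 * d) := by gcongr; exact h.le_rdist x hxδ q hqδ
      _ = b * d := by rw [hb]; ring
  have hvk : ∀ k, |φ x k - φ q k| ≤ b * d := fun k ↦
    (PiLp.norm_apply_le (φ x - φ q) k).trans hv
  have hab : ∀ i j, |cometric x₀ i j (φ x) - cometric x₀ i j (φ q)| ≤ M * (b * d) := fun i j ↦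
    (hMc _ hxW _ hqW i j).trans (by gcongr)
  have hsymm : φ.symm (φ x) = x := φ.left_inv hxs
  obtain ⟨e1, e2⟩ := quadDist_derivs q hxs
  have e3 := norm_grad_sq hxt (f := quadDist x₀ q) (by
    rw [← hφ, hsymm]; exact (contMDiffAt_quadDist q hxs).mdifferentiableAt (by norm_num))
  have e4 : ‖grad (quadDist x₀ q) (φ.symm (φ x))‖ ^ 2 = ‖grad (quadDist x₀ q) x‖ ^ 2 :=
    congrArg (fun y : N ↦ ‖grad (quadDist x₀ q) y‖ ^ 2) hsymm
  rw [← e4, e3, e2, e2, e1, chartLaplacian, quadDist_eq]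
  simp only [pd_quadPoly, pd_pd_quadPoly, ← hφ, if_true, one_ne_zero, zero_ne_one, if_false]
  have t1 := cometric_trace hqt
  have t2 := cometric_dual hqt (φ x 0 - φ q 0) (φ x 1 - φ q 1)
  have g00 := hMg _ hqW 0 0
  have g01 := hMg _ hqW 0 1
  have g11 := hMg _ hqW 1 1
  have d0 := hMd _ hxW 0
  have d1 := hMd _ hxW 1
  have a00 := hab 0 0
  have a01 := hab 0 1
  have a11 := hab 1 1
  have v0 := hvk 0
  have v1 := hvk 1
  unfold quadPoly
  generalize φ x 0 - φ q 0 = u at *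
  generalize φ x 1 - φ q 1 = v at *
  generalize gram x₀ (φ q) 0 0 = A at *
  generalize gram x₀ (φ q) 0 1 = D at *
  generalize gram x₀ (φ q) 1 1 = E at *
  generalize drift x₀ 0 (φ x) = m at *
  generalize drift x₀ 1 (φ x) = n at *
  obtain ⟨α, hα⟩ : ∃ α, α = cometric x₀ 0 0 (φ x) - cometric x₀ 0 0 (φ q) := ⟨_, rfl⟩
  obtain ⟨β, hβ⟩ : ∃ α, α = cometric x₀ 0 1 (φ x) - cometric x₀ 0 1 (φ q) := ⟨_, rfl⟩
  obtain ⟨γ, hγ⟩ : ∃ α, α = cometric x₀ 1 1 (φ x) - cometric x₀ 1 1 (φ q) := ⟨_, rfl⟩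
  rw [← hα] at a00
  rw [← hβ] at a01
  rw [← hγ] at a11
  rw [eq_add_of_sub_eq' hα.symm, eq_add_of_sub_eq' hβ.symm, eq_add_of_sub_eq' hγ.symm]
  generalize cometric x₀ 0 0 (φ q) = α' at *
  generalize cometric x₀ 0 1 (φ q) = β' at *
  generalize cometric x₀ 1 1 (φ q) = γ' at *
  set V := b * d with hV
  have hV0 : 0 ≤ V := by positivity
  have w0 : |A * u + D * v| ≤ 2 * (M * V) := by
    calc |A * u + D * v| ≤ |A| * |u| + |D| * |v| := by
          rw [← abs_mul, ← abs_mul]; exact abs_add_le _ _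
      _ ≤ M * V + M * V := by gcongr
      _ = _ := by ring
  have w1 : |D * u + E * v| ≤ 2 * (M * V) := by
    calc |D * u + E * v| ≤ |D| * |u| + |E| * |v| := by
          rw [← abs_mul, ← abs_mul]; exact abs_add_le _ _
      _ ≤ M * V + M * V := by gcongr
      _ = _ := by ring
  constructor
  · have id1 : (α' + α) * (2 * A * 1 + 2 * D * 0) + 2 * (β' + β) * (2 * A * 0 + 2 * D * 1) +
        (γ' + γ) * (2 * D * 0 + 2 * E * 1) +
        m * ((2 * A * 1 + 2 * D * 0) * u + (2 * D * 1 + 2 * E * 0) * v) +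
        n * ((2 * A * 0 + 2 * D * 1) * u + (2 * D * 0 + 2 * E * 1) * v) - 4 =
        2 * (α * A) + 4 * (β * D) + 2 * (γ * E) + 2 * (m * (A * u + D * v)) +
          2 * (n * (D * u + E * v)) := by
      linear_combination 2 * t1
    have b1 : |α * A| ≤ M * V * M := by rw [abs_mul]; gcongr
    have b2 : |β * D| ≤ M * V * M := by rw [abs_mul]; gcongr
    have b3 : |γ * E| ≤ M * V * M := by rw [abs_mul]; gcongr
    have b4 : |m * (A * u + D * v)| ≤ M * (2 * (M * V)) := by rw [abs_mul]; gcongr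
    have b5 : |n * (D * u + E * v)| ≤ M * (2 * (M * V)) := by rw [abs_mul]; gcongr
    have bound : |2 * (α * A) + 4 * (β * D) + 2 * (γ * E) + 2 * (m * (A * u + D * v)) +
          2 * (n * (D * u + E * v))| ≤ 16 * M ^ 2 * V := by
      rw [abs_le] at b1 b2 b3 b4 b5 ⊢
      constructor <;> linarith [b1.1, b1.2, b2.1, b2.2, b3.1, b3.2, b4.1, b4.2, b5.1, b5.2]
    have fin : 16 * M ^ 2 * V ≤ (16 * M ^ 2 * b + 64 * M ^ 3 * b ^ 3 + 1) * d := by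
      have : 0 ≤ (64 * M ^ 3 * b ^ 3 + 1) * d := by positivity
      rw [hV]; linarith
    refine le_trans (le_of_eq ?_) (bound.trans fin)
    rw [← id1]
  · have id2 : (α' + α) * ((2 * A * 1 + 2 * D * 0) * u + (2 * D * 1 + 2 * E * 0) * v) ^ 2 +
        2 * (β' + β) * (((2 * A * 1 + 2 * D * 0) * u + (2 * D * 1 + 2 * E * 0) * v) *
          ((2 * A * 0 + 2 * D * 1) * u + (2 * D * 0 + 2 * E * 1) * v)) +
        (γ' + γ) * ((2 * A * 0 + 2 * D * 1) * u + (2 * D * 0 + 2 * E * 1) * v) ^ 2 -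
        4 * (A * (u * u) + D * (u * v + v * u) + E * (v * v)) =
        4 * (α * ((A * u + D * v) * (A * u + D * v))) +
          8 * (β * ((A * u + D * v) * (D * u + E * v))) +
          4 * (γ * ((D * u + E * v) * (D * u + E * v))) := by
      linear_combination 4 * t2
    have b1 : |α * ((A * u + D * v) * (A * u + D * v))| ≤
        M * V * (2 * (M * V) * (2 * (M * V))) := by rw [abs_mul, abs_mul]; gcongr
    have b2 : |β * ((A * u + D * v) * (D * u + E * v))| ≤
        M * V * (2 * (M * V) * (2 * (M * V))) := by rw [abs_mul, abs_mul]; gcongr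
    have b3 : |γ * ((D * u + E * v) * (D * u + E * v))| ≤
        M * V * (2 * (M * V) * (2 * (M * V))) := by rw [abs_mul, abs_mul]; gcongr
    have bound : |4 * (α * ((A * u + D * v) * (A * u + D * v))) +
          8 * (β * ((A * u + D * v) * (D * u + E * v))) +
          4 * (γ * ((D * u + E * v) * (D * u + E * v)))| ≤ 64 * M ^ 3 * V ^ 3 := by
      rw [abs_le] at b1 b2 b3 ⊢
      constructor <;> linarith [b1.1, b1.2, b2.1, b2.2, b3.1, b3.2]
    have fin : 64 * M ^ 3 * V ^ 3 ≤ (16 * M ^ 2 * b + 64 * M ^ 3 * b ^ 3 + 1) * d ^ 3 := by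
      have : 0 ≤ (16 * M ^ 2 * b + 1) * d ^ 3 := by positivity
      rw [hV, mul_pow]; linarith
    refine le_trans (le_of_eq ?_) (bound.trans fin)
    rw [← id2]

end QuadDist

/-! ### Logarithmic barriers -/

/-- The radial profile `log ρ + 2 C ρ + k / ρ` as a function of `t = ρ ^ 2`. -/
def profile (C k t : ℝ) : ℝ := Real.log t / 2 + 2 * C * √t + k * (√t)⁻¹

/-- The derivative of `profile C k` at `t > 0`. -/
def profileDeriv (C k t : ℝ) : ℝ := t⁻¹ / 2 + C * (√t)⁻¹ - k / 2 * (√t)⁻¹ ^ 3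

lemma hasDerivAt_inv_sqrt {t : ℝ} (ht : 0 < t) :
    HasDerivAt (fun t ↦ (√t)⁻¹) (-(1 / 2) * (√t)⁻¹ ^ 3) t := by
  have hs := Real.sqrt_pos.2 ht
  refine ((Real.hasDerivAt_sqrt ht.ne').inv hs.ne').congr_deriv ?_
  field_simp

lemma hasDerivAt_profile (C k : ℝ) {t : ℝ} (ht : 0 < t) :
    HasDerivAt (profile C k) (profileDeriv C k t) t := by
  have h1 := (Real.hasDerivAt_log ht.ne').div_const 2
  have h2 := (Real.hasDerivAt_sqrt ht.ne').const_mul (2 * C)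
  have h3 := (hasDerivAt_inv_sqrt ht).const_mul k
  have hs := Real.sqrt_pos.2 ht
  refine ((h1.add h2).add h3).congr_deriv ?_
  rw [profileDeriv]
  field_simp
  ring

lemma hasDerivAt_profileDeriv (C k : ℝ) {t : ℝ} (ht : 0 < t) :
    HasDerivAt (profileDeriv C k)
      (-(t ^ 2)⁻¹ / 2 - C / 2 * (√t)⁻¹ ^ 3 + 3 * k / 4 * (√t)⁻¹ ^ 5) t := by
  have h1 := (hasDerivAt_inv ht.ne').div_const 2
  have h2 := (hasDerivAt_inv_sqrt ht).const_mul C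
  have h3 := ((hasDerivAt_inv_sqrt ht).pow 3).const_mul (k / 2)
  refine ((h1.add h2).sub h3).congr_deriv ?_
  push_cast
  ring

lemma contDiffAt_profile (C k : ℝ) {t : ℝ} (ht : 0 < t) : ContDiffAt ℝ 2 (profile C k) t := by
  have h1 : ContDiffAt ℝ 2 (fun t ↦ Real.log t / 2) t :=
    (Real.contDiffAt_log.2 ht.ne').div_const 2
  have h2 : ContDiffAt ℝ 2 (fun t ↦ √t) t := Real.contDiffAt_sqrt ht.ne'
  exact (h1.add (contDiffAt_const.mul h2)).add
    (contDiffAt_const.mul (h2.inv (Real.sqrt_pos.2 ht).ne'))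

/-- In the plane, `log ρ` is harmonic, `Δ ρ = 1 / ρ` and `Δ (1 / ρ) = 1 / ρ ^ 3`. If `ρ ^ 2` has
nearly the Euclidean Laplacian and gradient, the term `2 C ρ` absorbs the error made by `log ρ`. -/
lemma profile_laplacian_lower_bound {C k ρ a b : ℝ} (hC : 0 ≤ C) (hk : 0 ≤ k) (hρ : 0 < ρ)
    (hCρ : C * ρ ≤ 2 / 5) (ha : |a - 4| ≤ C * ρ) (hb : |b - 4 * ρ ^ 2| ≤ C * ρ ^ 3) :
    k / (2 * ρ ^ 3) ≤ profileDeriv C k (ρ ^ 2) * a +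
      (-((ρ ^ 2) ^ 2)⁻¹ / 2 - C / 2 * (√(ρ ^ 2))⁻¹ ^ 3 + 3 * k / 4 * (√(ρ ^ 2))⁻¹ ^ 5) * b := by
  rw [profileDeriv, Real.sqrt_sq hρ.le]
  obtain ⟨e, he⟩ : ∃ e, e = a - 4 := ⟨_, rfl⟩
  obtain ⟨f, hf⟩ : ∃ f, f = b - 4 * ρ ^ 2 := ⟨_, rfl⟩
  rw [← he] at ha
  rw [← hf] at hb
  rw [eq_add_of_sub_eq' he.symm, eq_add_of_sub_eq' hf.symm]
  have key : 0 ≤ 2 * (2 * C * ρ ^ 4 + k * ρ ^ 2) - k * ρ ^ 2 +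
      (ρ ^ 3 + 2 * C * ρ ^ 4 - k * ρ ^ 2) * e +
      (-ρ - C * ρ ^ 2 + 3 / 2 * k) * f := by
    have h1 : -(ρ ^ 3 + 2 * C * ρ ^ 4 + k * ρ ^ 2) * (C * ρ) ≤
        (ρ ^ 3 + 2 * C * ρ ^ 4 - k * ρ ^ 2) * e := by
      have habs : |ρ ^ 3 + 2 * C * ρ ^ 4 - k * ρ ^ 2| ≤ ρ ^ 3 + 2 * C * ρ ^ 4 + k * ρ ^ 2 := by
        rw [abs_le]
        have : 0 ≤ k * ρ ^ 2 := by positivity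
        have : 0 ≤ ρ ^ 3 + 2 * C * ρ ^ 4 := by positivity
        constructor <;> linarith
      have := neg_abs_le ((ρ ^ 3 + 2 * C * ρ ^ 4 - k * ρ ^ 2) * e)
      rw [abs_mul] at this
      have h2 := mul_le_mul habs ha (abs_nonneg e) (by positivity)
      linarith
    have h2 : -(ρ + C * ρ ^ 2 + 3 / 2 * k) * (C * ρ ^ 3) ≤ (-ρ - C * ρ ^ 2 + 3 / 2 * k) * f := by
      have habs : |-ρ - C * ρ ^ 2 + 3 / 2 * k| ≤ ρ + C * ρ ^ 2 + 3 / 2 * k := by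
        rw [abs_le]
        have : 0 ≤ C * ρ ^ 2 := by positivity
        constructor <;> linarith
      have := neg_abs_le ((-ρ - C * ρ ^ 2 + 3 / 2 * k) * f)
      rw [abs_mul] at this
      have h3 := mul_le_mul habs hb (abs_nonneg f) (by positivity)
      linarith
    have h3 : 0 ≤ C * ρ ^ 4 * (2 / 5 - C * ρ) := mul_nonneg (by positivity) (by linarith)
    have h4 : 0 ≤ k * ρ ^ 2 * (2 / 5 - C * ρ) := mul_nonneg (by positivity) (by linarith)
    have h5 : 0 ≤ C * ρ ^ 4 := by positivity
    have h6 : 0 ≤ k * ρ ^ 2 := by positivity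
    nlinarith
  have heq : ((ρ ^ 2)⁻¹ / 2 + C * ρ⁻¹ - k / 2 * ρ⁻¹ ^ 3) * (4 + e) +
      (-((ρ ^ 2) ^ 2)⁻¹ / 2 - C / 2 * ρ⁻¹ ^ 3 + 3 * k / 4 * ρ⁻¹ ^ 5) * (4 * ρ ^ 2 + f) -
      k / (2 * ρ ^ 3) = (2 * (2 * C * ρ ^ 4 + k * ρ ^ 2) - k * ρ ^ 2 +
      (ρ ^ 3 + 2 * C * ρ ^ 4 - k * ρ ^ 2) * e +
      (-ρ - C * ρ ^ 2 + 3 / 2 * k) * f) / (2 * ρ ^ 5) := by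
    field_simp
    ring
  have : (0 : ℝ) ≤ _ := div_nonneg key (show (0 : ℝ) ≤ 2 * ρ ^ 5 by positivity)
  rw [← heq] at this
  linarith

section Profile

set_option linter.unusedSectionVars false

variable {N : Type*} [TopologicalSpace N] [ChartedSpace (EuclideanSpace ℝ (Fin 2)) N]
  [IsManifold (𝓡 2) ∞ N] [RiemannianBundle (fun x : N ↦ TangentSpace (𝓡 2) x)]
  [IsContMDiffRiemannianBundle (𝓡 2) ∞ (EuclideanSpace ℝ (Fin 2))
    (fun x : N ↦ TangentSpace (𝓡 2) x)]

lemma contMDiffAt_profile {x : N} {s : N → ℝ} (hs : ContMDiffAt (𝓡 2) 𝓘(ℝ, ℝ) 2 s x)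
    (hpos : 0 < s x) (C k : ℝ) : ContMDiffAt (𝓡 2) 𝓘(ℝ, ℝ) 2 (fun y ↦ profile C k (s y)) x :=
  ContMDiffAt.comp x (contMDiffAt_iff_contDiffAt.2 (contDiffAt_profile C k hpos)) hs

lemma le_laplaceBeltrami_profile {x : N} {s : N → ℝ} (hs : ContMDiffAt (𝓡 2) 𝓘(ℝ, ℝ) 2 s x)
    (hpos : 0 < s x) {C k : ℝ} (hC : 0 ≤ C) (hk : 0 ≤ k) (hCs : C * √(s x) ≤ 2 / 5)
    (hΔ : |laplaceBeltrami s x - 4| ≤ C * √(s x))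
    (hg : |‖grad s x‖ ^ 2 - 4 * s x| ≤ C * √(s x) ^ 3) :
    k / (2 * √(s x) ^ 3) ≤ laplaceBeltrami (fun y ↦ profile C k (s y)) x := by
  rw [laplaceBeltrami_comp hs (contDiffAt_profile C k hpos)
    (by filter_upwards [lt_mem_nhds hpos] with t ht using hasDerivAt_profile C k ht)
    (hasDerivAt_profileDeriv C k hpos)]
  have h := Real.sq_sqrt hpos.le
  have key := profile_laplacian_lower_bound (a := laplaceBeltrami s x) (b := ‖grad s x‖ ^ 2)
    hC hk (Real.sqrt_pos.2 hpos) hCs hΔ (by rwa [h])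
  rwa [h] at key

/-- A comparison principle: `v` cannot exceed `w` if, wherever it does, `v` is a subsolution and `w`
a supersolution of `Δ f = V f` with a positive potential `V`. Boundary conditions enter through the
requirement that `v` can exceed `w` at interior points only. -/
lemma le_of_laplaceBeltrami_comparison {K : Set N} (hK : IsCompact K) {v w : N → ℝ}
    (hv : ContinuousOn v K) (hw : ContinuousOn w K)
    (h : ∀ x ∈ K, w x < v x → K ∈ nhds x ∧ ContMDiffAt (𝓡 2) 𝓘(ℝ, ℝ) 2 v x ∧
      ContMDiffAt (𝓡 2) 𝓘(ℝ, ℝ) 2 w x ∧ ∃ V : ℝ, 0 < V ∧ laplaceBeltrami w x ≤ V * w x ∧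
        V * v x ≤ laplaceBeltrami v x) {x : N} (hx : x ∈ K) : v x ≤ w x := by
  by_contra! hlt
  obtain ⟨y, hy, hmin⟩ := hK.exists_isMinOn ⟨x, hx⟩ (hw.sub hv)
  have hyx : w y - v y ≤ w x - v x := hmin hx
  obtain ⟨hn, hv2, hw2, V, hV, hΔw, hΔv⟩ := h y hy (by linarith)
  have hloc : IsLocalMin (fun y ↦ w y + (-1) * v y) y := by
    filter_upwards [hn] with z hz
    have : w y - v y ≤ w z - v z := hmin hz
    linarith
  have hv3 : ContMDiffAt (𝓡 2) 𝓘(ℝ, ℝ) 2 (fun y ↦ (-1) * v y) y := contMDiffAt_const.mul hv2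
  have h0 := IsLocalMin.laplaceBeltrami_nonneg hloc (hw2.add hv3)
  rw [laplaceBeltrami_add hw2 hv3, laplaceBeltrami_const_mul hv2] at h0
  nlinarith

end Profile

/-! ### Size of the barrier -/

/-- The value of the barrier at a point whose squared distances to the centres are (comparable to)
`s i`. The centre `o` is the one carrying the quadratic term, and `E` is subtracted from each
logarithm in order to normalize it at the outer radius. -/
def barrier {ι : Type*} [Fintype ι] (C k c E M : ℝ) (o : ι) (s : ι → ℝ) : ℝ :=
  1 + c * ∑ i, (profile C k (s i) - E) + M * s o

lemma sqrt_le_two_mul {d s : ℝ} (hd : 0 ≤ d) (h : s ≤ 2 * d ^ 2) : √s ≤ 2 * d :=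
  Real.sqrt_le_iff.2 ⟨by positivity, by nlinarith⟩

lemma le_two_mul_sqrt {d s : ℝ} (h : d ^ 2 ≤ 2 * s) : d ≤ 2 * √s := by
  have : d / 2 ≤ √s := Real.le_sqrt_of_sq_le (by nlinarith [sq_nonneg d])
  linarith

lemma profile_le {C κ r d s : ℝ} (hC : 0 ≤ C) (hκ : 0 ≤ κ) (hr : 0 < r) (hd : r ^ 2 ≤ d)
    (hd1 : d ≤ 1) (h1 : d ^ 2 ≤ 2 * s) (h2 : s ≤ 2 * d ^ 2) :
    profile C (κ * r ^ 2) s ≤ Real.log d + (1 + 4 * C + 2 * κ) := by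
  have hd0 : 0 < d := lt_of_lt_of_le (by positivity) hd
  have hs : 0 < s := by nlinarith [pow_pos hd0 2]
  have hlog : Real.log s ≤ Real.log 2 + 2 * Real.log d := by
    have := Real.log_le_log hs h2
    rw [Real.log_mul two_ne_zero (by positivity), Real.log_pow] at this
    exact_mod_cast this
  have hl2 : Real.log 2 ≤ 1 := by linarith [Real.log_two_lt_d9]
  have hsq : √s ≤ 2 * d := sqrt_le_two_mul hd0.le h2
  have hsq2 : d / 2 ≤ √s := by linarith [le_two_mul_sqrt h1]
  have h3 : κ * r ^ 2 * (√s)⁻¹ ≤ 2 * κ := by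
    rw [← div_eq_mul_inv, div_le_iff₀ (by linarith)]
    nlinarith [mul_nonneg hκ (by linarith : 0 ≤ 2 * √s - r ^ 2)]
  have h4 : 2 * C * √s ≤ 4 * C := by nlinarith
  rw [profile]
  linarith

lemma le_profile {C k d s : ℝ} (hC : 0 ≤ C) (hk : 0 ≤ k) (hd : 0 < d) (h : d ^ 2 ≤ 2 * s) :
    Real.log d - 1 ≤ profile C k s := by
  have hlog : 2 * Real.log d - Real.log 2 ≤ Real.log s := by
    have := Real.log_le_log (pow_pos hd 2) h
    rw [Real.log_pow, Real.log_mul two_ne_zero (by nlinarith [pow_pos hd 2])] at this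
    push_cast at this
    linarith
  have hl2 : Real.log 2 ≤ 1 := by linarith [Real.log_two_lt_d9]
  have h1 : 0 ≤ 2 * C * √s := by positivity
  have h2 : 0 ≤ k * (√s)⁻¹ := by positivity
  rw [profile]
  linarith

section Barrier

variable {ι : Type*} [Fintype ι] {C κ r ε L c D M : ℝ} {o : ι} {d s : ι → ℝ}

/-- The barrier is at most linear in the distance to each of the centres, and not positive within
distance `2 r ^ 2` of a centre: the logarithmic pole at the centre outweighs the other terms. -/
lemma barrier_le_linear {C₂ : ℝ} (hC : 0 ≤ C) (hκ : 0 ≤ κ) (hM : 0 ≤ M) (hr : 0 < r) (hrε : r ≤ ε)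
    (hε : ε ≤ 1) (hL : L = Real.log (ε / r)) (hc0 : 0 ≤ c)
    (hc : c * ((Fintype.card ι + 1) * L) = 1)
    (hC₂ : C₂ = Fintype.card ι + 8 * M * (Fintype.card ι + 1))
    (hD : D = 1 + 4 * C + 2 * κ + 2 * C₂)
    (hd : ∀ i, r ^ 2 ≤ d i) (hd1 : ∀ i, d i ≤ 1) (h1 : ∀ i, d i ^ 2 ≤ 2 * s i)
    (h2 : ∀ i, s i ≤ 2 * d i ^ 2) (j : ι) (hj : ∀ i, d i ≤ d j + ε * r) :
    barrier C (κ * r ^ 2) c (Real.log (ε ^ 2) + D) M o s ≤ c * (C₂ * (d j / r ^ 2 - 2)) := by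
  classical
  have hε0 : 0 < ε := hr.trans_le hrε
  have hr2 : 0 < r ^ 2 := by positivity
  have hd0 : ∀ i, 0 < d i := fun i ↦ hr2.trans_le (hd i)
  have hle : Real.log ε - Real.log r = L := by rw [hL, Real.log_div hε0.ne' hr.ne']
  set m : ℝ := (Fintype.card ι : ℝ) with hm
  have hm1 : 1 ≤ m := by
    rw [hm]
    exact_mod_cast Fintype.card_pos_iff.2 ⟨j⟩
  have hC₂0 : 0 ≤ C₂ := by rw [hC₂]; positivity
  -- the centre `j` takes twice the share `L` of `1 / c = (m + 1) L`, the others once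
  have hterm : ∀ i, profile C (κ * r ^ 2) (s i) - (Real.log (ε ^ 2) + D) + L +
      (if i = j then L else 0) ≤ d j / r ^ 2 - 2 * C₂ := by
    intro i
    have hp := profile_le hC hκ hr (hd i) (hd1 i) (h1 i) (h2 i)
    have e1 : Real.log (ε ^ 2) = 2 * Real.log ε := by rw [Real.log_pow]; norm_num
    split_ifs with hij
    · subst hij
      have := Real.log_le_sub_one_of_pos (div_pos (hd0 i) hr2)
      rw [Real.log_div (hd0 i).ne' hr2.ne', Real.log_pow] at this
      push_cast at this
      linarith
    · have h3 : d i / (ε * r) ≤ d j / r ^ 2 + 1 := by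
        rw [div_le_iff₀ (by positivity)]
        have h4 : d j ≤ d j / r ^ 2 * (ε * r) := by
          rw [div_mul_eq_mul_div, le_div_iff₀ hr2]
          exact mul_le_mul_of_nonneg_left (by nlinarith) (hd0 j).le
        linarith [hj i]
      have := Real.log_le_sub_one_of_pos (div_pos (hd0 i) (mul_pos hε0 hr))
      rw [Real.log_div (hd0 i).ne' (mul_pos hε0 hr).ne', Real.log_mul hε0.ne' hr.ne'] at this
      linarith
  have hsum := Finset.sum_le_sum fun i (_ : i ∈ Finset.univ) ↦ hterm i
  simp only [Finset.sum_add_distrib, Finset.sum_const, Finset.card_univ, nsmul_eq_mul,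
    Finset.sum_ite_eq', Finset.mem_univ, if_true, ← hm] at hsum
  have hLr : L * r ^ 2 ≤ 1 := by
    have := Real.log_le_sub_one_of_pos (div_pos hε0 hr)
    have h5 : ε / r * r ^ 2 ≤ 1 := by
      rw [show ε / r * r ^ 2 = ε * r by field_simp]
      nlinarith
    rw [← hL] at this
    nlinarith
  -- the quadratic term is of order `d j`, and `1 ≤ (m + 1) * c / r ^ 2`
  have hquad : M * s o ≤ c * (8 * M * (m + 1) * (d j / r ^ 2)) := by
    have h6 : d o ^ 2 ≤ 4 * d j := by
      have h7 : d o ^ 2 ≤ (d j + ε * r) ^ 2 := pow_le_pow_left₀ (hd0 o).le (hj o) 2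
      have h8 : (ε * r) ^ 2 ≤ d j := by
        rw [mul_pow]
        nlinarith [hd j, pow_le_one₀ (n := 2) hε0.le hε]
      nlinarith [sq_nonneg (d j - ε * r), hd1 j, hd0 j]
    have h9 : d j ≤ c * ((m + 1) * (d j / r ^ 2)) := by
      have h10 : c * ((m + 1) * (d j / r ^ 2)) * (L * r ^ 2) = d j := by
        rw [show c * ((m + 1) * (d j / r ^ 2)) * (L * r ^ 2) =
          c * ((m + 1) * L) * (d j / r ^ 2 * r ^ 2) by ring, hc, div_mul_cancel₀ _ hr2.ne', one_mul]
      have h11 : 0 ≤ c * ((m + 1) * (d j / r ^ 2)) := by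
        have := hd0 j
        positivity
      nlinarith
    nlinarith [h2 o]
  have h12 : c * (∑ i, (profile C (κ * r ^ 2) (s i) - (Real.log (ε ^ 2) + D)) + m * L + L) ≤
      c * (m * (d j / r ^ 2 - 2 * C₂)) := mul_le_mul_of_nonneg_left (by linarith) hc0
  have h13 : c * (m * (d j / r ^ 2 - 2 * C₂)) ≤ c * (m * (d j / r ^ 2) - 2 * C₂) :=
    mul_le_mul_of_nonneg_left (by nlinarith) hc0
  rw [barrier]
  have h14 : C₂ * (d j / r ^ 2 - 2) =
      m * (d j / r ^ 2) - 2 * C₂ + 8 * M * (m + 1) * (d j / r ^ 2) := by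
    rw [sub_eq_add_neg, mul_add]
    nth_rewrite 1 [hC₂]
    ring
  rw [h14, mul_add]
  linarith

lemma barrier_le_two (hC : 0 ≤ C) (hκ : 0 ≤ κ) (hM : 0 ≤ M) (hr : 0 < r) (hε0 : 0 < ε)
    (hε : ε ≤ 1) (hc0 : 0 ≤ c) (hD : 1 + 4 * C + 2 * κ ≤ D) (hMε : 2 * M * ε ≤ 1)
    (hd : ∀ i, r ^ 2 ≤ d i) (hd1 : ∀ i, d i ≤ ε ^ 2) (h1 : ∀ i, d i ^ 2 ≤ 2 * s i)
    (h2 : ∀ i, s i ≤ 2 * d i ^ 2) :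
    barrier C (κ * r ^ 2) c (Real.log (ε ^ 2) + D) M o s ≤ 2 := by
  have hr2 : 0 < r ^ 2 := by positivity
  have hd0 : ∀ i, 0 < d i := fun i ↦ hr2.trans_le (hd i)
  have hε2 : ε ^ 2 ≤ 1 := pow_le_one₀ hε0.le hε
  have hsum : ∑ i, (profile C (κ * r ^ 2) (s i) - (Real.log (ε ^ 2) + D)) ≤ 0 := by
    refine Finset.sum_nonpos fun i _ ↦ ?_
    have hp := profile_le hC hκ hr (hd i) ((hd1 i).trans hε2) (h1 i) (h2 i)
    have := Real.log_le_log (hd0 i) (hd1 i)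
    linarith
  have hs : s o ≤ 2 * ε := by
    have h3 : d o ^ 2 ≤ (ε ^ 2) ^ 2 := pow_le_pow_left₀ (hd0 o).le (hd1 o) 2
    have h4 : (ε ^ 2) ^ 2 ≤ ε := by
      rw [← pow_mul]
      exact pow_le_of_le_one hε0.le hε (by norm_num)
    linarith [h2 o]
  have h5 : c * ∑ i, (profile C (κ * r ^ 2) (s i) - (Real.log (ε ^ 2) + D)) ≤ 0 :=
    mul_nonpos_of_nonneg_of_nonpos hc0 hsum
  have h6 : M * s o ≤ M * (2 * ε) := mul_le_mul_of_nonneg_left hs hM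
  rw [barrier]
  linarith

/-- At distance at least `ε r / 2` from all centres the logarithms cost at most the fraction
`m / (m + 1)` of the constant term `1`, up to lower order. -/
lemma le_barrier (hC : 0 ≤ C) (hκ : 0 ≤ κ) (hM : 0 ≤ M) (hr : 0 < r) (hε0 : 0 < ε)
    (hL : L = Real.log (ε / r)) (hc0 : 0 ≤ c) (hc : c * ((Fintype.card ι + 1) * L) = 1)
    (hLD : 2 * Fintype.card ι * (2 + D) ≤ L)
    (hd : ∀ i, ε * r / 2 ≤ d i) (h1 : ∀ i, d i ^ 2 ≤ 2 * s i) :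
    1 / (2 * (Fintype.card ι + 1)) ≤
      barrier C (κ * r ^ 2) c (Real.log (ε ^ 2) + D) M o s := by
  have hle : Real.log ε - Real.log r = L := by rw [hL, Real.log_div hε0.ne' hr.ne']
  have hεr : 0 < ε * r / 2 := by positivity
  set m : ℝ := (Fintype.card ι : ℝ) with hm
  have hm0 : 0 ≤ m := by positivity
  have hl2 : Real.log 2 ≤ 1 := by linarith [Real.log_two_lt_d9]
  have hterm : ∀ i, -(L + 2 + D) ≤ profile C (κ * r ^ 2) (s i) - (Real.log (ε ^ 2) + D) := by
    intro i
    have hp := le_profile hC (k := κ * r ^ 2) (by positivity) (hεr.trans_le (hd i)) (h1 i)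
    have h3 := Real.log_le_log hεr (hd i)
    rw [Real.log_div (by positivity) two_ne_zero, Real.log_mul hε0.ne' hr.ne'] at h3
    have e1 : Real.log (ε ^ 2) = 2 * Real.log ε := by rw [Real.log_pow]; norm_num
    linarith
  have hsum := Finset.sum_le_sum fun i (_ : i ∈ Finset.univ) ↦ hterm i
  simp only [Finset.sum_const, Finset.card_univ, nsmul_eq_mul, ← hm] at hsum
  have hs : 0 ≤ M * s o := mul_nonneg hM (by nlinarith [h1 o, sq_nonneg (d o)])
  have h4 := mul_le_mul_of_nonneg_left hsum hc0
  have h5 : c * (2 * m * (2 + D)) ≤ c * L := mul_le_mul_of_nonneg_left hLD hc0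
  have h6 : c * L = 1 / (m + 1) := by
    field_simp
    linarith
  have h7 : 1 / (2 * (m + 1)) = c * L / 2 := by
    rw [h6]
    field_simp
  rw [barrier, h7]
  nlinarith

end Barrier

/-- The differential inequality for the barrier: `u` is the value of the barrier, `w` that of the
solution, `e` the distance to the nearest `q j`, `d` the distance to `p` and `ρ` the comparison
distance to the nearest `q j`. -/
lemma potential_mul_le {C₀ C₂ M κ c r ε u w d e ρ : ℝ} (hC₀ : 0 < C₀) (hC₂ : 0 ≤ C₂) (hc : 0 ≤ c)
    (hM : M = C₀ + 8 * C₀ ^ 3) (hκ : κ = 288 * C₀ ^ 3 * C₂) (hr : 0 < r) (hε0 : 0 ≤ ε) (hε : ε ≤ 1)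
    (hu : 0 ≤ u) (hu2 : u ≤ 2) (he : 0 < e) (hue : u ≤ c * (C₂ * (e / r ^ 2))) (hd0 : 0 ≤ d)
    (hde : d ≤ e + ε * r) (hw0 : 0 ≤ w) (hw : w ≤ C₀ * (d ^ 2 + r ^ 2)) (hρ : 0 < ρ)
    (hρe : ρ ≤ 2 * e) :
    (C₀ + C₀ * w ^ 2 / e ^ 4) * u ≤ c * (κ * r ^ 2 / (2 * ρ ^ 3)) + 3 * M := by
  have h1 : d ^ 2 + r ^ 2 ≤ 2 * e ^ 2 + 3 * r ^ 2 := by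
    have h2 : d ^ 2 ≤ (e + ε * r) ^ 2 := pow_le_pow_left₀ hd0 hde 2
    have h3 : (ε * r) ^ 2 ≤ r ^ 2 :=
      pow_le_pow_left₀ (by positivity) (mul_le_of_le_one_left hr.le hε) 2
    nlinarith [sq_nonneg (e - ε * r)]
  have h4 : w ^ 2 ≤ C₀ ^ 2 * (8 * e ^ 4 + 18 * r ^ 4) := by
    have h5 : w ^ 2 ≤ (C₀ * (2 * e ^ 2 + 3 * r ^ 2)) ^ 2 :=
      pow_le_pow_left₀ hw0 (hw.trans (mul_le_mul_of_nonneg_left h1 hC₀.le)) 2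
    have h6 : (2 * e ^ 2 + 3 * r ^ 2) ^ 2 ≤ 8 * e ^ 4 + 18 * r ^ 4 := by
      nlinarith [sq_nonneg (2 * e ^ 2 - 3 * r ^ 2)]
    rw [mul_pow] at h5
    exact h5.trans (mul_le_mul_of_nonneg_left h6 (by positivity))
  have h7 : C₀ * w ^ 2 / e ^ 4 ≤ 8 * C₀ ^ 3 + 18 * C₀ ^ 3 * r ^ 4 / e ^ 4 := by
    rw [div_le_iff₀ (by positivity), add_mul, div_mul_cancel₀ _ (by positivity)]
    nlinarith [mul_le_mul_of_nonneg_left h4 hC₀.le]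
  have h8 : 18 * C₀ ^ 3 * r ^ 4 / e ^ 4 * u ≤ c * (κ * r ^ 2 / (2 * ρ ^ 3)) := by
    calc 18 * C₀ ^ 3 * r ^ 4 / e ^ 4 * u
        ≤ 18 * C₀ ^ 3 * r ^ 4 / e ^ 4 * (c * (C₂ * (e / r ^ 2))) :=
          mul_le_mul_of_nonneg_left hue (by positivity)
      _ = c * (κ * r ^ 2 / (2 * (2 * e) ^ 3)) := by
          rw [hκ]
          field_simp
          ring
      _ ≤ c * (κ * r ^ 2 / (2 * ρ ^ 3)) := by
          have : 0 ≤ κ * r ^ 2 := by rw [hκ]; positivity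
          gcongr
  have h9 : (C₀ + C₀ * w ^ 2 / e ^ 4) * u ≤
      (C₀ + (8 * C₀ ^ 3 + 18 * C₀ ^ 3 * r ^ 4 / e ^ 4)) * u := by gcongr
  have h10 : (C₀ + 8 * C₀ ^ 3) * u ≤ (C₀ + 8 * C₀ ^ 3) * 2 := by gcongr
  have h11 : 0 < C₀ ^ 3 := by positivity
  nlinarith

/-! ### The barrier on the surface -/

section LaplacianSum

set_option linter.unusedSectionVars false

variable {N : Type*} [TopologicalSpace N] [ChartedSpace (EuclideanSpace ℝ (Fin 2)) N]
  [IsManifold (𝓡 2) ∞ N] [RiemannianBundle (fun x : N ↦ TangentSpace (𝓡 2) x)]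
  [IsContMDiffRiemannianBundle (𝓡 2) ∞ (EuclideanSpace ℝ (Fin 2))
    (fun x : N ↦ TangentSpace (𝓡 2) x)]

lemma laplaceBeltrami_sum {ι : Type*} (t : Finset ι) {f : ι → N → ℝ} {x : N}
    (hf : ∀ i, ContMDiffAt (𝓡 2) 𝓘(ℝ, ℝ) 2 (f i) x) :
    laplaceBeltrami (fun y ↦ ∑ i ∈ t, f i y) x = ∑ i ∈ t, laplaceBeltrami (f i) x := by
  classical
  induction t using Finset.induction_on with
  | empty =>
    have h0 : ContMDiffAt (𝓡 2) 𝓘(ℝ, ℝ) 2 (fun _ : N ↦ (0 : ℝ)) x := contMDiffAt_const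
    simpa using laplaceBeltrami_const_mul h0 0
  | insert i t hi ih =>
    simp only [Finset.sum_insert hi]
    rw [laplaceBeltrami_add (hf i) (ContMDiffAt.sum fun j _ ↦ hf j), ih]

lemma contMDiffAt_barrier {ι : Type*} [Fintype ι] {C k c E M : ℝ} {o : ι} {s : ι → N → ℝ} {x : N}
    (hs : ∀ i, ContMDiffAt (𝓡 2) 𝓘(ℝ, ℝ) 2 (s i) x) (hpos : ∀ i, 0 < s i x) :
    ContMDiffAt (𝓡 2) 𝓘(ℝ, ℝ) 2 (fun y ↦ barrier C k c E M o fun i ↦ s i y) x :=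
  (contMDiffAt_const.add (contMDiffAt_const.mul (ContMDiffAt.sum fun i _ ↦
    (contMDiffAt_profile (hs i) (hpos i) C k).sub contMDiffAt_const))).add
    (contMDiffAt_const.mul (hs o))

lemma laplaceBeltrami_barrier {ι : Type*} [Fintype ι] {C k c E M : ℝ} {o : ι} {s : ι → N → ℝ}
    {x : N} (hs : ∀ i, ContMDiffAt (𝓡 2) 𝓘(ℝ, ℝ) 2 (s i) x) (hpos : ∀ i, 0 < s i x) :
    laplaceBeltrami (fun y ↦ barrier C k c E M o fun i ↦ s i y) x =
      c * ∑ i, laplaceBeltrami (fun y ↦ profile C k (s i y)) x + M * laplaceBeltrami (s o) x := by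
  have hp := fun i ↦ contMDiffAt_profile (hs i) (hpos i) C k
  have hsum : ContMDiffAt (𝓡 2) 𝓘(ℝ, ℝ) 2 (fun y ↦ ∑ i, profile C k (s i y)) x :=
    ContMDiffAt.sum fun i _ ↦ hp i
  have h1 : ContMDiffAt (𝓡 2) 𝓘(ℝ, ℝ) 2 (fun y ↦ c * ∑ i, profile C k (s i y)) x :=
    contMDiffAt_const.mul hsum
  have h2 : ContMDiffAt (𝓡 2) 𝓘(ℝ, ℝ) 2 (fun y ↦ M * s o y) x := contMDiffAt_const.mul (hs o)
  have heq : (fun y ↦ barrier C k c E M o fun i ↦ s i y) =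
      fun y ↦ (c * ∑ i, profile C k (s i y) + M * s o y) + (1 - c * (Fintype.card ι * E)) := by
    funext y
    simp only [barrier, Finset.sum_sub_distrib, Finset.sum_const, Finset.card_univ, nsmul_eq_mul]
    ring
  rw [heq, laplaceBeltrami_add_const (f := fun y ↦ c * ∑ i, profile C k (s i y) + M * s o y)
    (h1.add h2), laplaceBeltrami_add h1 h2, laplaceBeltrami_const_mul hsum,
    laplaceBeltrami_const_mul (hs o), laplaceBeltrami_sum _ hp]

end LaplacianSum

lemma exists_rdistSet_range_eq {N : Type*} [EMetricSpace N] {n : ℕ} (hn : 0 < n) (q : Fin n → N)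
    (x : N) : ∃ j, rdistSet x (range q) = rdist x (q j) := by
  obtain ⟨_, ⟨j, rfl⟩, hj⟩ := (finite_range q).isCompact.exists_infEDist_eq_edist
    ⟨q ⟨0, hn⟩, mem_range_self _⟩ x
  exact ⟨j, by rw [rdistSet, hj, rdist]⟩

section Barrier

set_option linter.unusedSectionVars false

variable {N : Type*} [EMetricSpace N] [ChartedSpace (EuclideanSpace ℝ (Fin 2)) N]
  [IsManifold (𝓡 2) ∞ N] [RiemannianBundle (fun x : N ↦ TangentSpace (𝓡 2) x)]
  [IsContMDiffRiemannianBundle (𝓡 2) ∞ (EuclideanSpace ℝ (Fin 2))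
    (fun x : N ↦ TangentSpace (𝓡 2) x)]

set_option maxHeartbeats 400000 in
/-- There are barriers `u` at all small scales: `u ≤ 2` up to radius `ε ^ 2 / 2`, `u` is positive
away from the centres but not positive near them, bounded below on the sphere of radius `ε r`, and
where it is positive it is a subsolution for the potential that the minimal condition allows. -/
lemma IsNormalizedChart.exists_barrier {x₀ : N} {B : Plane ≃L[ℝ] ℂ} {δ ρ : ℝ}
    (h : IsNormalizedChart x₀ B δ ρ) {J : ℕ} (hJ : 0 < J) {C₀ : ℝ} (hC₀ : 0 < C₀) :
    ∃ η : ℝ, 0 < η ∧ η ≤ ρ ∧ ∃ ε₀ : ℝ, 0 < ε₀ ∧ ε₀ ≤ 1 ∧ 4 * ε₀ ≤ η ∧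
      ∀ p ∈ geodesicBall x₀ (η / 2), ∀ (r ε : ℝ) (q : Fin J → N), 0 < r → 0 < ε → r ≤ ε ^ 4 →
        ε < ε₀ → (∀ j, q j ∈ closedGeodesicBall p (ε * r / 2)) →
        ∃ u : N → ℝ, ∀ x ∈ closedGeodesicBall p (ε ^ 2 / 2), r ^ 2 ≤ rdist x p →
          (∀ j, r ^ 2 ≤ rdist x (q j)) →
          ContMDiffAt (𝓡 2) 𝓘(ℝ, ℝ) 2 u x ∧ u x ≤ 2 ∧ (rdist x p ≤ 2 * r ^ 2 → u x ≤ 0) ∧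
          (∀ j, rdist x (q j) ≤ 2 * r ^ 2 → u x ≤ 0) ∧
          (rdist x p = ε * r → 1 / (2 * (J + 2)) ≤ u x) ∧
          (0 < u x → ∀ w : ℝ, 0 ≤ w → w ≤ C₀ * (rdist x p ^ 2 + r ^ 2) →
            (C₀ + C₀ * w ^ 2 / rdistSet x (range q) ^ 4) * u x ≤ laplaceBeltrami u x) := by
  obtain ⟨Λ, hΛ, η, hη, hηρ, hest⟩ := h.exists_quadDist_estimates
  -- `m` is the number of centres. The constants are those of `profile_le`, `barrier_le_linear` and
  -- `potential_mul_le`; the factor `8` in `C` is due to the comparison `d ≤ 2 √s`.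
  obtain ⟨m, hm⟩ : ∃ m : ℝ, m = J + 1 := ⟨_, rfl⟩
  obtain ⟨C, hC⟩ : ∃ C, C = 8 * Λ := ⟨_, rfl⟩
  obtain ⟨M, hM⟩ : ∃ M, M = C₀ + 8 * C₀ ^ 3 := ⟨_, rfl⟩
  obtain ⟨C₂, hC₂⟩ : ∃ C₂, C₂ = m + 8 * M * (m + 1) := ⟨_, rfl⟩
  obtain ⟨κ, hκ⟩ : ∃ κ, κ = 288 * C₀ ^ 3 * C₂ := ⟨_, rfl⟩
  obtain ⟨D, hD⟩ : ∃ D, D = 1 + 4 * C + 2 * κ + 2 * C₂ := ⟨_, rfl⟩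
  have hm0 : 0 < m := by rw [hm]; positivity
  have hC0 : 0 < C := by rw [hC]; positivity
  have hM0 : 0 < M := by rw [hM]; positivity
  have hC₂0 : 0 < C₂ := by rw [hC₂]; positivity
  have hκ0 : 0 < κ := by rw [hκ]; positivity
  have hD0 : 0 < D := by rw [hD]; positivity
  refine ⟨η, hη, hηρ, min (η / 4) (min 1 (min (1 / (40 * Λ)) (min (1 / (2 * M))
    (Real.exp (-(2 * m * (2 + D))))))), by positivity, (min_le_right _ _).trans (min_le_left _ _),
    by linarith [min_le_left (η / 4) (min 1 (min (1 / (40 * Λ)) (min (1 / (2 * M))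
      (Real.exp (-(2 * m * (2 + D)))))))], ?_⟩
  intro p hp r ε q hr hε0 hrε4 hε hq
  simp only [lt_min_iff] at hε
  obtain ⟨hεη, hε1, hεΛ, hεM, hεD⟩ := hε
  rw [lt_div_iff₀ (by positivity)] at hεΛ hεM
  have hrε : r ≤ ε := hrε4.trans (pow_le_of_le_one hε0.le hε1.le (by norm_num))
  have hε2 : ε ^ 2 ≤ ε := pow_le_of_le_one hε0.le hε1.le (by norm_num)
  have hεr : ε * r ≤ ε ^ 2 := by
    rw [sq]
    exact mul_le_mul_of_nonneg_left hrε hε0.le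
  have hmem : ∀ y, y ∈ closedGeodesicBall p (ε ^ 2 / 2) → y ∈ geodesicBall x₀ η := by
    intro y hy
    calc edist y x₀ ≤ edist y p + edist p x₀ := edist_triangle _ _ _
      _ < ENNReal.ofReal (η / 2) + ENNReal.ofReal (η / 2) :=
        ENNReal.add_lt_add (hy.trans_lt ((ENNReal.ofReal_lt_ofReal_iff (by positivity)).2
          (by linarith))) hp
      _ = ENNReal.ofReal η := by rw [← ENNReal.ofReal_add (by positivity) (by positivity)]; ring_nf
  -- the centres, `p` being the one with index `0`
  set P : Fin (J + 1) → N := Fin.cons p q with hP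
  have hPp : ∀ i, edist (P i) p ≤ ENNReal.ofReal (ε * r / 2) := by
    intro i
    refine Fin.cases ?_ (fun j ↦ ?_) i
    · simp [hP]
    · exact hq j
  have hPη : ∀ i, P i ∈ geodesicBall x₀ η := fun i ↦
    hmem _ ((hPp i).trans (ENNReal.ofReal_le_ofReal (by linarith)))
  have hpη : p ∈ geodesicBall x₀ η := hPη 0
  have hηδ : geodesicBall x₀ η ⊆ geodesicBall x₀ δ := fun y hy ↦
    lt_of_lt_of_le hy (ENNReal.ofReal_le_ofReal (by linarith [h.ρ_le, h.ρ_pos]))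
  have hPr : ∀ i, rdist (P i) p ≤ ε * r / 2 := fun i ↦
    ENNReal.toReal_le_of_le_ofReal (by positivity) (hPp i)
  obtain ⟨L, hL⟩ : ∃ L, L = Real.log (ε / r) := ⟨_, rfl⟩
  -- `L` is large because `r ≤ ε ^ 2` gives `ε / r ≥ 1 / ε`
  have hLD : 2 * m * (2 + D) ≤ L := by
    have h1 : Real.exp (2 * m * (2 + D)) ≤ ε / r := by
      rw [le_div_iff₀ hr]
      have h2 : ε * Real.exp (2 * m * (2 + D)) ≤ 1 := by
        have := mul_le_mul_of_nonneg_right hεD.le (Real.exp_pos (2 * m * (2 + D))).le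
        rwa [← Real.exp_add, neg_add_cancel, Real.exp_zero] at this
      have h3 : r ≤ ε ^ 2 := hrε4.trans (pow_le_pow_of_le_one hε0.le hε1.le (by norm_num))
      calc Real.exp (2 * m * (2 + D)) * r ≤ Real.exp (2 * m * (2 + D)) * ε ^ 2 :=
            mul_le_mul_of_nonneg_left h3 (Real.exp_pos _).le
        _ = ε * Real.exp (2 * m * (2 + D)) * ε := by ring
        _ ≤ ε := mul_le_of_le_one_left hε0.le h2
    rw [hL]
    exact (Real.le_log_iff_exp_le (by positivity)).2 h1
  have hL0 : 0 < L := lt_of_lt_of_le (by positivity) hLD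
  obtain ⟨c, hc⟩ : ∃ c, c = 1 / ((m + 1) * L) := ⟨_, rfl⟩
  have hc0 : 0 < c := by rw [hc]; positivity
  have hcL : c * ((m + 1) * L) = 1 := by rw [hc]; field_simp
  have hcard : m = (Fintype.card (Fin (J + 1)) : ℝ) := by simp [hm]
  obtain ⟨u, hu⟩ : ∃ u : N → ℝ, u = fun y ↦ barrier C (κ * r ^ 2) c (Real.log (ε ^ 2) + D) M 0
      fun i ↦ quadDist x₀ (P i) y := ⟨_, rfl⟩
  refine ⟨u, fun x hx hxp hxq ↦ ?_⟩
  have hxη := hmem x hx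
  obtain ⟨d, hd⟩ : ∃ d : Fin (J + 1) → ℝ, d = fun i ↦ rdist x (P i) := ⟨_, rfl⟩
  obtain ⟨s, hs⟩ : ∃ s : Fin (J + 1) → ℝ, s = fun i ↦ quadDist x₀ (P i) x := ⟨_, rfl⟩
  have hdi : ∀ i, d i = rdist x (P i) := fun i ↦ by rw [hd]
  have hd00 : d 0 = rdist x p := hdi 0
  have hsi : ∀ i, quadDist x₀ (P i) x = s i := fun i ↦ by rw [hs]
  have hdr : ∀ i, r ^ 2 ≤ d i := by
    intro i
    rw [hdi]
    refine Fin.cases hxp hxq i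
  have hd0 : ∀ i, 0 < d i := fun i ↦ lt_of_lt_of_le (by positivity) (hdr i)
  have hxp2 : rdist x p ≤ ε ^ 2 / 2 := ENNReal.toReal_le_of_le_ofReal (by positivity) hx
  have hfin : ∀ y ∈ geodesicBall x₀ η, ∀ z ∈ geodesicBall x₀ η, edist y z ≠ ⊤ :=
    fun y hy z hz ↦ edist_ne_top_of_mem_geodesicBall hy hz
  have hdp : ∀ i, d i ≤ rdist x p + ε * r / 2 := by
    intro i
    have := rdist_triangle (hfin x hxη p hpη) (hfin p hpη (P i) (hPη i))
    rw [rdist_comm p] at this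
    rw [hdi]
    linarith [hPr i]
  have hdp2 : ∀ i, rdist x p ≤ d i + ε * r / 2 := by
    intro i
    have := rdist_triangle (hfin x hxη (P i) (hPη i)) (hfin (P i) (hPη i) p hpη)
    rw [hdi]
    linarith [hPr i]
  have hdj : ∀ j i, d i ≤ d j + ε * r := fun j i ↦ by linarith [hdp i, hdp2 j]
  have hdε : ∀ i, d i ≤ ε ^ 2 := fun i ↦ by linarith [hdp i]
  have hd1 : ∀ i, d i ≤ 1 := fun i ↦ by linarith [hdε i]
  have hb1 : ∀ i, d i ^ 2 ≤ 2 * s i := fun i ↦ by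
    rw [hdi, hs]
    exact (h.quadDist_bounds (hηδ (hPη i)) (hηδ hxη)).1
  have hb2 : ∀ i, s i ≤ 2 * d i ^ 2 := fun i ↦ by
    rw [hdi, hs]
    exact (h.quadDist_bounds (hηδ (hPη i)) (hηδ hxη)).2
  have hs0 : ∀ i, 0 < s i := fun i ↦ by linarith [hb1 i, pow_pos (hd0 i) 2]
  have hsmooth : ∀ i, ContMDiffAt (𝓡 2) 𝓘(ℝ, ℝ) 2 (quadDist x₀ (P i)) x := fun i ↦
    contMDiffAt_quadDist _ (h.mem_source x (hηδ hxη))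
  have hspos : ∀ i, 0 < quadDist x₀ (P i) x := fun i ↦ by rw [hsi]; exact hs0 i
  have hval : u x = barrier C (κ * r ^ 2) c (Real.log (ε ^ 2) + D) M 0 s := by rw [hu, hs]
  have hlin : ∀ j, barrier C (κ * r ^ 2) c (Real.log (ε ^ 2) + D) M 0 s ≤
      c * (C₂ * (d j / r ^ 2 - 2)) := fun j ↦
    barrier_le_linear hC0.le hκ0.le hM0.le hr hrε hε1.le hL hc0.le (by rwa [← hcard])
      (by rwa [← hcard]) hD hdr hd1 hb1 hb2 j (hdj j)
  have hnonpos : ∀ j, d j ≤ 2 * r ^ 2 →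
      barrier C (κ * r ^ 2) c (Real.log (ε ^ 2) + D) M 0 s ≤ 0 := fun j hj ↦ by
    refine (hlin j).trans (mul_nonpos_of_nonneg_of_nonpos hc0.le
      (mul_nonpos_of_nonneg_of_nonpos hC₂0.le ?_))
    have : d j / r ^ 2 ≤ 2 := (div_le_iff₀ (by positivity)).2 hj
    linarith
  have htwo : barrier C (κ * r ^ 2) c (Real.log (ε ^ 2) + D) M 0 s ≤ 2 :=
    barrier_le_two hC0.le hκ0.le hM0.le hr hε0 hε1.le hc0.le (by linarith) (by linarith) hdr hdε
      hb1 hb2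
  refine ⟨by rw [hu]; exact contMDiffAt_barrier hsmooth hspos, ?_, fun hle ↦ ?_, fun j hj ↦ ?_,
    fun heq ↦ ?_, fun hux w hw0 hw ↦ ?_⟩
  · rwa [hval]
  · rw [hval]
    exact hnonpos 0 (hd00.trans_le hle)
  · rw [hval]
    exact hnonpos j.succ ((hdi _).trans_le hj)
  · rw [hval]
    have key := le_barrier (o := (0 : Fin (J + 1))) hC0.le hκ0.le hM0.le hr hε0 hL hc0.le
      (by rwa [← hcard]) (by rwa [← hcard]) (fun i ↦ by linarith [hdp2 i]) hb1
    rw [← hcard, hm] at key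
    convert key using 3
    ring
  · rw [hval] at hux ⊢
    obtain ⟨j, hj⟩ := exists_rdistSet_range_eq hJ q x
    have hsqrt := fun i ↦ sqrt_le_two_mul (hd0 i).le (hb2 i)
    have hsqrt2 := fun i ↦ le_two_mul_sqrt (hb1 i)
    have hsqrt0 : ∀ i, 0 < √(s i) := fun i ↦ Real.sqrt_pos.2 (hs0 i)
    have hΛd : ∀ i, Λ * d i ≤ 1 / 40 := fun i ↦ by
      linarith [mul_le_mul_of_nonneg_left ((hdε i).trans hε2) hΛ.le]
    have hprof : ∀ i, κ * r ^ 2 / (2 * √(s i) ^ 3) ≤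
        laplaceBeltrami (fun y ↦ profile C (κ * r ^ 2) (quadDist x₀ (P i) y)) x := by
      intro i
      obtain ⟨e1, e2⟩ := hest (P i) (hPη i) x hxη
      rw [← hdi] at e1 e2
      have key := le_laplaceBeltrami_profile (hsmooth i) (hspos i) hC0.le
        (k := κ * r ^ 2) (by positivity)
      rw [hsi] at key e2
      refine key ?_ (e1.trans ?_) (e2.trans ?_)
      · rw [hC]
        linarith [mul_le_mul_of_nonneg_left (hsqrt i) hΛ.le, hΛd i]
      · rw [hC]
        linarith [mul_le_mul_of_nonneg_left (hsqrt2 i) hΛ.le, mul_pos hΛ (hsqrt0 i)]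
      · rw [hC]
        exact (mul_le_mul_of_nonneg_left (pow_le_pow_left₀ (hd0 i).le (hsqrt2 i) 3) hΛ.le).trans_eq
          (by ring)
    have hlap0 : 3 ≤ laplaceBeltrami (quadDist x₀ (P 0)) x := by
      obtain ⟨e1, -⟩ := hest (P 0) (hPη 0) x hxη
      rw [← hdi] at e1
      linarith [(abs_le.1 e1).1, hΛd 0]
    have hpot := potential_mul_le (ρ := √(s j.succ)) hC₀ hC₂0.le hc0.le hM hκ hr hε0.le hε1.le
      hux.le htwo (hd0 j.succ) ((hlin j.succ).trans ?_) (rdist_nonneg x p)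
      (hd00.ge.trans (hdj _ _)) hw0 hw (hsqrt0 _) (hsqrt _)
    · rw [hu, laplaceBeltrami_barrier hsmooth hspos, hj,
        show rdist x (q j) = d j.succ from (hdi j.succ).symm]
      refine hpot.trans (add_le_add (mul_le_mul_of_nonneg_left ?_ hc0.le) ?_)
      · refine (hprof j.succ).trans (Finset.single_le_sum (f := fun i ↦
          laplaceBeltrami (fun y ↦ profile C (κ * r ^ 2) (quadDist x₀ (P i) y)) x)
          (fun i _ ↦ le_trans ?_ (hprof i)) (Finset.mem_univ _))
        have := hsqrt0 i
        positivity
      · linarith [mul_le_mul_of_nonneg_left hlap0 hM0.le]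
    · refine mul_le_mul_of_nonneg_left (mul_le_mul_of_nonneg_left ?_ hC₂0.le) hc0.le
      linarith

end Barrier

/-! ### The inequality near a point -/

section Spheres

variable {N : Type*} [EMetricSpace N]

lemma geodesicBall_subset_closedGeodesicBall (p : N) (s : ℝ) :
    geodesicBall p s ⊆ closedGeodesicBall p s := fun x hx ↦
  le_of_lt (show edist x p < ENNReal.ofReal s from hx)

lemma frontier_geodesicBall_subset (p : N) (s : ℝ) :
    frontier (geodesicBall p s) ⊆ closedGeodesicBall p s \ geodesicBall p s := by
  rw [frontier, (isOpen_geodesicBall p s).interior_eq]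
  exact sdiff_subset_sdiff_left (closure_minimal (geodesicBall_subset_closedGeodesicBall p s)
    (isClosed_closedGeodesicBall p s))

lemma rdist_eq_of_mem_diff {p x : N} {s : ℝ} (hs : 0 ≤ s)
    (hx : x ∈ closedGeodesicBall p s \ geodesicBall p s) : rdist x p = s := by
  have h : edist x p = ENNReal.ofReal s := le_antisymm hx.1 (not_lt.1 hx.2)
  rw [rdist, h, ENNReal.toReal_ofReal hs]

lemma isOpen_geodesicBall_diff {J : ℕ} (p : N) (s s' : ℝ) (q : Fin J → N) :
    IsOpen (geodesicBall p s \ (closedGeodesicBall p s' ∪ ⋃ j, closedGeodesicBall (q j) s')) :=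
  (isOpen_geodesicBall p s).sdiff ((isClosed_closedGeodesicBall p s').union
    (isClosed_iUnion_of_finite fun j ↦ isClosed_closedGeodesicBall (q j) s'))

lemma mem_geodesicBall_diff {J : ℕ} {p x : N} {s s' : ℝ} {q : Fin J → N} (hs' : 0 ≤ s')
    (hx : x ∈ geodesicBall p s) (hp : s' < rdist x p) (hq : ∀ j, s' < rdist x (q j)) :
    x ∈ geodesicBall p s \ (closedGeodesicBall p s' ∪ ⋃ j, closedGeodesicBall (q j) s') := by
  refine ⟨hx, ?_⟩
  rw [mem_union, mem_iUnion]
  rintro (h | ⟨j, h⟩)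
  · exact hp.not_ge (ENNReal.toReal_le_of_le_ofReal hs' h)
  · exact (hq j).not_ge (ENNReal.toReal_le_of_le_ofReal hs' h)

end Spheres

section Local

set_option linter.unusedSectionVars false

variable {N : Type*} [EMetricSpace N] [ChartedSpace (EuclideanSpace ℝ (Fin 2)) N]
  [IsManifold (𝓡 2) ∞ N] [RiemannianBundle (fun x : N ↦ TangentSpace (𝓡 2) x)]
  [IsContMDiffRiemannianBundle (𝓡 2) ∞ (EuclideanSpace ℝ (Fin 2))
    (fun x : N ↦ TangentSpace (𝓡 2) x)]

/-- The Harnack inequality with constant `C` around the point `p`, at all scales `ε < ε₀`. -/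
def HarnackBelow (J : ℕ) (C₀ C : ℝ) (p : N) (ε₀ : ℝ) : Prop :=
  ∀ (r ε : ℝ) (q : Fin J → N) (w : N → ℝ), 0 < r → r ^ (1 / 4 : ℝ) < ε → ε < ε₀ →
    (∀ j, q j ∈ closedGeodesicBall p (ε * r / 2)) →
    MinimalCondition p r (range q) (holedAnnulus p r ε q) C₀ w →
    ∃ a b : ℝ, IsGreatest (w '' frontier (geodesicBall p (ε ^ 2 / 2))) a ∧
      IsLeast (w '' frontier (geodesicBall p (ε * r))) b ∧ a ≤ C * b

/-- The gradient bound gives the Harnack inequality on the outer sphere, which is far from the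
centres compared with its radius. -/
lemma IsNormalizedChart.le_exp_mul_of_minimalCondition {x₀ : N} {B : Plane ≃L[ℝ] ℂ} {δ ρ : ℝ}
    (h : IsNormalizedChart x₀ B δ ρ) {J : ℕ} (hJ : 0 < J) {C₀ : ℝ} (hC₀ : 0 < C₀) {p : N}
    (hp : p ∈ geodesicBall x₀ ρ) {r ε : ℝ} (hr : 0 < r) (hrε : 4 * r ≤ ε) (hε : ε ^ 2 < ρ)
    {q : Fin J → N} (hq : ∀ j, q j ∈ closedGeodesicBall p (ε * r / 2)) {w : N → ℝ}
    (hw : MinimalCondition p r (range q) (holedAnnulus p r ε q) C₀ w) {x y : N}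
    (hx : x ∈ closedGeodesicBall p (ε ^ 2 / 2) \ geodesicBall p (ε ^ 2 / 2))
    (hy : y ∈ closedGeodesicBall p (ε ^ 2 / 2) \ geodesicBall p (ε ^ 2 / 2)) :
    w x ≤ Real.exp (40 * C₀) * w y := by
  have hε0 : 0 < ε := by linarith
  have hεr : 4 * (ε * r) ≤ ε ^ 2 := by nlinarith
  have hr2 : 16 * r ^ 2 ≤ ε ^ 2 := by nlinarith
  have hpos2 : 0 < r ^ 2 := by positivity
  have hann : ∀ z ∈ geodesicBall x₀ δ, ε ^ 2 / 2 / 2 ≤ rdist z p → rdist z p ≤ 3 / 2 * (ε ^ 2 / 2) →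
      z ∈ holedAnnulus p r ε q ∧ ε ^ 2 / 8 ≤ rdistSet z (range q) := by
    intro z hz h1 h2
    have hzp := edist_ne_top_of_mem_geodesicBall hz (h.mem_ball_of_mem hp)
    have hzq : ∀ j, ε ^ 2 / 8 ≤ rdist z (q j) := by
      intro j
      have hqp : edist (q j) p ≠ ⊤ := ne_top_of_le_ne_top ENNReal.ofReal_ne_top (hq j)
      have h3 := rdist_triangle (x := z) (z := p) (ne_top_of_le_ne_top (ENNReal.add_ne_top.2
        ⟨hzp, hqp⟩) (edist_triangle_right z (q j) p)) hqp
      have h4 : rdist (q j) p ≤ ε * r / 2 := ENNReal.toReal_le_of_le_ofReal (by positivity) (hq j)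
      linarith
    refine ⟨mem_geodesicBall_diff hpos2.le ((mem_geodesicBall_iff_rdist hzp).2 (by linarith))
      (by linarith) fun j ↦ by linarith [hzq j], ?_⟩
    obtain ⟨j, hj⟩ := exists_rdistSet_range_eq hJ q z
    exact (hzq j).trans_eq hj.symm
  have hball : ∀ z ∈ closedGeodesicBall p (ε ^ 2 / 2) \ geodesicBall p (ε ^ 2 / 2),
      z ∈ geodesicBall x₀ δ ∧ rdist z p = ε ^ 2 / 2 := fun z hz ↦
    ⟨h.mem_ball_of_edist_le hp (by linarith) hz.1, rdist_eq_of_mem_diff (by positivity) hz⟩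
  have hpos : ∀ z ∈ closedGeodesicBall p (ε ^ 2 / 2) \ geodesicBall p (ε ^ 2 / 2), 0 < w z := by
    intro z hz
    obtain ⟨h1, h2⟩ := hball z hz
    exact hw.pos z (hann z h1 (by linarith) (by linarith)).1
  -- the annulus lies at distance at least a quarter of its radius from all `q j`, hence `4 * C₀`
  have key := h.abs_sub_le_of_norm_grad_le (f := fun z ↦ Real.log (w z)) (t := ε ^ 2 / 2)
    (M := 4 * C₀) hp (by positivity) (by linarith) (by positivity) (fun z hz h1 h2 ↦ ?_)
    (hball x hx).1 (hball x hx).2 (hball y hy).1 (hball y hy).2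
  · have h1 : Real.log (w x) ≤ 40 * C₀ + Real.log (w y) := by linarith [le_of_abs_le key]
    rwa [Real.log_le_iff_le_exp (hpos x hx), Real.exp_add, Real.exp_log (hpos y hy)] at h1
  · obtain ⟨h3, h4⟩ := hann z hz h1 h2
    have hwz : ContMDiffAt (𝓡 2) 𝓘(ℝ, ℝ) 2 w z :=
      hw.contMDiffOn.contMDiffAt ((isOpen_geodesicBall_diff p _ _ q).mem_nhds h3)
    have hlog : ContMDiffAt 𝓘(ℝ, ℝ) 𝓘(ℝ, ℝ) 2 Real.log (w z) :=
      contMDiffAt_iff_contDiffAt.2 (Real.contDiffAt_log.2 (hw.pos z h3).ne')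
    refine ⟨(ContMDiffAt.comp z hlog hwz).mdifferentiableAt (by norm_num), ?_⟩
    have h5 := hw.log_gradient z h3
    have h6 := mul_le_mul_of_nonneg_right h4 (norm_nonneg (grad (fun y ↦ Real.log (w y)) z))
    rw [le_div_iff₀ (by positivity)]
    linarith

/-- Near any point the inequality holds with a constant that depends on `J` and `C₀` only; the
surface enters through `ε₀`. The proof compares `w` with the barrier, scaled by the minimum of `w` over the
outer sphere. -/
lemma exists_harnackBelow [IsRiemannianManifold (𝓡 2) N] (x₀ : N) {J : ℕ} (hJ : 0 < J) {C₀ : ℝ}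
    (hC₀ : 0 < C₀) : ∃ U ∈ nhds x₀, ∃ ε₀ : ℝ, 0 < ε₀ ∧
      ∀ p ∈ U, HarnackBelow J C₀ (4 * (J + 2) * Real.exp (40 * C₀)) p ε₀ := by
  obtain ⟨B, δ, ρ, h⟩ := exists_isNormalizedChart x₀
  obtain ⟨η, hη, hηρ, ε₀, hε₀, hε₀1, hε₀η, hbar⟩ := h.exists_barrier hJ hC₀
  refine ⟨geodesicBall x₀ (η / 2), (isOpen_geodesicBall _ _).mem_nhds
    (self_mem_geodesicBall (by positivity)), min ε₀ (1 / 4), by positivity, ?_⟩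
  intro p hp r ε q w hr hrε hε hq hw
  rw [lt_min_iff] at hε
  obtain ⟨hε, hε4⟩ := hε
  have hε0 : 0 < ε := (Real.rpow_nonneg hr.le _).trans_lt hrε
  have hr4 : r ≤ ε ^ 4 := by
    have h1 := pow_le_pow_left₀ (Real.rpow_nonneg hr.le _) hrε.le 4
    rwa [← Real.rpow_natCast, ← Real.rpow_mul hr.le,
      show (1 / 4 : ℝ) * ((4 : ℕ) : ℝ) = 1 by norm_num, Real.rpow_one] at h1
  have h4r : 4 * r ≤ ε := by
    have h1 : ε ^ 3 ≤ (1 / 4) ^ 3 := pow_le_pow_left₀ hε0.le hε4.le 3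
    have h2 : ε ^ 4 ≤ (1 / 4) ^ 3 * ε := by
      rw [pow_succ]
      exact mul_le_mul_of_nonneg_right h1 hε0.le
    linarith
  have hε2 : ε ^ 2 ≤ ε := pow_le_of_le_one hε0.le (by linarith) (by norm_num)
  have hεr : 4 * (ε * r) ≤ ε ^ 2 := by nlinarith
  have hr2 : 4 * r ^ 2 ≤ ε * r := by nlinarith
  have hpos2 : 0 < r ^ 2 := by positivity
  have hpos3 : 0 < ε * r := by positivity
  have hpos4 : 0 < ε ^ 2 := by positivity
  have hpρ : p ∈ geodesicBall x₀ ρ := lt_of_lt_of_le hp (ENNReal.ofReal_le_ofReal (by linarith))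
  obtain ⟨u, hu⟩ := hbar p hp r ε q hr hε0 hr4 hε hq
  -- distances to the points `q j` and to `p` differ by at most `ε r / 2`.
  have hqd : ∀ x ∈ closedGeodesicBall p (ε ^ 2 / 2), ∀ j,
      rdist x p - ε * r / 2 ≤ rdist x (q j) := by
    intro x hx j
    have hxp : edist x p ≠ ⊤ := ne_top_of_le_ne_top ENNReal.ofReal_ne_top hx
    have hqp : edist (q j) p ≠ ⊤ := ne_top_of_le_ne_top ENNReal.ofReal_ne_top (hq j)
    have h3 := rdist_triangle (x := x) (z := p) (ne_top_of_le_ne_top (ENNReal.add_ne_top.2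
      ⟨hxp, hqp⟩) (edist_triangle_right x (q j) p)) hqp
    have h4 : rdist (q j) p ≤ ε * r / 2 := ENNReal.toReal_le_of_le_ofReal (by positivity) (hq j)
    linarith
  have hlt : ∀ x ∈ closedGeodesicBall p (ε ^ 2 / 2), x ∈ geodesicBall p (ε ^ 2) := fun x hx ↦
    lt_of_le_of_lt hx ((ENNReal.ofReal_lt_ofReal_iff hpos4).2 (by linarith))
  have hcompact : IsCompact (closedGeodesicBall p (ε ^ 2 / 2)) :=
    h.isCompact_closedGeodesicBall hpρ (by positivity) (by linarith)
  have hwsmooth : ∀ x ∈ holedAnnulus p r ε q, ContMDiffAt (𝓡 2) 𝓘(ℝ, ℝ) 2 w x := fun x hx ↦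
    hw.contMDiffOn.contMDiffAt ((isOpen_geodesicBall_diff p _ _ q).mem_nhds hx)
  have hfar : ∀ x ∈ closedGeodesicBall p (ε ^ 2 / 2), ε * r ≤ rdist x p →
      x ∈ holedAnnulus p r ε q := fun x hx hxp ↦
    mem_geodesicBall_diff hpos2.le (hlt x hx) (by linarith) fun j ↦ by linarith [hqd x hx j]
  -- the minimum `w y₀` over the outer sphere.
  set S := closedGeodesicBall p (ε ^ 2 / 2) \ geodesicBall p (ε ^ 2 / 2) with hS
  have hSd : ∀ x ∈ S, rdist x p = ε ^ 2 / 2 := fun x hx ↦ rdist_eq_of_mem_diff (by positivity) hx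
  have hSmem : ∀ x ∈ S, x ∈ holedAnnulus p r ε q := fun x hx ↦
    hfar x hx.1 (by linarith [hSd x hx])
  have hfront : (frontier (geodesicBall p (ε ^ 2 / 2))).Nonempty :=
    h.frontier_geodesicBall_nonempty hpρ (by positivity) (by linarith)
  have hSne : S.Nonempty := hfront.mono (frontier_geodesicBall_subset p _)
  obtain ⟨y₀, hy₀, hmin⟩ := (hcompact.diff (isOpen_geodesicBall p _)).exists_isMinOn hSne
    (fun x hx ↦ (hwsmooth x (hSmem x hx)).continuousAt.continuousWithinAt)
  have hA : 0 < w y₀ := hw.pos y₀ (hSmem y₀ hy₀)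
  -- comparison on the closed region at distance at least `2 r ^ 2` from all centres.
  set K := closedGeodesicBall p (ε ^ 2 / 2) \
    (geodesicBall p (2 * r ^ 2) ∪ ⋃ j, geodesicBall (q j) (2 * r ^ 2)) with hK
  have hKc : IsCompact K := hcompact.diff ((isOpen_geodesicBall p _).union
    (isOpen_iUnion fun j ↦ isOpen_geodesicBall (q j) _))
  have hfin : ∀ x ∈ closedGeodesicBall p (ε ^ 2 / 2), edist x p ≠ ⊤ ∧ ∀ j, edist x (q j) ≠ ⊤ :=
    fun x hx ↦ ⟨ne_top_of_le_ne_top ENNReal.ofReal_ne_top hx, fun j ↦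
      ne_top_of_le_ne_top (ENNReal.add_ne_top.2 ⟨ne_top_of_le_ne_top ENNReal.ofReal_ne_top hx,
        ne_top_of_le_ne_top ENNReal.ofReal_ne_top (hq j)⟩) (edist_triangle_right x (q j) p)⟩
  have hKmem : ∀ x ∈ closedGeodesicBall p (ε ^ 2 / 2),
      x ∈ K ↔ 2 * r ^ 2 ≤ rdist x p ∧ ∀ j, 2 * r ^ 2 ≤ rdist x (q j) := by
    intro x hx
    obtain ⟨h1, h2⟩ := hfin x hx
    rw [hK, mem_sdiff, mem_union, mem_iUnion, mem_geodesicBall_iff_rdist h1]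
    simp only [hx, true_and, not_or, not_lt, not_exists]
    exact and_congr_right fun _ ↦ forall_congr' fun j ↦ by
      rw [mem_geodesicBall_iff_rdist (h2 j), not_lt]
  have hKΞ : ∀ x ∈ K, x ∈ holedAnnulus p r ε q := by
    intro x hx
    obtain ⟨h1, h2⟩ := (hKmem x hx.1).1 hx
    exact mem_geodesicBall_diff hpos2.le (hlt x hx.1) (by linarith) fun j ↦ by linarith [h2 j]
  have hKu := fun x (hx : x ∈ K) ↦ hu x hx.1 (by linarith [((hKmem x hx.1).1 hx).1])
    fun j ↦ by linarith [((hKmem x hx.1).1 hx).2 j]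
  have hcomp : ∀ x ∈ K, w y₀ / 2 * u x ≤ w x := by
    intro x hx
    refine le_of_laplaceBeltrami_comparison hKc (v := fun x ↦ w y₀ / 2 * u x)
      (fun x hx ↦ ((hKu x hx).1.continuousAt.const_mul _).continuousWithinAt)
      (fun x hx ↦ (hwsmooth x (hKΞ x hx)).continuousAt.continuousWithinAt) ?_ hx
    intro x hx hlt
    obtain ⟨hu1, hu2, hu3, hu4, -, hu5⟩ := hKu x hx
    have hwx := hw.pos x (hKΞ x hx)
    have hux : 0 < u x := pos_of_mul_pos_right (hwx.trans hlt) (by positivity)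
    have hxS : x ∈ geodesicBall p (ε ^ 2 / 2) := by
      by_contra hxS
      have h1 : w y₀ ≤ w x := hmin (show x ∈ S from ⟨hx.1, hxS⟩)
      have h2 : w y₀ / 2 * u x ≤ w y₀ / 2 * 2 := mul_le_mul_of_nonneg_left hu2 (by positivity)
      linarith
    have hxp : 2 * r ^ 2 < rdist x p := lt_of_not_ge fun hle ↦ (hu3 hle).not_gt hux
    have hxq : ∀ j, 2 * r ^ 2 < rdist x (q j) := fun j ↦
      lt_of_not_ge fun hle ↦ (hu4 j hle).not_gt hux
    have hnhds : K ∈ nhds x := by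
      refine Filter.mem_of_superset ((isOpen_geodesicBall_diff p (ε ^ 2 / 2) (2 * r ^ 2) q).mem_nhds
        (mem_geodesicBall_diff (by positivity) hxS hxp hxq)) ?_
      exact sdiff_subset_sdiff (geodesicBall_subset_closedGeodesicBall p _)
        (union_subset_union (geodesicBall_subset_closedGeodesicBall p _)
          (iUnion_mono fun j ↦ geodesicBall_subset_closedGeodesicBall (q j) _))
    have hV := hu5 hux (w x) hwx.le (hw.quadratic_growth x (hKΞ x hx))
    refine ⟨hnhds, contMDiffAt_const.mul hu1, hwsmooth x (hKΞ x hx),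
      C₀ + C₀ * w x ^ 2 / rdistSet x (range q) ^ 4, by positivity, ?_, ?_⟩
    · refine (le_abs_self _).trans ((hw.laplacian x (hKΞ x hx)).trans_eq ?_)
      ring
    · rw [laplaceBeltrami_const_mul hu1, mul_left_comm]
      exact mul_le_mul_of_nonneg_left hV (by positivity)
  -- points of the inner sphere.
  have hinner : ∀ x ∈ frontier (geodesicBall p (ε * r)),
      x ∈ closedGeodesicBall p (ε ^ 2 / 2) ∧ rdist x p = ε * r := by
    intro x hx
    have hx2 := frontier_geodesicBall_subset p _ hx
    exact ⟨le_trans hx2.1 (ENNReal.ofReal_le_ofReal (by linarith)),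
      rdist_eq_of_mem_diff hpos3.le hx2⟩
  obtain ⟨a, ha⟩ := ((hcompact.of_isClosed_subset isClosed_frontier
    ((frontier_geodesicBall_subset p _).trans sdiff_subset)).image_of_continuousOn (f := w)
    fun x hx ↦ (hwsmooth x (hSmem x (frontier_geodesicBall_subset p _ hx)))
      |>.continuousAt.continuousWithinAt).exists_isGreatest (hfront.image w)
  obtain ⟨b, hb⟩ := ((hcompact.of_isClosed_subset isClosed_frontier
    fun x hx ↦ (hinner x hx).1).image_of_continuousOn (f := w)
    fun x hx ↦ (hwsmooth x (hfar x (hinner x hx).1 (hinner x hx).2.ge))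
      |>.continuousAt.continuousWithinAt).exists_isLeast
    ((h.frontier_geodesicBall_nonempty hpρ hpos3 (by linarith)).image w)
  refine ⟨a, b, ha, hb, ?_⟩
  obtain ⟨x, hx, rfl⟩ := ha.1
  obtain ⟨y, hy, rfl⟩ := hb.1
  obtain ⟨hy1, hy2⟩ := hinner y hy
  have hyK : y ∈ K := (hKmem y hy1).2
    ⟨by linarith, fun j ↦ by linarith [hqd y hy1 j]⟩
  have h1 := h.le_exp_mul_of_minimalCondition hJ hC₀ hpρ hr h4r (by linarith) hq hw
    (frontier_geodesicBall_subset p _ hx) hy₀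
  have h2 := mul_le_mul_of_nonneg_left ((hKu y hyK).2.2.2.2.1 hy2) (half_pos hA).le
  have h3 : w y₀ ≤ 4 * (J + 2) * w y := by
    have h4 := h2.trans (hcomp y hyK)
    rw [mul_one_div, div_le_iff₀ (by positivity)] at h4
    linarith
  calc w x ≤ Real.exp (40 * C₀) * w y₀ := h1
    _ ≤ Real.exp (40 * C₀) * (4 * (J + 2) * w y) :=
      mul_le_mul_of_nonneg_left h3 (Real.exp_pos _).le
    _ = 4 * (J + 2) * Real.exp (40 * C₀) * w y := by ring

lemma exists_harnackBelow_of_isCompact [IsRiemannianManifold (𝓡 2) N] {K : Set N}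
    (hK : IsCompact K) {J : ℕ} (hJ : 0 < J) {C₀ : ℝ} (hC₀ : 0 < C₀) : ∃ ε₀ : ℝ, 0 < ε₀ ∧
      ∀ p ∈ K, HarnackBelow J C₀ (4 * (J + 2) * Real.exp (40 * C₀)) p ε₀ := by
  refine hK.induction_on (p := fun s ↦ ∃ ε₀ : ℝ, 0 < ε₀ ∧
      ∀ p ∈ s, HarnackBelow J C₀ (4 * (J + 2) * Real.exp (40 * C₀)) p ε₀)
    ⟨1, one_pos, fun p hp ↦ hp.elim⟩ ?_ ?_ ?_
  · rintro s t hst ⟨ε₀, h0, h⟩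
    exact ⟨ε₀, h0, fun p hp ↦ h p (hst hp)⟩
  · rintro s t ⟨ε₁, h1, hs⟩ ⟨ε₂, h2, ht⟩
    refine ⟨min ε₁ ε₂, lt_min h1 h2, ?_⟩
    rintro p (hp | hp) r ε q w hr hrε hε
    · exact hs p hp r ε q w hr hrε (hε.trans_le (min_le_left _ _))
    · exact ht p hp r ε q w hr hrε (hε.trans_le (min_le_right _ _))
  · intro x _
    obtain ⟨U, hU, h⟩ := exists_harnackBelow x hJ hC₀
    exact ⟨U, mem_nhdsWithin_of_mem_nhds hU, h⟩

end Local

end SurfaceHarnack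

end

open SurfaceHarnack in
theorem mainTheorem5 {N : Type*} [EMetricSpace N]
    [ChartedSpace (EuclideanSpace ℝ (Fin 2)) N] [IsManifold (𝓡 2) ∞ N]
    [RiemannianBundle (fun x : N ↦ TangentSpace (𝓡 2) x)]
    [IsContMDiffRiemannianBundle (𝓡 2) ∞ (EuclideanSpace ℝ (Fin 2))
      (fun x : N ↦ TangentSpace (𝓡 2) x)]
    [IsRiemannianManifold (𝓡 2) N]
    (K : Set N) (hK : IsCompact K) (J : ℕ) (hJ : 0 < J) (C₀ : ℝ) (hC₀ : 0 < C₀) :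
    ∃ ε₀ : ℝ, 0 < ε₀ ∧ ∃ C : ℝ, 0 < C ∧
      ∀ (p : N) (r ε : ℝ) (q : Fin J → N) (w : N → ℝ),
        p ∈ K → 0 < r → r ^ (1 / 4 : ℝ) < ε → ε < ε₀ →
        (∀ j, r ^ 2 ≤ rdist (q j) p ∧ q j ∈ closedGeodesicBall p (ε * r / 2)) →
        MinimalCondition p r (Set.range q) (holedAnnulus p r ε q) C₀ w →
        ∃ a b : ℝ,
          IsGreatest (w '' frontier (geodesicBall p (ε ^ 2 / 2))) a ∧
          IsLeast (w '' frontier (geodesicBall p (ε * r))) b ∧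
          a ≤ C * b := by
  obtain ⟨ε₀, h0, h⟩ := exists_harnackBelow_of_isCompact hK hJ hC₀
  refine ⟨ε₀, h0, 4 * (J + 2) * Real.exp (40 * C₀), by positivity, ?_⟩
  intro p r ε q w hp hr hrε hε hq hw
  exact h p hp r ε q w hr hrε hε (fun j ↦ (hq j).2) hw
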